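/- Let $\Bbbk$ be an algebraically closed field of characteristic $0$ and let $H$ be a finite-dimensional Hopf algebra over $\Bbbk$, with group $G(H)$ of group-like elements. Let $H_0$ be the coradical of $H$ (the sum of all simple subcoalgebras), fix a coalgebra projection $\pi\colon H\to H_0$, and put $\rho_L=(\pi\otimes\mathrm{id})\Delta$ and $\rho_R=(\mathrm{id}\otimes\pi)\Delta$, so that $H$ is an $H_0$-bicomodule. Define $P_0=0$ and, for $n\ge 1$, $$P_n=\Big\{c\in H \;\Big|\; \Delta(c)-\rho_L(c)-\rho_R(c)\in\sum_{1\le i\le n-1}P_i\otimes P_{n-i}\Big\}.$$ Every simple subcoalgebra $D$ has dimension $d_D^2$ for some $d_D\ge 1$; let $V_D$ (resp. $V_D^*$) be its simple left (resp. right) comodule. For simple subcoalgebras $D,E$ let $P_n^{D,E}$ be the sum of all simple $H_0$-subbicomodules of $P_n$ isomorphic to $V_D\otimes V_E^*$, and for $n\ge1$ choose an $H_0$-subbicomodule $Q_n^{D,E}$, a direct sum of simple bicomodules isomorphic to $V_D\otimes V_E^*$, with $P_n^{D,E}=P_{n-1}^{D,E}\oplus Q_n^{D,E}$. The blocks of $H$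 are $$B_n^{d_1,d_2}=\bigoplus_{d_D=d_1,\ d_E=d_2}Q_n^{D,E}\quad(n\ge 1),\qquad B_0^{d,d}=\bigoplus_{d_D=d}D,\qquad B_0^{d_1,d_2}=0\quad (d_1\neq d_2).$$ For all choices of $\pi$ and of the $Q_n^{D,E}$, there is a largest $n\ge 0$ with $B_n^{1,1}\neq 0$; call it $m$. Let $l$ be the smallest $n\ge 1$ with $B_n^{1,1}\ne0$ (if there is one). Then: (1) $\dim B_m^{1,1}=|G(H)|$. Moreover, $H$ has a basis, each of whose elements lies in some block, that contains an element $u\in B_m^{1,1}$ whose dual basis functional $u^*$ is a left integral of $H^*$, i.e. $f*u^*=f(1)\,u^*$ for all $f\in H^*$, where $*$ is the convolution product. (2) If $l$ exists and $l<m$, $H$ is not cosemisimple (i.e. $H\ne H_0$), and $H$ has no nontrivial skew-primitives (i.e. whenever $g,h\in G(H)$ and $\Delta(x)=g\otimes x+x\otimes h$, one has $x\in\Bbbk(g-h)$), then $l>1$ and there exist integers $d_1,d_2,d_3,d_4>1$ and $l'>l$ such that $B^{d_1,1}_{l'}$, $B^{1,d_2}_{l'}$, $B^{d_1,d_3}_{l'-1}$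 and $B^{d_4,d_2}_{l'-1}$ are all nonzero. -/

import Mathlib

open scoped TensorProduct

noncomputable section

namespace HopfBlock

section Coalg

variable {k C : Type*} [Field k] [AddCommGroup C] [Module k C]

/-- The image of `V ⊗ W` in `C ⊗ C`, for subspaces `V` and `W` of `C`. -/
def tens (V W : Submodule k C) : Submodule k (C ⊗[k] C) :=
  Submodule.map₂ (TensorProduct.mk k C C) V W

variable [Coalgebra k C]

/-- `Δ(D) ⊆ D ⊗ D`. -/
def IsSubcoalgebra (D : Submodule k C) : Prop :=
  ∀ x ∈ D, Coalgebra.comul (R := k) x ∈ tens D D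

/-- A nonzero subcoalgebra without proper nonzero subcoalgebras. -/
structure IsSimpleSubcoalgebra (D : Submodule k C) : Prop where
  isSubcoalgebra : IsSubcoalgebra D
  ne_bot : D ≠ ⊥
  eq_bot_or_eq : ∀ E : Submodule k C, E ≤ D → IsSubcoalgebra E → E = ⊥ ∨ E = D

variable (k C) in
/-- The coradical `C₀`: the sum of all simple subcoalgebras. -/
def coradical : Submodule k C :=
  sSup {D | IsSimpleSubcoalgebra D}

variable (k C) in
/-- `C` equals its coradical. -/
def IsCosemisimple : Prop := coradical k C = ⊤

variable (k C) in
/-- Every `x` with `Δ(x) = g ⊗ x + x ⊗ h`, where `g` and `h` are group-like, is a scalar multiple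
of `g - h`. -/
def NoNontrivialSkewPrimitives : Prop :=
  ∀ g h x : C, IsGroupLikeElem k g → IsGroupLikeElem k h →
    Coalgebra.comul (R := k) x = g ⊗ₜ[k] x + x ⊗ₜ[k] h → x ∈ Submodule.span k {g - h}

/-- `C_{0,d}`: the sum of the simple subcoalgebras of dimension `d ^ 2`. -/
def coradicalPart (k C : Type*) [Field k] [AddCommGroup C] [Module k C] [Coalgebra k C] (d : ℕ) :
    Submodule k C :=
  ⨆ (D : Submodule k C) (_ : IsSimpleSubcoalgebra D) (_ : Module.finrank k D = d ^ 2), D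

/-- A standard basis of `D`: a basis `e i j` with `Δ(e i j) = ∑ l, e i l ⊗ e l j` and
`ε(e i j) = δ i j`. -/
structure IsStandardBasis (D : Submodule k C) {d : ℕ} (e : Fin d → Fin d → C) : Prop where
  linearIndependent : LinearIndependent k (fun p : Fin d × Fin d => e p.1 p.2)
  span_eq : Submodule.span k (Set.range fun p : Fin d × Fin d => e p.1 p.2) = D
  comul_eq : ∀ i j, Coalgebra.comul (R := k) (e i j) = ∑ l, e i l ⊗ₜ[k] e l j
  counit_eq : ∀ i j, Coalgebra.counit (R := k) (e i j) = if i = j then 1 else 0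

/-- `ρ_L = (π ⊗ id) Δ`. -/
def rhoL (π : C →ₗ[k] C) : C →ₗ[k] C ⊗[k] C :=
  TensorProduct.map π LinearMap.id ∘ₗ Coalgebra.comul

/-- `ρ_R = (id ⊗ π) Δ`. -/
def rhoR (π : C →ₗ[k] C) : C →ₗ[k] C ⊗[k] C :=
  TensorProduct.map LinearMap.id π ∘ₗ Coalgebra.comul

/-- The subspaces `P_n`: `P_0 = 0`, and for `n ≥ 1` the space `P_n` consists of the `c` with
`Δ(c) - ρ_L(c) - ρ_R(c) ∈ ∑_{1 ≤ i ≤ n - 1} P_i ⊗ P_{n - i}`. -/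
def P (π : C →ₗ[k] C) : ℕ → Submodule k C
  | 0 => ⊥
  | n + 1 => (⨆ i : Fin n, tens (P π (i + 1)) (P π (n - i))).comap
      (Coalgebra.comul - rhoL π - rhoR π)
termination_by n => n
decreasing_by all_goals omega

/-- `M` is a subbicomodule of `(C, ρ_L, ρ_R)` that is isomorphic to `V_D ⊗ V_E^*`, where `V_D` is
the simple left comodule of the simple subcoalgebra `D` (a column of a standard basis `e` of `D`)
and `V_E^*` is the simple right comodule of `E` (a row of a standard basis `f` of `E`): the
vectors `w i j` are the images of the `e i 0 ⊗ f 0 j`. -/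
def IsBicomoduleOfType (π : C →ₗ[k] C) (D E M : Submodule k C) : Prop :=
  ∃ (d d' : ℕ) (e : Fin d → Fin d → C) (f : Fin d' → Fin d' → C) (w : Fin d → Fin d' → C),
    IsStandardBasis D e ∧ IsStandardBasis E f ∧
    LinearIndependent k (fun p : Fin d × Fin d' => w p.1 p.2) ∧
    Submodule.span k (Set.range fun p : Fin d × Fin d' => w p.1 p.2) = M ∧
    (∀ i j, rhoL π (w i j) = ∑ l, e i l ⊗ₜ[k] w l j) ∧
    (∀ i j, rhoR π (w i j) = ∑ l, w i l ⊗ₜ[k] f l j)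

/-- The sum of all subbicomodules of `(C, ρ_L, ρ_R)` of the form `V_D ⊗ V_E^*` inside `N`. -/
def isotypic (π : C →ₗ[k] C) (D E N : Submodule k C) : Submodule k C :=
  sSup {M | M ≤ N ∧ IsBicomoduleOfType π D E M}

end Coalg

/-- The choices that define the blocks of a coalgebra `C`: a coalgebra projection `π : C → C₀`
and, for all simple subcoalgebras `D`, `E` and all `n ≥ 1`, a bicomodule complement `Q D E n` of
`P_{n-1}^{D,E}` in `P_n^{D,E}`. -/
structure BlockSystem (k C : Type*) [Field k] [AddCommGroup C] [Module k C] [Coalgebra k C] where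
  π : C →ₗc[k] C
  π_mem : ∀ x, π x ∈ coradical k C
  π_eq : ∀ x ∈ coradical k C, π x = x
  Q : Submodule k C → Submodule k C → ℕ → Submodule k C
  /-- `Q D E n` is a sum of simple subbicomodules of the form `V_D ⊗ V_E^*`. -/
  Q_isotypic : ∀ D E n, IsSimpleSubcoalgebra D → IsSimpleSubcoalgebra E → 1 ≤ n →
    isotypic (π : C →ₗ[k] C) D E (Q D E n) = Q D E n
  Q_disjoint : ∀ D E n, IsSimpleSubcoalgebra D → IsSimpleSubcoalgebra E → 1 ≤ n →
    isotypic (π : C →ₗ[k] C) D E (P (π : C →ₗ[k] C) (n - 1)) ⊓ Q D E n = ⊥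
  Q_sup : ∀ D E n, IsSimpleSubcoalgebra D → IsSimpleSubcoalgebra E → 1 ≤ n →
    isotypic (π : C →ₗ[k] C) D E (P (π : C →ₗ[k] C) (n - 1)) ⊔ Q D E n =
      isotypic (π : C →ₗ[k] C) D E (P (π : C →ₗ[k] C) n)

/-- The block `B^{d₁,d₂}_n`. -/
def BlockSystem.block {k C : Type*} [Field k] [AddCommGroup C] [Module k C] [Coalgebra k C]
    (S : BlockSystem k C) (d₁ d₂ n : ℕ) : Submodule k C :=
  if n = 0 then
    if d₁ = d₂ then coradicalPart k C d₁ else ⊥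
  else
    ⨆ (D : Submodule k C) (E : Submodule k C)
      (_ : IsSimpleSubcoalgebra D) (_ : IsSimpleSubcoalgebra E)
      (_ : Module.finrank k D = d₁ ^ 2) (_ : Module.finrank k E = d₂ ^ 2), S.Q D E n

/-- `lam` is a left integral of `H^*` (with the convolution product): `f * lam = f(1) lam` for all
`f` in `H^*`. -/
def IsLeftIntegral {k H : Type*} [Field k] [Ring H] [HopfAlgebra k H] (lam : H →ₗ[k] k) : Prop :=
  ∀ (f : H →ₗ[k] k) (x : H),
    LinearMap.mul' k k (TensorProduct.map f lam (Coalgebra.comul (R := k) x)) = f 1 * lam x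

end HopfBlock

end

/-! Everything is translated into the dual algebra A = H^* and its radical J, the functionals
vanishing on H_0; `annPow M.total n` is J^n. Wedderburn's theorem for A/J yields matrix coefficients
that span the coradical. Composing the dual matrix units with π lifts them to A and gives orthogonal
idempotents ε_i with sum 1, one for each simple subcoalgebra D_i. Since Δ - ρ_L - ρ_R = ((id - π) ⊗
(id - π))Δ - (π ⊗ π)Δ, the space P_n is the part of ker π killed by J^{n+1} (`P_eq`), and ε_i, ε_j
cut out its part of type (D_i, D_j) (`isotypic_kerFiltration`). Hence Q_n of type (D_i, D_j) is
nonzero exactly when ε_i J^n ε_j is not contained in J^{n+1} (`Q_ne_bot_iff`).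

Let λ be a nonzero left integral. The map h ↦ λ(· S(h)) is an isomorphism H → A of left A-modules.
It sends a group-like g to a translate T_g of λ. Translations by group-likes are algebra
automorphisms and preserve the powers of J, so all T_g lie in one layer J^s \ J^{s+1}. With a the
distinguished group-like element, T_g = ε_g T_g ε_{ag}. The key fact (`exists_mul_eq_equiv`) is that
a nonzero x = x ε_h, with h group-like, generates a left ideal Ax that contains T_{a⁻¹h}: the left
socle of A corresponds to H_0, and only multiples of this T survive in the column of ε_h. So no such
column reaches beyond layer s, whence m = s. Modulo J^{s+1}, the group-like part of layer s is
spanned by the T_g; they serve as coordinates on B_m^{1,1}, whose dimension is therefore |G(H)|.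
Finally λ = T_1 vanishes on every other block, so it is a dual basis functional.

For (2), take x = ε_i x ε_j in layer l < s with i, j group-like. Some T_g in Ax lies deeper than x,
so Jx ≠ 0. Without skew-primitives ε_p J ε_q lies in J² for group-like p, q. If ε_p J x vanished for
all p of degree > 1, then Jx ⊆ J²x ⊆ ..., so Jx = 0. Hence a nonzero element of some ε_p J x, with
d_p > 1, lies in a layer l' > l. Splitting off one factor of J gives the block in degree l' - 1, and
the antipode gives the two mirrored blocks. -/

noncomputable section

namespace HopfBlock

/-! ### The dual algebra of a coalgebra and its actions on the coalgebra -/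

section Convolution

variable {k C : Type*} [Field k] [AddCommGroup C] [Module k C]

variable (k C) in
/-- The dual space of a coalgebra, with the convolution product. -/
abbrev ConvDual := WithConv (C →ₗ[k] k)

instance [FiniteDimensional k C] : FiniteDimensional k (ConvDual k C) :=
  Module.Finite.equiv (WithConv.linearEquiv k (C →ₗ[k] k)).symm

theorem eq_of_forall_apply_eq {x y : C} (h : ∀ f : ConvDual k C, f x = f y) : x = y := by
  rw [← sub_eq_zero, ← Module.forall_dual_apply_eq_zero_iff k]
  intro f
  simpa [sub_eq_zero] using h (WithConv.toConv f)

theorem eq_zero_of_forall_apply {x : C} (h : ∀ f : ConvDual k C, f x = 0) : x = 0 :=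
  eq_of_forall_apply_eq fun f => (h f).trans (map_zero f.ofConv).symm

/-- The functionals that vanish on `U`. -/
def ann (U : Submodule k C) : Submodule k (ConvDual k C) :=
  U.dualAnnihilator.comap (WithConv.linearEquiv k (C →ₗ[k] k)).toLinearMap

/-- The common zeros of the functionals in `I`. -/
def coann (I : Submodule k (ConvDual k C)) : Submodule k C :=
  (I.map (WithConv.linearEquiv k (C →ₗ[k] k)).toLinearMap).dualCoannihilator

theorem mem_ann {U : Submodule k C} {f : ConvDual k C} : f ∈ ann U ↔ ∀ x ∈ U, f x = 0 := by
  simp [ann, Submodule.mem_dualAnnihilator]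

theorem mem_coann {I : Submodule k (ConvDual k C)} {x : C} :
    x ∈ coann I ↔ ∀ f ∈ I, f x = 0 := by
  simp only [coann, Submodule.mem_dualCoannihilator, Submodule.mem_map]
  exact ⟨fun h f hf => h _ ⟨f, hf, rfl⟩, by rintro h _ ⟨f, hf, rfl⟩; exact h f hf⟩

theorem coann_ann (U : Submodule k C) : coann (ann U) = U := by
  have : (ann U).map (WithConv.linearEquiv k (C →ₗ[k] k)).toLinearMap = U.dualAnnihilator :=
    Submodule.map_comap_eq_of_surjective (WithConv.linearEquiv k (C →ₗ[k] k)).surjective _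
  rw [coann, this, Subspace.dualAnnihilator_dualCoannihilator_eq]

theorem ann_coann [FiniteDimensional k C] (I : Submodule k (ConvDual k C)) :
    ann (coann I) = I := by
  rw [ann, coann, Subspace.dualCoannihilator_dualAnnihilator_eq]
  exact Submodule.comap_map_eq_of_injective (WithConv.linearEquiv k (C →ₗ[k] k)).injective _

theorem coann_le_coann {I I' : Submodule k (ConvDual k C)} (h : I ≤ I') : coann I' ≤ coann I :=
  fun _ hx => mem_coann.2 fun f hf => mem_coann.1 hx f (h hf)

theorem exists_mem_coann_apply_ne_zero [FiniteDimensional k C] {I : Submodule k (ConvDual k C)}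
    {f : ConvDual k C} (hf : f ∉ I) : ∃ x ∈ coann I, f x ≠ 0 := by
  by_contra! h
  exact hf (ann_coann I ▸ mem_ann.2 h)

/-- Every functional on `ConvDual k C` is the evaluation at an element. -/
theorem exists_eval_eq [FiniteDimensional k C] (χ : ConvDual k C →ₗ[k] k) :
    ∃ a : C, ∀ f : ConvDual k C, f a = χ f := by
  refine ⟨(Module.evalEquiv k C).symm
    (χ ∘ₗ (WithConv.linearEquiv k (C →ₗ[k] k)).symm.toLinearMap), fun f => ?_⟩
  have := Module.apply_evalEquiv_symm_apply (R := k) (M := C) f.ofConv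
    (χ ∘ₗ (WithConv.linearEquiv k (C →ₗ[k] k)).symm.toLinearMap)
  exact this

theorem tmul_eq_zero_of_forall [FiniteDimensional k C] {z : C ⊗[k] C}
    (h : ∀ f g : C →ₗ[k] k, LinearMap.mul' k k (TensorProduct.map f g z) = 0) : z = 0 := by
  let b := Module.finBasis k C
  have key : ∀ p, ∀ z : C ⊗[k] C, (b.tensorProduct b).repr z p =
      LinearMap.mul' k k (TensorProduct.map (b.coord p.1) (b.coord p.2) z) := by
    intro p z
    induction z with
    | zero => simp
    | tmul x y => exact (b.tensorProduct_repr_tmul_apply b x y p.1 p.2).trans (by simp [mul_comm])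
    | add x y hx hy => rw [map_add, map_add, map_add, Finsupp.add_apply, hx, hy]
  refine (b.tensorProduct b).repr.injective (Finsupp.ext fun p => ?_)
  rw [map_zero, Finsupp.zero_apply, key, h]

theorem map_tmul_mem_tens {U V : Submodule k C} {p q : C →ₗ[k] C} (hp : ∀ x, p x ∈ U)
    (hq : ∀ x, q x ∈ V) (z : C ⊗[k] C) : TensorProduct.map p q z ∈ tens U V := by
  induction z with
  | zero => simp
  | add x y hx hy => rw [map_add]; exact add_mem hx hy
  | tmul x y => exact Submodule.apply_mem_map₂ _ (hp x) (hq y)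

theorem map_eq_self_of_mem_tens {U V : Submodule k C} {p q : C →ₗ[k] C} (hp : ∀ x ∈ U, p x = x)
    (hq : ∀ x ∈ V, q x = x) {z : C ⊗[k] C} (hz : z ∈ tens U V) : TensorProduct.map p q z = z := by
  have : tens U V ≤ LinearMap.eqLocus (TensorProduct.map p q) LinearMap.id :=
    Submodule.map₂_le.2 fun x hx y hy => by simp [LinearMap.mem_eqLocus, hp x hx, hq y hy]
  exact this hz

theorem exists_projection (U : Submodule k C) :
    ∃ p : C →ₗ[k] C, (∀ x, p x ∈ U) ∧ ∀ x ∈ U, p x = x := by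
  obtain ⟨p, hp⟩ := U.subtype.exists_leftInverse_of_injective U.ker_subtype
  exact ⟨U.subtype ∘ₗ p, fun x => (p x).2, fun x hx => congrArg Subtype.val congr($hp ⟨x, hx⟩)⟩

variable [Coalgebra k C]

theorem one_apply (x : C) : (1 : ConvDual k C) x = Coalgebra.counit (R := k) x := rfl

/-- `f ⇀ x = ∑ f(x₁) x₂`. -/
def leftHit (f : ConvDual k C) : C →ₗ[k] C :=
  TensorProduct.lid k C ∘ₗ TensorProduct.map f.ofConv LinearMap.id ∘ₗ Coalgebra.comul

/-- `x ↼ f = ∑ x₁ f(x₂)`. -/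
def rightHit (f : ConvDual k C) : C →ₗ[k] C :=
  TensorProduct.rid k C ∘ₗ TensorProduct.map LinearMap.id f.ofConv ∘ₗ Coalgebra.comul

/-- `leftHit f` is the transpose of left multiplication by `f`, hence a right action of the dual
algebra; likewise `rightHit` is a left action. Identities between hits reduce in this way to
associativity of convolution. -/
theorem apply_leftHit (f g : ConvDual k C) (x : C) : g (leftHit f x) = (f * g) x := by
  have : g.ofConv ∘ₗ (TensorProduct.lid k C).toLinearMap ∘ₗ TensorProduct.map f.ofConv .id =
      LinearMap.mul' k k ∘ₗ TensorProduct.map f.ofConv g.ofConv := by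
    ext; simp
  exact congr($this (Coalgebra.comul x))

theorem apply_rightHit (f g : ConvDual k C) (x : C) : g (rightHit f x) = (g * f) x := by
  have : g.ofConv ∘ₗ (TensorProduct.rid k C).toLinearMap ∘ₗ TensorProduct.map .id f.ofConv =
      LinearMap.mul' k k ∘ₗ TensorProduct.map g.ofConv f.ofConv := by
    ext; simp [mul_comm]
  exact congr($this (Coalgebra.comul x))

theorem leftHit_leftHit (f g : ConvDual k C) (x : C) :
    leftHit f (leftHit g x) = leftHit (g * f) x :=
  eq_of_forall_apply_eq fun p => by rw [apply_leftHit, apply_leftHit, apply_leftHit, mul_assoc]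

theorem rightHit_rightHit (f g : ConvDual k C) (x : C) :
    rightHit f (rightHit g x) = rightHit (f * g) x :=
  eq_of_forall_apply_eq fun p => by rw [apply_rightHit, apply_rightHit, apply_rightHit, mul_assoc]

theorem leftHit_rightHit (f g : ConvDual k C) (x : C) :
    leftHit f (rightHit g x) = rightHit g (leftHit f x) :=
  eq_of_forall_apply_eq fun p => by
    rw [apply_rightHit, apply_leftHit, apply_rightHit, apply_leftHit, mul_assoc]

theorem leftHit_one (x : C) : leftHit (1 : ConvDual k C) x = x :=
  eq_of_forall_apply_eq fun p => by rw [apply_leftHit, one_mul]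

theorem rightHit_one (x : C) : rightHit (1 : ConvDual k C) x = x :=
  eq_of_forall_apply_eq fun p => by rw [apply_rightHit, mul_one]

theorem leftHit_sum {ι : Type*} (s : Finset ι) (f : ι → ConvDual k C) (x : C) :
    leftHit (∑ i ∈ s, f i) x = ∑ i ∈ s, leftHit (f i) x :=
  eq_of_forall_apply_eq fun p => by
    rw [apply_leftHit, map_sum, Finset.sum_mul]
    simp only [WithConv.ofConv_sum, LinearMap.sum_apply, apply_leftHit]

theorem rightHit_sum {ι : Type*} (s : Finset ι) (f : ι → ConvDual k C) (x : C) :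
    rightHit (∑ i ∈ s, f i) x = ∑ i ∈ s, rightHit (f i) x :=
  eq_of_forall_apply_eq fun p => by
    rw [apply_rightHit, map_sum, Finset.mul_sum]
    simp only [WithConv.ofConv_sum, LinearMap.sum_apply, apply_rightHit]

/-- Stable under both actions of the dual algebra. -/
def HitStable (D : Submodule k C) : Prop :=
  ∀ (f : ConvDual k C), ∀ x ∈ D, leftHit f x ∈ D ∧ rightHit f x ∈ D

/-- With p a projection onto D, membership of Δ(x) in D ⊗ D means that p ⊗ p fixes it. Stability
under each of the two actions removes one of the two factors p. -/
theorem isSubcoalgebra_iff_hitStable [FiniteDimensional k C] {D : Submodule k C} :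
    IsSubcoalgebra D ↔ HitStable D := by
  obtain ⟨p, hp, hp'⟩ := exists_projection D
  constructor
  · intro h f x hx
    have hx' := map_eq_self_of_mem_tens hp' hp' (h x hx)
    have h1 : leftHit f x = p (leftHit (WithConv.toConv (f.ofConv ∘ₗ p)) x) := by
      have : (TensorProduct.lid k C).toLinearMap ∘ₗ TensorProduct.map f.ofConv .id ∘ₗ
          TensorProduct.map p p = p ∘ₗ (TensorProduct.lid k C).toLinearMap ∘ₗ
            TensorProduct.map (f.ofConv ∘ₗ p) .id := by ext; simp
      conv_lhs => rw [leftHit, LinearMap.comp_apply, LinearMap.comp_apply, ← hx']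
      exact congr($this (Coalgebra.comul x))
    have h2 : rightHit f x = p (rightHit (WithConv.toConv (f.ofConv ∘ₗ p)) x) := by
      have : (TensorProduct.rid k C).toLinearMap ∘ₗ TensorProduct.map .id f.ofConv ∘ₗ
          TensorProduct.map p p = p ∘ₗ (TensorProduct.rid k C).toLinearMap ∘ₗ
            TensorProduct.map .id (f.ofConv ∘ₗ p) := by ext; simp
      conv_lhs => rw [rightHit, LinearMap.comp_apply, LinearMap.comp_apply, ← hx']
      exact congr($this (Coalgebra.comul x))
    exact ⟨h1 ▸ hp _, h2 ▸ hp _⟩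
  · intro h x hx
    suffices hx' : TensorProduct.map p p (Coalgebra.comul (R := k) x) = Coalgebra.comul x from
      hx' ▸ map_tmul_mem_tens hp hp _
    rw [← sub_eq_zero]
    refine tmul_eq_zero_of_forall fun f g => ?_
    have e1 : ∀ z : C ⊗[k] C, LinearMap.mul' k k (TensorProduct.map f g (TensorProduct.map p p z)) =
        LinearMap.mul' k k (TensorProduct.map (f ∘ₗ p) (g ∘ₗ p) z) := fun z => by
      rw [TensorProduct.map_comp]; rfl
    rw [map_sub, map_sub, e1, sub_eq_zero]
    change (WithConv.toConv (f ∘ₗ p) * WithConv.toConv (g ∘ₗ p) : ConvDual k C) x =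
      (WithConv.toConv f * WithConv.toConv g : ConvDual k C) x
    rw [← apply_leftHit]
    change WithConv.toConv g (p _) = _
    rw [hp' _ (h _ x hx).1, apply_leftHit, ← apply_rightHit]
    change WithConv.toConv f (p _) = _
    rw [hp' _ (h _ x hx).2, apply_rightHit]

end Convolution

/-! ### Matrix coefficients from the Wedderburn decomposition of the dual algebra -/

section Coradical

variable {k C : Type*} [Field k] [AddCommGroup C] [Module k C] [Coalgebra k C]

/-- The powers of the space of functionals that vanish on `U`, with `annPow U 0 = ⊤`. -/
def annPow (U : Submodule k C) : ℕ → Submodule k (ConvDual k C)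
  | 0 => ⊤
  | n + 1 => annPow U n * ann U

variable (k C) in
/-- Simultaneous standard bases `e i` of subcoalgebras whose sum has a nilpotent annihilator in the
dual algebra. -/
structure MatrixCoeffs where
  r : ℕ
  d : Fin r → ℕ
  d_pos : ∀ i, 0 < d i
  e : ∀ i, Fin (d i) → Fin (d i) → C
  linearIndependent :
    LinearIndependent k (fun p : Σ i, Fin (d i) × Fin (d i) => e p.1 p.2.1 p.2.2)
  comul_eq : ∀ i a b, Coalgebra.comul (R := k) (e i a b) = ∑ c, e i a c ⊗ₜ[k] e i c b
  counit_eq : ∀ i a b, Coalgebra.counit (R := k) (e i a b) = if a = b then 1 else 0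
  exists_pow_eq_bot : ∃ N : ℕ, annPow (Submodule.span k
    (Set.range fun p : Σ i, Fin (d i) × Fin (d i) => e p.1 p.2.1 p.2.2)) N = ⊥

theorem exists_algHom_pi_matrix (k A : Type*) [Field k] [IsAlgClosed k] [Ring A] [Algebra k A]
    [FiniteDimensional k A] : ∃ (r : ℕ) (d : Fin r → ℕ) (_ : ∀ i, NeZero (d i))
      (Ψ : A →ₐ[k] (Π i, Matrix (Fin (d i)) (Fin (d i)) k)),
      Function.Surjective Ψ ∧ ∀ f, Ψ f = 0 ↔ f ∈ Ring.jacobson A := by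
  have : IsArtinianRing A := IsArtinianRing.of_finite k _
  have : FiniteDimensional k (A ⧸ Ring.jacobson A) :=
    Module.Finite.of_surjective (Ideal.Quotient.mkₐ k (Ring.jacobson A)).toLinearMap
      Ideal.Quotient.mk_surjective
  obtain ⟨r, d, hd, ⟨φ⟩⟩ := IsSemisimpleRing.exists_algEquiv_pi_matrix_of_isAlgClosed k
    (A ⧸ Ring.jacobson A)
  refine ⟨r, d, hd, φ.toAlgHom.comp (Ideal.Quotient.mkₐ k (Ring.jacobson A)),
    φ.surjective.comp Ideal.Quotient.mk_surjective, fun f => ?_⟩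
  exact (EmbeddingLike.map_eq_zero_iff (f := φ)).trans Ideal.Quotient.eq_zero_iff_mem

/-- The entries of Ψ(f) are linear in f, so they are evaluations at elements `e i a b` of C.
Multiplicativity of Ψ becomes the comultiplication rule, surjectivity becomes linear independence,
and nilpotency of the Jacobson radical gives the vanishing power. -/
theorem exists_matrixCoeffs [IsAlgClosed k] [FiniteDimensional k C] :
    Nonempty (MatrixCoeffs k C) := by
  classical
  obtain ⟨r, d, hd, Ψ, hΨ, hker⟩ := exists_algHom_pi_matrix k (ConvDual k C)
  have : IsArtinianRing (ConvDual k C) := IsArtinianRing.of_finite k _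
  have he : ∀ i a b, ∃ x : C, ∀ f : ConvDual k C, f x = Ψ f i a b := fun i a b =>
    exists_eval_eq
      ({ toFun := fun f => Ψ f i a b
         map_add' := fun f g => by simp
         map_smul' := fun c f => by simp } : ConvDual k C →ₗ[k] k)
  choose e he using he
  have hli : LinearIndependent k (fun p : Σ i, Fin (d i) × Fin (d i) => e p.1 p.2.1 p.2.2) := by
    rw [Fintype.linearIndependent_iff]
    intro c hc p
    obtain ⟨f, hf⟩ := hΨ (Pi.single p.1 (Matrix.single p.2.1 p.2.2 1))
    have := congrArg f hc
    rw [map_zero, map_sum, Finset.sum_eq_single p] at this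
    · simpa [he, hf] using this
    · rintro ⟨i, a, b⟩ - hq
      obtain ⟨j, a', b'⟩ := p
      simp only [map_smul, he, hf, smul_eq_mul]
      by_cases hij : i = j
      · subst hij
        have : ¬ (a' = a ∧ b' = b) := by rintro ⟨rfl, rfl⟩; exact hq rfl
        simp [this]
      · simp [Pi.single_eq_of_ne hij]
    · simp
  refine ⟨⟨r, d, fun i => Nat.pos_of_ne_zero (hd i).out, e, hli, fun i a b => ?_, fun i a b => ?_,
    ?_⟩⟩
  · rw [← sub_eq_zero]
    refine tmul_eq_zero_of_forall fun f g => ?_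
    rw [map_sub, map_sub, sub_eq_zero]
    change (WithConv.toConv f * WithConv.toConv g : ConvDual k C) (e i a b) = _
    have hf := he (f := WithConv.toConv f)
    have hg := he (f := WithConv.toConv g)
    rw [he]
    simp [Matrix.mul_apply, hf, hg]
  · rw [← one_apply, he, map_one]
    simp [Matrix.one_apply]
  · obtain ⟨N, hN⟩ := IsSemiprimaryRing.isNilpotent (R := ConvDual k C)
    refine ⟨N, eq_bot_iff.2 ?_⟩
    have hJ : ∀ n, annPow (Submodule.span k (Set.range
        fun p : Σ i, Fin (d i) × Fin (d i) => e p.1 p.2.1 p.2.2)) n ≤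
          (Ring.jacobson (ConvDual k C) ^ n).restrictScalars k := by
      intro n
      induction n with
      | zero =>
        rw [Submodule.pow_zero, Ideal.one_eq_top]
        exact le_top
      | succ n ih =>
        rw [annPow, Submodule.pow_succ, Submodule.mul_le]
        intro f hf g hg
        refine Ideal.mul_mem_mul (ih hf) ((hker g).1 ?_)
        ext i a b
        rw [← he]
        exact mem_ann.1 hg _ (Submodule.subset_span ⟨⟨i, a, b⟩, rfl⟩)
    intro f hf
    have := hJ N hf
    rw [hN] at this
    simpa using this

end Coradical

/-! ### Simple subcoalgebras and the coradical -/

section Coradical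

variable {k C : Type*} [Field k] [AddCommGroup C] [Module k C] [Coalgebra k C]

theorem leftHit_eq_of_comul {ι : Type*} [Fintype ι] {x : C} {y z : ι → C}
    (h : Coalgebra.comul (R := k) x = ∑ i, y i ⊗ₜ[k] z i) (f : ConvDual k C) :
    leftHit f x = ∑ i, f (y i) • z i := by
  simp [leftHit, h]

theorem rightHit_eq_of_comul {ι : Type*} [Fintype ι] {x : C} {y z : ι → C}
    (h : Coalgebra.comul (R := k) x = ∑ i, y i ⊗ₜ[k] z i) (f : ConvDual k C) :
    rightHit f x = ∑ i, f (z i) • y i := by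
  simp [rightHit, h]

theorem HitStable.mul_mem_ann_left {U : Submodule k C} (hU : HitStable U) {f : ConvDual k C}
    (g : ConvDual k C) (hf : f ∈ ann U) : g * f ∈ ann U :=
  mem_ann.2 fun x hx => by
    rw [← apply_leftHit]
    exact mem_ann.1 hf _ (hU g x hx).1

theorem HitStable.mul_mem_ann_right {U : Submodule k C} (hU : HitStable U) {f : ConvDual k C}
    (g : ConvDual k C) (hf : f ∈ ann U) : f * g ∈ ann U :=
  mem_ann.2 fun x hx => by
    rw [← apply_rightHit]
    exact mem_ann.1 hf _ (hU g x hx).2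

theorem ann_inf (U V : Submodule k C) : ann (U ⊓ V) = ann U ⊔ ann V := by
  rw [ann, Subspace.dualAnnihilator_inf_eq, ann, ann]
  exact (Submodule.comap_equiv_eq_map_symm _ _).trans
    ((Submodule.map_sup _ _ _).trans (by
      rw [← Submodule.comap_equiv_eq_map_symm, ← Submodule.comap_equiv_eq_map_symm]))

theorem mem_annPow_of_pow {U : Submodule k C} {f : ConvDual k C} (hf : f ∈ ann U) (n : ℕ) :
    f ^ n ∈ annPow U n := by
  induction n with
  | zero => trivial
  | succ n ih => exact pow_succ f n ▸ Submodule.mul_mem_mul ih hf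

namespace MatrixCoeffs

variable (M : MatrixCoeffs k C)

/-- The index set of the matrix coefficients. -/
abbrev Idx := Σ i, Fin (M.d i) × Fin (M.d i)

/-- The matrix coefficients as one family. -/
def vec (p : M.Idx) : C := M.e p.1 p.2.1 p.2.2

/-- The span of the `i`-th standard basis. -/
def D (i : Fin M.r) : Submodule k C :=
  Submodule.span k (Set.range fun p : Fin (M.d i) × Fin (M.d i) => M.e i p.1 p.2)

/-- The span of all the matrix coefficients. -/
def total : Submodule k C := Submodule.span k (Set.range M.vec)

theorem e_mem_D (i : Fin M.r) (a b : Fin (M.d i)) : M.e i a b ∈ M.D i :=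
  Submodule.subset_span ⟨(a, b), rfl⟩

theorem D_le_total (i : Fin M.r) : M.D i ≤ M.total :=
  Submodule.span_le.2 (by rintro _ ⟨p, rfl⟩; exact Submodule.subset_span ⟨⟨i, p⟩, rfl⟩)

theorem e_mem_total (i : Fin M.r) (a b : Fin (M.d i)) : M.e i a b ∈ M.total :=
  M.D_le_total i (M.e_mem_D i a b)

theorem total_eq_iSup : M.total = ⨆ i, M.D i := by
  refine le_antisymm (Submodule.span_le.2 ?_) (iSup_le M.D_le_total)
  rintro _ ⟨⟨i, a, b⟩, rfl⟩
  exact Submodule.mem_iSup_of_mem i (M.e_mem_D i a b)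

theorem total_induction {p : C → Prop} (h0 : p 0) (ha : ∀ x y, p x → p y → p (x + y))
    (hs : ∀ (c : k) x, p x → p (c • x)) (he : ∀ i a b, p (M.e i a b)) {x : C} (hx : x ∈ M.total) :
    p x :=
  Submodule.span_induction (by rintro _ ⟨⟨i, a, b⟩, rfl⟩; exact he i a b) h0
    (fun x y _ _ => ha x y) (fun c x _ => hs c x) hx

theorem D_induction {i : Fin M.r} {p : C → Prop} (h0 : p 0) (ha : ∀ x y, p x → p y → p (x + y))
    (hs : ∀ (c : k) x, p x → p (c • x)) (he : ∀ a b, p (M.e i a b)) {x : C} (hx : x ∈ M.D i) :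
    p x :=
  Submodule.span_induction (by rintro _ ⟨⟨a, b⟩, rfl⟩; exact he a b) h0
    (fun x y _ _ => ha x y) (fun c x _ => hs c x) hx

theorem leftHit_e (f : ConvDual k C) (i : Fin M.r) (a b : Fin (M.d i)) :
    leftHit f (M.e i a b) = ∑ c, f (M.e i a c) • M.e i c b :=
  leftHit_eq_of_comul (M.comul_eq i a b) f

theorem rightHit_e (f : ConvDual k C) (i : Fin M.r) (a b : Fin (M.d i)) :
    rightHit f (M.e i a b) = ∑ c, f (M.e i c b) • M.e i a c :=
  rightHit_eq_of_comul (M.comul_eq i a b) f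

theorem hitStable_D (i : Fin M.r) : HitStable (M.D i) := by
  intro f x hx
  refine M.D_induction (p := fun x => leftHit f x ∈ M.D i ∧ rightHit f x ∈ M.D i) ?_ ?_ ?_ ?_ hx
  · simp
  · intro x y hx hy
    rw [map_add, map_add]
    exact ⟨add_mem hx.1 hy.1, add_mem hx.2 hy.2⟩
  · intro c x hx
    rw [map_smul, map_smul]
    exact ⟨Submodule.smul_mem _ _ hx.1, Submodule.smul_mem _ _ hx.2⟩
  · intro a b
    rw [leftHit_e, rightHit_e]
    exact ⟨sum_mem fun c _ => Submodule.smul_mem _ _ (M.e_mem_D _ _ _),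
      sum_mem fun c _ => Submodule.smul_mem _ _ (M.e_mem_D _ _ _)⟩

theorem hitStable_total : HitStable M.total := by
  intro f x hx
  refine M.total_induction (p := fun x => leftHit f x ∈ M.total ∧ rightHit f x ∈ M.total) ?_ ?_ ?_ ?_ hx
  · simp
  · intro x y hx hy
    rw [map_add, map_add]
    exact ⟨add_mem hx.1 hy.1, add_mem hx.2 hy.2⟩
  · intro c x hx
    rw [map_smul, map_smul]
    exact ⟨Submodule.smul_mem _ _ hx.1, Submodule.smul_mem _ _ hx.2⟩
  · intro i a b
    exact ⟨M.D_le_total i (M.hitStable_D i f _ (M.e_mem_D i a b)).1,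
      M.D_le_total i (M.hitStable_D i f _ (M.e_mem_D i a b)).2⟩

/-- Functionals `u i a b` that are dual to the matrix coefficients. -/
structure IsDual (u : ∀ i, Fin (M.d i) → Fin (M.d i) → ConvDual k C) : Prop where
  apply_self : ∀ i a b a' b', u i a b (M.e i a' b') = if a = a' ∧ b = b' then 1 else 0
  apply_ne : ∀ i a b j a' b', i ≠ j → u i a b (M.e j a' b') = 0

theorem exists_isDual : ∃ u, M.IsDual u := by
  classical
  obtain ⟨g, hg⟩ := (Finsupp.linearCombination k M.vec).exists_leftInverse_of_injective
    (LinearMap.ker_eq_bot.2 M.linearIndependent)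
  have hv : ∀ p q : M.Idx, g (M.vec q) p = if q = p then 1 else 0 := fun p q => by
    have := congr($hg (Finsupp.single q 1) p)
    simpa [Finsupp.single_apply] using this
  refine ⟨fun i a b => WithConv.toConv (Finsupp.lapply (⟨i, a, b⟩ : M.Idx) ∘ₗ g), ?_, ?_⟩
  · intro i a b a' b'
    refine (hv ⟨i, a, b⟩ ⟨i, a', b'⟩).trans ?_
    simp [eq_comm]
  · intro i a b j a' b' hij
    refine (hv ⟨i, a, b⟩ ⟨j, a', b'⟩).trans (if_neg fun h => hij ?_)
    exact (congrArg Sigma.fst h).symm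

variable {M} {u : ∀ i, Fin (M.d i) → Fin (M.d i) → ConvDual k C} (hu : M.IsDual u)
include hu

theorem IsDual.leftHit_self (i : Fin M.r) (a b a' b' : Fin (M.d i)) :
    leftHit (u i a b) (M.e i a' b') = if a = a' then M.e i b b' else 0 := by
  rw [leftHit_e]
  by_cases h : a = a'
  · simp [hu.apply_self, h]
  · simp [hu.apply_self, h]

theorem IsDual.rightHit_self (i : Fin M.r) (a b a' b' : Fin (M.d i)) :
    rightHit (u i a b) (M.e i a' b') = if b = b' then M.e i a' a else 0 := by
  rw [rightHit_e]
  by_cases h : b = b'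
  · simp [hu.apply_self, h]
  · simp [hu.apply_self, h]

theorem IsDual.leftHit_ne (i : Fin M.r) (a b) (j) (a' b' : Fin (M.d j)) (hij : i ≠ j) :
    leftHit (u i a b) (M.e j a' b') = 0 := by
  rw [leftHit_e]
  simp [hu.apply_ne _ _ _ _ _ _ hij]

/-- Hitting with matrix units from both sides isolates one coefficient of x and moves it to any
position. Therefore a hit-stable subspace containing an x with a nonzero i-th coefficient contains
all of `M.D i`. -/
theorem IsDual.rightHit_leftHit (i : Fin M.r) (p q b c : Fin (M.d i)) {x : C} (hx : x ∈ M.total) :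
    rightHit (u i c q) (leftHit (u i p b) x) = u i p q x • M.e i b c := by
  refine M.total_induction (p := fun x => rightHit (u i c q) (leftHit (u i p b) x) = u i p q x • M.e i b c) ?_ ?_ ?_ ?_ hx
  · simp
  · intro x y hx hy
    rw [map_add, map_add, map_add, hx, hy, add_smul]
  · intro c x hx
    rw [map_smul, map_smul, map_smul, hx, smul_assoc]
  · intro j a b'
    by_cases hij : i = j
    · subst hij
      rw [hu.leftHit_self, hu.apply_self]
      by_cases h : p = a <;> by_cases h' : q = b' <;> simp [h, h', hu.rightHit_self]
    · rw [hu.leftHit_ne _ _ _ _ _ _ hij, hu.apply_ne _ _ _ _ _ _ hij]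
      simp

theorem IsDual.eq_sum {x : C} (hx : x ∈ M.total) :
    x = ∑ i, ∑ a, ∑ b, u i a b x • M.e i a b := by
  refine M.total_induction (p := fun x => x = ∑ i, ∑ a, ∑ b, u i a b x • M.e i a b) ?_ ?_ ?_ ?_ hx
  · simp
  · intro x y hx hy
    simp only [map_add, add_smul, Finset.sum_add_distrib]
    rw [← hx, ← hy]
  · intro c x hx
    simp only [map_smul, smul_assoc, ← Finset.smul_sum]
    rw [← hx]
  · intro i a b
    rw [Finset.sum_eq_single i, Finset.sum_eq_single a, Finset.sum_eq_single b]
    · simp [hu.apply_self]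
    · intro b' _ hb; simp [hu.apply_self, hb]
    · simp
    · intro b' _ hb; simp [hu.apply_self, hb]
    · simp
    · intro j _ hj; simp [hu.apply_ne _ _ _ _ _ _ hj]
    · simp

theorem IsDual.apply_D_ne {i j : Fin M.r} (hij : i ≠ j) (a b) {x : C} (hx : x ∈ M.D j) :
    u i a b x = 0 := by
  refine M.D_induction (p := fun x => u i a b x = 0) ?_ ?_ ?_ ?_ hx
  · simp
  · intro x y hx hy
    rw [map_add, hx, hy, add_zero]
  · intro c x hx
    rw [map_smul, hx, smul_zero]
  · intro a' b'
    exact hu.apply_ne _ _ _ _ _ _ hij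

theorem IsDual.le_of_hitStable {E : Submodule k C} (hE : HitStable E) {x : C} (hx : x ∈ E)
    (hx' : x ∈ M.total) {i : Fin M.r} {p q : Fin (M.d i)} (h : u i p q x ≠ 0) : M.D i ≤ E := by
  refine Submodule.span_le.2 ?_
  rintro _ ⟨⟨b, c⟩, rfl⟩
  have := (hE (u i c q) _ (hE (u i p b) x hx).1).2
  rw [hu.rightHit_leftHit i p q b c hx'] at this
  exact (Submodule.smul_mem_iff _ h).1 this

theorem IsDual.exists_apply_ne_zero {x : C} (hx : x ∈ M.total) (h0 : x ≠ 0) :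
    ∃ i p q, u i p q x ≠ 0 := by
  by_contra! h
  refine h0 ?_
  rw [hu.eq_sum hx]
  simp [h]

omit hu

variable (M)

theorem e_ne_zero (i : Fin M.r) (a b : Fin (M.d i)) : M.e i a b ≠ 0 :=
  M.linearIndependent.ne_zero (⟨i, a, b⟩ : M.Idx)

theorem isStandardBasis (i : Fin M.r) : IsStandardBasis (M.D i) (M.e i) where
  linearIndependent := M.linearIndependent.comp (fun p => (⟨i, p⟩ : M.Idx))
    (sigma_mk_injective (β := fun i => Fin (M.d i) × Fin (M.d i)))
  span_eq := rfl
  comul_eq := M.comul_eq i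
  counit_eq := M.counit_eq i

theorem finrank_D (i : Fin M.r) : Module.finrank k (M.D i) = M.d i ^ 2 := by
  rw [D, finrank_span_eq_card (M.isStandardBasis i).linearIndependent]
  simp [sq]

theorem D_injective : Function.Injective M.D := by
  intro i j hij
  obtain ⟨u, hu⟩ := M.exists_isDual
  by_contra h
  let a : Fin (M.d i) := ⟨0, M.d_pos i⟩
  have := hu.apply_D_ne h a a (hij ▸ M.e_mem_D i a a)
  rw [hu.apply_self] at this
  simp at this

variable [FiniteDimensional k C]

theorem isSimpleSubcoalgebra_D (i : Fin M.r) : IsSimpleSubcoalgebra (M.D i) where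
  isSubcoalgebra := isSubcoalgebra_iff_hitStable.2 (M.hitStable_D i)
  ne_bot h := M.e_ne_zero i ⟨0, M.d_pos i⟩ ⟨0, M.d_pos i⟩
    ((Submodule.mem_bot k).1 (h ▸ M.e_mem_D i _ _))
  eq_bot_or_eq E hE hE' := by
    rw [isSubcoalgebra_iff_hitStable] at hE'
    refine or_iff_not_imp_left.2 fun hne => le_antisymm hE ?_
    obtain ⟨x, hx, hx0⟩ := E.exists_mem_ne_zero_of_ne_bot hne
    obtain ⟨u, hu⟩ := M.exists_isDual
    obtain ⟨j, p, q, h⟩ := hu.exists_apply_ne_zero (M.D_le_total i (hE hx)) hx0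
    obtain rfl : j = i := by
      by_contra hji
      exact h (hu.apply_D_ne hji p q (hE hx))
    exact hu.le_of_hitStable hE' hx (M.D_le_total j (hE hx)) h

-- If the intersection were zero, 1 = v + w with v vanishing on D and w in J. The functionals
-- vanishing on D form an ideal, so 1 - w^n vanishes on D for all n; w is nilpotent, so 1 vanishes
-- on D and D = 0.
omit [FiniteDimensional k C] in
theorem inf_total_ne_bot {D : Submodule k C} (hD : HitStable D) (h0 : D ≠ ⊥) :
    D ⊓ M.total ≠ ⊥ := by
  intro h
  have h1 : (1 : ConvDual k C) ∈ ann D ⊔ ann M.total := by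
    rw [← ann_inf, h]
    exact mem_ann.2 fun x hx => by rw [(Submodule.mem_bot k).1 hx, map_zero]
  obtain ⟨v, hv, w, hw, hvw⟩ := Submodule.mem_sup.1 h1
  obtain ⟨N, hN⟩ := M.exists_pow_eq_bot
  have hwN : w ^ N = 0 := (Submodule.mem_bot k).1 (hN ▸ mem_annPow_of_pow hw N)
  have key : ∀ n : ℕ, 1 - w ^ n ∈ ann D := by
    intro n
    induction n with
    | zero => simp
    | succ n ih =>
      have : 1 - w ^ (n + 1) = v + (1 - w ^ n) * w := by
        rw [pow_succ, sub_mul, one_mul, ← add_sub_assoc, hvw]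
      rw [this]
      exact add_mem hv (hD.mul_mem_ann_right _ ih)
  have h1D := key N
  rw [hwN, sub_zero] at h1D
  refine h0 ((Submodule.eq_bot_iff D).2 fun x hx => ?_)
  refine eq_zero_of_forall_apply (k := k) fun f => ?_
  rw [← mul_one f]
  exact mem_ann.1 (hD.mul_mem_ann_left f h1D) x hx

theorem exists_eq_D {D : Submodule k C} (hD : IsSimpleSubcoalgebra D) : ∃ i, D = M.D i := by
  have hD' := isSubcoalgebra_iff_hitStable.1 hD.isSubcoalgebra
  obtain ⟨x, hx, hx0⟩ := Submodule.exists_mem_ne_zero_of_ne_bot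
    (M.inf_total_ne_bot hD' hD.ne_bot)
  obtain ⟨u, hu⟩ := M.exists_isDual
  obtain ⟨i, p, q, h⟩ := hu.exists_apply_ne_zero hx.2 hx0
  have hle := hu.le_of_hitStable hD' hx.1 hx.2 h
  exact ⟨i, ((hD.eq_bot_or_eq _ hle (M.isSimpleSubcoalgebra_D i).isSubcoalgebra).resolve_left
    (M.isSimpleSubcoalgebra_D i).ne_bot).symm⟩

theorem coradical_eq : coradical k C = M.total := by
  refine le_antisymm (sSup_le fun D hD => ?_) ?_
  · obtain ⟨i, rfl⟩ := M.exists_eq_D hD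
    exact M.D_le_total i
  · rw [total_eq_iSup]
    exact iSup_le fun i => le_sSup (M.isSimpleSubcoalgebra_D i)

end MatrixCoeffs

end Coradical

/-! ### Subspaces and filtrations of the tensor square -/

section Tensor

variable {k C : Type*} [Field k] [AddCommGroup C] [Module k C]

/-- The pairing `(f ⊗ g)(z)`. -/
def pair (f g : ConvDual k C) : C ⊗[k] C →ₗ[k] k :=
  LinearMap.mul' k k ∘ₗ TensorProduct.map f.ofConv g.ofConv

@[simp] theorem pair_tmul (f g : ConvDual k C) (x y : C) : pair f g (x ⊗ₜ y) = f x * g y := by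
  simp [pair]

theorem pair_map (f g : ConvDual k C) (p q : C →ₗ[k] C) (z : C ⊗[k] C) :
    pair f g (TensorProduct.map p q z) =
      pair (WithConv.toConv (f.ofConv ∘ₗ p)) (WithConv.toConv (g.ofConv ∘ₗ q)) z := by
  rw [pair, pair, WithConv.ofConv_toConv, WithConv.ofConv_toConv, TensorProduct.map_comp]
  rfl

theorem tens_mono {U U' V V' : Submodule k C} (hU : U ≤ U') (hV : V ≤ V') :
    tens U V ≤ tens U' V' :=
  Submodule.map₂_le_map₂ hU hV

theorem pair_eq_zero_of_mem_tens {U V : Submodule k C} {f g : ConvDual k C}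
    (h : (∀ x ∈ U, f x = 0) ∨ ∀ y ∈ V, g y = 0) {z : C ⊗[k] C} (hz : z ∈ tens U V) :
    pair f g z = 0 := by
  have : tens U V ≤ LinearMap.ker (pair f g) := Submodule.map₂_le.2 fun x hx y hy => by
    rcases h with h | h
    · simp [h x hx]
    · simp [h y hy]
  exact this hz

/-- For projections p, q onto U, V the hypothesis makes (id - p) ⊗ (id - q) kill z; expanding this
product writes z as the required sum. -/
theorem mem_tens_sup_of_forall [FiniteDimensional k C] {U V : Submodule k C} {z : C ⊗[k] C}
    (h : ∀ f ∈ ann U, ∀ g ∈ ann V, pair f g z = 0) : z ∈ tens U ⊤ ⊔ tens ⊤ V := by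
  obtain ⟨p, hp, hp'⟩ := exists_projection U
  obtain ⟨q, hq, hq'⟩ := exists_projection V
  have h0 : TensorProduct.map (LinearMap.id - p) (LinearMap.id - q) z = 0 :=
    tmul_eq_zero_of_forall fun f g => by
      refine (pair_map (WithConv.toConv f) (WithConv.toConv g) _ _ z).trans (h _ ?_ _ ?_)
      · exact mem_ann.2 fun x hx => by simp [hp' x hx]
      · exact mem_ann.2 fun x hx => by simp [hq' x hx]
  have h1 : z = TensorProduct.map p LinearMap.id z +
      TensorProduct.map (LinearMap.id - p) q z := by
    have h2 : ∀ z : C ⊗[k] C, TensorProduct.map (LinearMap.id - p) (LinearMap.id - q) z =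
        z - TensorProduct.map p LinearMap.id z - TensorProduct.map (LinearMap.id - p) q z := by
      intro z
      induction z with
      | zero => simp
      | add x y hx hy => simp only [map_add, hx, hy]; abel
      | tmul x y => simp [TensorProduct.tmul_sub, TensorProduct.sub_tmul]
    rw [h2, sub_sub, sub_eq_zero] at h0
    exact h0
  rw [h1]
  exact Submodule.add_mem_sup (map_tmul_mem_tens hp (fun _ => Submodule.mem_top) z)
    (map_tmul_mem_tens (fun _ => Submodule.mem_top) hq z)

theorem tens_inf_le (U W : Submodule k C) : tens U ⊤ ⊓ tens ⊤ W ≤ tens U W := by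
  rintro z ⟨h1, h2⟩
  obtain ⟨p, hp, hp'⟩ := exists_projection U
  obtain ⟨q, hq, hq'⟩ := exists_projection W
  have h1' := map_eq_self_of_mem_tens (q := LinearMap.id) hp' (fun _ _ => rfl) h1
  have h2' := map_eq_self_of_mem_tens (p := LinearMap.id) (fun _ _ => rfl) hq' h2
  rw [← h1', ← h2', ← LinearMap.comp_apply, ← TensorProduct.map_comp]
  exact map_tmul_mem_tens hp hq z

/-- Terms are split off one at a time: modulo the first j terms, z lies in C ⊗ F_{n-j}. The
hypothesis for (j + 1, n - j - 1) splits this remainder into a part in (F_{j+1} ⊗ C) ∩ (C ⊗ F_{n-j})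
= F_{j+1} ⊗ F_{n-j}, which is the next term, and a part in C ⊗ F_{n-j-1}. -/
theorem mem_iSup_tens_of_filtration {F : ℕ → Submodule k C} (hF : Monotone F) (h0 : F 0 = ⊥)
    {n : ℕ} {z : C ⊗[k] C} (h : ∀ a b, a + b = n → z ∈ tens (F a) ⊤ ⊔ tens ⊤ (F b)) :
    z ∈ ⨆ i : Fin n, tens (F (i + 1)) (F (n - i)) := by
  have hbot : ∀ U : Submodule k C, tens ⊥ U = ⊥ ∧ tens U ⊥ = ⊥ := fun U =>
    ⟨Submodule.map₂_bot_left _ _, Submodule.map₂_bot_right _ _⟩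
  let T : ℕ → Submodule k (C ⊗[k] C) := fun j =>
    ⨆ (i : Fin n) (_ : (i : ℕ) < j), tens (F (i + 1)) (F (n - i))
  have hT : ∀ j, T j ≤ tens (F j) ⊤ := fun j =>
    iSup₂_le fun i hi => tens_mono (hF hi) le_top
  have key : ∀ j ≤ n, z ∈ T j ⊔ tens ⊤ (F (n - j)) := by
    intro j
    induction j with
    | zero =>
      intro _
      have := h 0 n (zero_add n)
      rw [h0, (hbot ⊤).1, bot_sup_eq] at this
      exact Submodule.mem_sup_right this
    | succ j ih =>
      intro hj
      obtain ⟨s, hs, y, hy, rfl⟩ := Submodule.mem_sup.1 (ih (by omega))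
      have hy' : y ∈ tens (F (j + 1)) ⊤ ⊔ tens ⊤ (F (n - (j + 1))) := by
        have := sub_mem (h (j + 1) (n - (j + 1)) (by omega))
          (Submodule.mem_sup_left (tens_mono (hF (Nat.le_succ j)) le_rfl (hT j hs)))
        simpa using this
      obtain ⟨y₁, hy₁, y₂, hy₂, rfl⟩ := Submodule.mem_sup.1 hy'
      have hy₁' : y₁ ∈ tens ⊤ (F (n - j)) := by
        have := sub_mem hy (tens_mono le_rfl (hF (by omega)) hy₂ : y₂ ∈ tens ⊤ (F (n - j)))
        simpa using this
      rw [← add_assoc]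
      refine Submodule.add_mem_sup (add_mem ?_ ?_) hy₂
      · exact (biSup_mono fun i hi => Nat.lt_succ_of_lt hi : T j ≤ T (j + 1)) hs
      · exact Submodule.mem_iSup_of_mem (⟨j, by omega⟩ : Fin n)
          (Submodule.mem_iSup_of_mem (Nat.lt_succ_self j) (tens_inf_le _ _ ⟨hy₁, hy₁'⟩))
  have := key n le_rfl
  rw [Nat.sub_self, h0, (hbot ⊤).2, sup_bot_eq] at this
  have hle : T n ≤ ⨆ i : Fin n, tens (F (i + 1)) (F (n - i)) :=
    iSup_mono fun i => iSup_le fun _ => le_rfl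
  exact hle this

end Tensor

/-! ### The radical filtration and the spaces P_n -/

section Filtration

variable {k C : Type*} [Field k] [AddCommGroup C] [Module k C] [Coalgebra k C]

theorem mul_mem_annPow_left {U : Submodule k C} {n : ℕ}
    {f : ConvDual k C} (g : ConvDual k C) (hf : f ∈ annPow U n) : g * f ∈ annPow U n := by
  induction n generalizing f with
  | zero => trivial
  | succ n ih =>
    refine Submodule.mul_induction_on hf (fun p hp q hq => ?_) fun p q hp hq => ?_
    · rw [← mul_assoc]
      exact Submodule.mul_mem_mul (ih hp) hq
    · rw [mul_add]
      exact add_mem hp hq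

theorem HitStable.mul_mem_annPow_right {U : Submodule k C} (hU : HitStable U) {n : ℕ}
    {f : ConvDual k C} (g : ConvDual k C) (hf : f ∈ annPow U n) : f * g ∈ annPow U n := by
  cases n with
  | zero => trivial
  | succ n =>
    refine Submodule.mul_induction_on hf (fun p hp q hq => ?_) fun p q hp hq => ?_
    · rw [mul_assoc]
      exact Submodule.mul_mem_mul hp (hU.mul_mem_ann_right g hq)
    · rw [add_mul]
      exact add_mem hp hq

theorem HitStable.annPow_one {U : Submodule k C} (hU : HitStable U) : annPow U 1 = ann U := by
  refine le_antisymm (Submodule.mul_le.2 fun f _ g hg => hU.mul_mem_ann_left f hg) fun f hf => ?_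
  rw [← one_mul f]
  exact Submodule.mul_mem_mul trivial hf

theorem HitStable.annPow_succ_le {U : Submodule k C} (hU : HitStable U) (n : ℕ) :
    annPow U (n + 1) ≤ annPow U n :=
  Submodule.mul_le.2 fun _ hf g _ => hU.mul_mem_annPow_right g hf

theorem HitStable.annPow_antitone {U : Submodule k C} (hU : HitStable U) : Antitone (annPow U) :=
  antitone_nat_of_succ_le hU.annPow_succ_le

theorem HitStable.mul_mem_annPow {U : Submodule k C} (hU : HitStable U) {m n : ℕ}
    {f g : ConvDual k C} (hf : f ∈ annPow U m) (hg : g ∈ annPow U n) :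
    f * g ∈ annPow U (m + n) := by
  induction n generalizing g with
  | zero => exact hU.mul_mem_annPow_right g hf
  | succ n ih =>
    refine Submodule.mul_induction_on hg (fun p hp q hq => ?_) fun p q hp hq => ?_
    · rw [← mul_assoc]
      exact Submodule.mul_mem_mul (ih hp) hq
    · rw [mul_add]
      exact add_mem hp hq

theorem HitStable.annPow_succ' {U : Submodule k C} (hU : HitStable U) (n : ℕ) :
    annPow U (n + 1) = ann U * annPow U n := by
  refine le_antisymm ?_ (Submodule.mul_le.2 fun f hf g hg => ?_)
  · induction n with
    | zero =>
      rw [zero_add, hU.annPow_one]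
      intro f hf
      rw [← mul_one f]
      exact Submodule.mul_mem_mul hf trivial
    | succ n ih =>
      rw [annPow]
      refine (mul_le_mul_left ih _).trans ?_
      exact (mul_assoc (ann U) (annPow U n) (ann U)).le
  · rw [add_comm]
    exact hU.mul_mem_annPow (hU.annPow_one ▸ hf) hg

/-- The functional `f ∘ π`. -/
def pull (π : C →ₗc[k] C) (f : ConvDual k C) : ConvDual k C :=
  WithConv.toConv (f.ofConv ∘ₗ (π : C →ₗ[k] C))

theorem pull_apply (π : C →ₗc[k] C) (f : ConvDual k C) (x : C) : pull π f x = f (π x) := rfl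

/-- As π is a coalgebra map, `pull π` is an algebra endomorphism of the dual. For a block system on
a finite-dimensional coalgebra it is idempotent with kernel J, so its image is a subalgebra lifting
A/J. -/
theorem pull_mul (π : C →ₗc[k] C) (f g : ConvDual k C) :
    pull π (f * g) = pull π f * pull π g :=
  WithConv.ofConv_injective (LinearMap.convMul_comp_coalgHom_distrib f g π)

theorem pull_one (π : C →ₗc[k] C) : pull π 1 = (1 : ConvDual k C) := by
  refine WithConv.ext (LinearMap.ext fun x => ?_)
  change (1 : ConvDual k C) (π x) = _
  rw [one_apply, one_apply]
  exact CoalgHomClass.counit_comp_apply π x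

/-- `Δ - ρ_L - ρ_R`. -/
def delta (π : C →ₗ[k] C) : C →ₗ[k] C ⊗[k] C := Coalgebra.comul - rhoL π - rhoR π

variable (S : BlockSystem k C) (M : MatrixCoeffs k C)

namespace BlockSystem

theorem π_π (x : C) : S.π (S.π x) = S.π x := S.π_eq _ (S.π_mem x)

theorem pull_pull (f : ConvDual k C) : pull S.π (pull S.π f) = pull S.π f :=
  WithConv.ext (LinearMap.ext fun x => congrArg f.ofConv (S.π_π x))

/-- The elements of `ker π` that are annihilated by the power `n + 1` of the radical. -/
def kerFiltration (n : ℕ) : Submodule k C :=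
  LinearMap.ker (S.π : C →ₗ[k] C) ⊓ coann (annPow M.total (n + 1))

theorem mem_kerFiltration {n : ℕ} {x : C} :
    x ∈ S.kerFiltration M n ↔ S.π x = 0 ∧ ∀ f ∈ annPow M.total (n + 1), f x = 0 := by
  rw [kerFiltration, Submodule.mem_inf, mem_coann]
  rfl

theorem kerFiltration_mono : Monotone (S.kerFiltration M) := fun _ _ h =>
  inf_le_inf le_rfl (coann_le_coann (M.hitStable_total.annPow_antitone (by omega)))

theorem pair_delta (f g : ConvDual k C) (x : C) :
    pair f g (delta (S.π : C →ₗ[k] C) x) =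
      (f * g) x - (pull S.π f * g) x - (f * pull S.π g) x := by
  rw [delta, LinearMap.sub_apply, LinearMap.sub_apply, map_sub, map_sub, rhoL, rhoR,
    LinearMap.comp_apply, LinearMap.comp_apply, pair_map, pair_map]
  rfl

variable [FiniteDimensional k C]

theorem π_mem_total (x : C) : S.π x ∈ M.total := M.coradical_eq ▸ S.π_mem x

theorem π_eq_self {x : C} (hx : x ∈ M.total) : S.π x = x := S.π_eq x (M.coradical_eq ▸ hx)

theorem pull_eq_zero {f : ConvDual k C} (hf : f ∈ ann M.total) : pull S.π f = 0 :=
  WithConv.ext (LinearMap.ext fun x => mem_ann.1 hf _ (S.π_mem_total M x))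

theorem sub_π_mem_kerFiltration {n : ℕ} {x : C} (hx : x ∈ coann (annPow M.total (n + 1))) :
    x - S.π x ∈ S.kerFiltration M n := by
  refine (S.mem_kerFiltration M).2 ⟨by rw [map_sub, S.π_π, sub_self], fun f hf => ?_⟩
  have hf' : f ∈ ann M.total :=
    M.hitStable_total.annPow_one ▸ M.hitStable_total.annPow_antitone (by omega) hf
  rw [map_sub, mem_coann.1 hx f hf, mem_ann.1 hf' _ (S.π_mem_total M x), sub_zero]

theorem kerFiltration_zero : S.kerFiltration M 0 = ⊥ := by
  refine (Submodule.eq_bot_iff _).2 fun x hx => ?_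
  obtain ⟨h1, h2⟩ := hx
  rw [SetLike.mem_coe, zero_add, M.hitStable_total.annPow_one, coann_ann] at h2
  rw [← S.π_eq_self M h2]
  exact h1

/-- Induction on n. On ker π the term (π ⊗ π)Δ vanishes, so Δ - ρ_L - ρ_R is ((id - π) ⊗ (id - π))Δ
there. Functionals of the form f - f ∘ π are in J, so its position in the tensor square is governed
by products of powers of J. -/
theorem P_eq (n : ℕ) : P (S.π : C →ₗ[k] C) n = S.kerFiltration M n := by
  induction n using Nat.strong_induction_on with
  | _ n ih =>
  rcases n with _ | n
  · rw [P, kerFiltration_zero]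
  have hP : (⨆ i : Fin n, tens (P (S.π : C →ₗ[k] C) (i + 1)) (P (S.π : C →ₗ[k] C) (n - i))) =
      ⨆ i : Fin n, tens (S.kerFiltration M (i + 1)) (S.kerFiltration M (n - i)) :=
    iSup_congr fun i => by rw [ih (i + 1) (by omega), ih (n - i) (by omega)]
  rw [P, hP]
  ext x
  rw [Submodule.mem_comap, mem_kerFiltration, ← delta]
  constructor
  · intro hx
    constructor
    · refine eq_zero_of_forall_apply (k := k) fun f => ?_
      -- Functionals pulled back along π kill the first tensor factors, which lie in ker π; on Δ -
      -- ρ_L - ρ_R this pairing leaves -f(π x).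
      have h0 : pair (pull S.π f) (pull S.π 1)
          (delta (S.π : C →ₗ[k] C) x) = 0 := by
        have hle : (⨆ i : Fin n, tens (S.kerFiltration M (i + 1)) (S.kerFiltration M (n - i))) ≤
            LinearMap.ker (pair (pull S.π f) (pull S.π 1)) :=
          iSup_le fun i z hz => pair_eq_zero_of_mem_tens (Or.inl fun y hy => by
            rw [pull_apply, ((S.mem_kerFiltration M).1 hy).1, map_zero]) hz
        exact hle hx
      rw [pair_delta, pull_pull, pull_pull, pull_one, mul_one, sub_self, zero_sub,
        neg_eq_zero] at h0
      exact h0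
    · intro f hf
      rw [M.hitStable_total.annPow_succ'] at hf
      refine Submodule.mul_induction_on hf (fun g hg h hh => ?_) fun p q hp hq => ?_
      -- Both g and h lie in J, so their pullbacks vanish and the pairing is (g * h)(x). Since h is
      -- in J^{n+1}, it kills every second factor P_{n-i}.
      · have hh' : h ∈ ann M.total := M.hitStable_total.annPow_one ▸
          M.hitStable_total.annPow_antitone (by omega) hh
        have h0 : pair g h
            (delta (S.π : C →ₗ[k] C) x) = 0 := by
          have hle : (⨆ i : Fin n, tens (S.kerFiltration M (i + 1)) (S.kerFiltration M (n - i))) ≤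
              LinearMap.ker (pair g h) :=
            iSup_le fun i z hz => pair_eq_zero_of_mem_tens (Or.inr fun y hy =>
              ((S.mem_kerFiltration M).1 hy).2 h
                (M.hitStable_total.annPow_antitone (by omega) hh)) hz
          exact hle hx
        rw [pair_delta, S.pull_eq_zero M hg, S.pull_eq_zero M hh', zero_mul, mul_zero] at h0
        simpa using h0
      · rw [WithConv.ofConv_add, LinearMap.add_apply, hp, hq, add_zero]
  · rintro ⟨hx1, hx2⟩
    refine mem_iSup_tens_of_filtration (S.kerFiltration_mono M) (S.kerFiltration_zero M)
      fun a b hab => mem_tens_sup_of_forall fun f hf g hg => ?_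
    -- For y killed by J^{c+1}, the element y - π y lies in the c-th step of the filtration, where p
    -- vanishes.
    have hsub : ∀ {c : ℕ} {p : ConvDual k C}, p ∈ ann (S.kerFiltration M c) →
        p - pull S.π p ∈ annPow M.total (c + 1) := by
      intro c p hp
      rw [← ann_coann (annPow M.total (c + 1))]
      refine mem_ann.2 fun y hy => ?_
      have := mem_ann.1 hp _ (S.sub_π_mem_kerFiltration M hy)
      rwa [map_sub] at this
    have h1 := hx2 _ (M.hitStable_total.annPow_antitone (by omega : n + 1 + 1 ≤ a + 1 + (b + 1))
      (M.hitStable_total.mul_mem_annPow (hsub hf) (hsub hg)))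
    have h2 : (pull S.π f * pull S.π g : ConvDual k C) x = 0 := by
      rw [← pull_mul, pull_apply, hx1, map_zero]
    rw [pair_delta]
    -- The left side is in J^{a+1} J^{b+1} ⊆ J^{n+2}, hence zero at x; the last term on the right is
    -- zero at x because π x = 0.
    have h3 : (f - pull S.π f) * (g - pull S.π g) =
        f * g - pull S.π f * g - f * pull S.π g + pull S.π f * pull S.π g := by
      rw [sub_mul, mul_sub, mul_sub]; abel
    rw [h3, WithConv.ofConv_add, LinearMap.add_apply, h2, add_zero] at h1
    exact h1

end BlockSystem

end Filtration

/-! ### Lifted matrix units and isotypic components -/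

section Isotypic

variable {k C : Type*} [Field k] [AddCommGroup C] [Module k C]

theorem eq_of_forall_pair [FiniteDimensional k C] {z w : C ⊗[k] C}
    (h : ∀ f g : ConvDual k C, pair f g z = pair f g w) : z = w := by
  rw [← sub_eq_zero]
  refine tmul_eq_zero_of_forall fun f g => ?_
  have := h (WithConv.toConv f) (WithConv.toConv g)
  rw [← sub_eq_zero, ← map_sub] at this
  exact this

variable [Coalgebra k C]

theorem pair_rhoL (f g : ConvDual k C) (π : C →ₗc[k] C) (x : C) :
    pair f g (rhoL (π : C →ₗ[k] C) x) = (pull π f * g) x := by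
  rw [rhoL, LinearMap.comp_apply, pair_map]
  rfl

theorem pair_rhoR (f g : ConvDual k C) (π : C →ₗc[k] C) (x : C) :
    pair f g (rhoR (π : C →ₗ[k] C) x) = (f * pull π g) x := by
  rw [rhoR, LinearMap.comp_apply, pair_map]
  rfl

theorem leftHit_pull_eq_of_rhoL {ι : Type*} [Fintype ι] {π : C →ₗc[k] C} {x : C} {y z : ι → C}
    (h : rhoL (π : C →ₗ[k] C) x = ∑ i, y i ⊗ₜ[k] z i) (f : ConvDual k C) :
    leftHit (pull π f) x = ∑ i, f (y i) • z i :=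
  eq_of_forall_apply_eq fun g => by
    rw [apply_leftHit, ← pair_rhoL, h]
    simp

theorem rightHit_pull_eq_of_rhoR {ι : Type*} [Fintype ι] {π : C →ₗc[k] C} {x : C} {y z : ι → C}
    (h : rhoR (π : C →ₗ[k] C) x = ∑ i, y i ⊗ₜ[k] z i) (f : ConvDual k C) :
    rightHit (pull π f) x = ∑ i, f (z i) • y i :=
  eq_of_forall_apply_eq fun g => by
    rw [apply_rightHit, ← pair_rhoR, h]
    simp [mul_comm]

theorem MatrixCoeffs.mul_apply_e (M : MatrixCoeffs k C) (f g : ConvDual k C) (i : Fin M.r)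
    (a b : Fin (M.d i)) : (f * g) (M.e i a b) = ∑ c, f (M.e i a c) * g (M.e i c b) := by
  rw [← apply_leftHit, M.leftHit_e]
  simp

namespace BlockSystem

variable (S : BlockSystem k C) (M : MatrixCoeffs k C)

theorem leftHit_pull_mem_kerFiltration (f : ConvDual k C) {n : ℕ} {x : C}
    (hx : x ∈ S.kerFiltration M n) : leftHit (pull S.π f) x ∈ S.kerFiltration M n := by
  rw [mem_kerFiltration] at hx ⊢
  refine ⟨eq_zero_of_forall_apply (k := k) fun g => ?_, fun g hg => ?_⟩
  · rw [← pull_apply, apply_leftHit, ← pull_mul, pull_apply, hx.1, map_zero]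
  · rw [apply_leftHit]
    exact hx.2 _ (mul_mem_annPow_left _ hg)

theorem rightHit_pull_mem_kerFiltration (f : ConvDual k C) {n : ℕ} {x : C}
    (hx : x ∈ S.kerFiltration M n) : rightHit (pull S.π f) x ∈ S.kerFiltration M n := by
  rw [mem_kerFiltration] at hx ⊢
  refine ⟨eq_zero_of_forall_apply (k := k) fun g => ?_, fun g hg => ?_⟩
  · rw [← pull_apply, apply_rightHit, ← pull_mul, pull_apply, hx.1, map_zero]
  · rw [apply_rightHit]
    exact hx.2 _ (M.hitStable_total.mul_mem_annPow_right _ hg)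

/-- Matrix units in the dual algebra that lift the dual basis of the coradical. -/
def unit (i : Fin M.r) (a b : Fin (M.d i)) : ConvDual k C :=
  pull S.π (M.exists_isDual.choose i a b)

/-- The central idempotent of the `i`-th simple subcoalgebra, lifted to the dual algebra. -/
def eps (i : Fin M.r) : ConvDual k C := ∑ a, S.unit M i a a

/-- The part of `kerFiltration n` of type `(i, j)`. -/
def component (n : ℕ) (i j : Fin M.r) : Submodule k C :=
  S.kerFiltration M n ⊓ LinearMap.eqLocus (leftHit (S.eps M i)) LinearMap.id ⊓
    LinearMap.eqLocus (rightHit (S.eps M j)) LinearMap.id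

theorem mem_component {n : ℕ} {i j : Fin M.r} {x : C} : x ∈ S.component M n i j ↔
    x ∈ S.kerFiltration M n ∧ leftHit (S.eps M i) x = x ∧ rightHit (S.eps M j) x = x := by
  rw [component, Submodule.mem_inf, Submodule.mem_inf, and_assoc]
  rfl

theorem pull_unit (i : Fin M.r) (a b : Fin (M.d i)) : pull S.π (S.unit M i a b) = S.unit M i a b :=
  S.pull_pull _

theorem pull_sum {ι : Type*} (s : Finset ι) (f : ι → ConvDual k C) :
    pull S.π (∑ i ∈ s, f i) = ∑ i ∈ s, pull S.π (f i) :=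
  WithConv.ext (LinearMap.ext fun x => by simp [pull])

theorem pull_eps (i : Fin M.r) : pull S.π (S.eps M i) = S.eps M i := by
  rw [eps, pull_sum]
  simp_rw [pull_unit]

variable [FiniteDimensional k C]

/-- The image of `pull` only sees the restriction to the coradical, so the relations between lifted
matrix units can be checked on matrix coefficients. -/
theorem pull_congr {f g : ConvDual k C}
    (h : ∀ i a b, f (M.e i a b) = g (M.e i a b)) : pull S.π f = pull S.π g := by
  refine WithConv.ext (LinearMap.ext fun x => ?_)
  refine M.total_induction (p := fun y => f y = g y) (by simp) ?_ ?_ h (S.π_mem_total M x)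
  · intro x y hx hy
    rw [map_add, map_add, hx, hy]
  · intro c x hx
    rw [map_smul, map_smul, hx]

theorem isDual_unit : M.IsDual (S.unit M) where
  apply_self i a b a' b' := by
    rw [unit, pull_apply, S.π_eq_self M (M.e_mem_total _ _ _)]
    exact M.exists_isDual.choose_spec.apply_self i a b a' b'
  apply_ne i a b j a' b' hij := by
    rw [unit, pull_apply, S.π_eq_self M (M.e_mem_total _ _ _)]
    exact M.exists_isDual.choose_spec.apply_ne i a b j a' b' hij

theorem unit_mul_self (i : Fin M.r) (a b c d : Fin (M.d i)) :
    S.unit M i a b * S.unit M i c d = if b = c then S.unit M i a d else 0 := by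
  have hu := S.isDual_unit M
  have h : pull S.π (S.unit M i a b * S.unit M i c d) =
      pull S.π (if b = c then S.unit M i a d else 0) := by
    refine S.pull_congr M fun j p q => ?_
    rw [← apply_leftHit]
    by_cases hij : i = j
    · subst hij
      rw [hu.leftHit_self]
      by_cases h1 : a = p <;> by_cases h2 : b = c <;> simp [h1, h2, hu.apply_self, eq_comm]
    · rw [hu.leftHit_ne _ _ _ _ _ _ hij]
      by_cases h2 : b = c <;> simp [h2, hu.apply_ne _ _ _ _ _ _ hij]
  rw [pull_mul, pull_unit, pull_unit] at h
  rw [h]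
  split_ifs
  · exact S.pull_unit M _ _ _
  · rfl

theorem unit_mul_ne {i j : Fin M.r} (hij : i ≠ j) (a b c d) :
    S.unit M i a b * S.unit M j c d = 0 := by
  have hu := S.isDual_unit M
  have h : pull S.π (S.unit M i a b * S.unit M j c d) = pull S.π 0 := by
    refine S.pull_congr M fun l p q => ?_
    rw [← apply_leftHit]
    by_cases hil : i = l
    · subst hil
      rw [hu.leftHit_self]
      split_ifs
      · exact hu.apply_ne _ _ _ _ _ _ hij.symm
      · simp
    · rw [hu.leftHit_ne _ _ _ _ _ _ hil]
      simp
  rw [pull_mul, pull_unit, pull_unit] at h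
  exact h

theorem sum_eps : ∑ i, S.eps M i = 1 := by
  have hu := S.isDual_unit M
  have h : pull S.π (∑ i, S.eps M i) = pull S.π 1 := by
    refine S.pull_congr M fun j p q => ?_
    rw [one_apply, M.counit_eq, WithConv.ofConv_sum, LinearMap.sum_apply, Finset.sum_eq_single j]
    · rw [eps, WithConv.ofConv_sum, LinearMap.sum_apply]
      simp_rw [hu.apply_self]
      rw [Finset.sum_eq_single p]
      · simp
      · intro a _ ha; simp [ha]
      · simp
    · intro i _ hij
      rw [eps, WithConv.ofConv_sum, LinearMap.sum_apply]
      exact Finset.sum_eq_zero fun a _ => hu.apply_ne _ _ _ _ _ _ hij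
    · simp
  rw [pull_sum, pull_one] at h
  simpa only [pull_eps] using h

theorem unit_mul_eps (i : Fin M.r) (a b : Fin (M.d i)) :
    S.unit M i a b * S.eps M i = S.unit M i a b := by
  rw [eps, Finset.mul_sum]
  simp_rw [unit_mul_self]
  simp

theorem eps_mul_eps_self (i : Fin M.r) : S.eps M i * S.eps M i = S.eps M i := by
  conv_lhs => enter [1]; rw [eps]
  rw [Finset.sum_mul]
  exact Finset.sum_congr rfl fun a _ => S.unit_mul_eps M i a a

theorem eps_mul_eps_ne {i j : Fin M.r} (hij : i ≠ j) : S.eps M i * S.eps M j = 0 := by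
  rw [eps, eps, Finset.sum_mul]
  simp_rw [Finset.mul_sum, S.unit_mul_ne M hij, Finset.sum_const_zero]

theorem eps_apply_ne {i j : Fin M.r} (hij : i ≠ j) {x : C} (hx : x ∈ M.D j) :
    S.eps M i x = 0 := by
  rw [eps, WithConv.ofConv_sum, LinearMap.sum_apply]
  exact Finset.sum_eq_zero fun a _ => (S.isDual_unit M).apply_D_ne hij a a hx

theorem eps_apply_self {i : Fin M.r} {x : C} (hx : x ∈ M.D i) :
    S.eps M i x = Coalgebra.counit (R := k) x := by
  rw [← one_apply, ← S.sum_eps M, WithConv.ofConv_sum, LinearMap.sum_apply,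
    Finset.sum_eq_single i]
  · intro j _ hj
    exact S.eps_apply_ne M hj hx
  · simp

theorem pull_eq_sum (f : ConvDual k C) :
    pull S.π f = ∑ p : M.Idx, f (M.vec p) • S.unit M p.1 p.2.1 p.2.2 := by
  have hu := S.isDual_unit M
  have h : pull S.π f = pull S.π (∑ p : M.Idx, f (M.vec p) • S.unit M p.1 p.2.1 p.2.2) := by
    refine S.pull_congr M fun i a b => ?_
    rw [WithConv.ofConv_sum, LinearMap.sum_apply, Finset.sum_eq_single ⟨i, a, b⟩]
    · simp [hu.apply_self, MatrixCoeffs.vec]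
    · rintro ⟨j, c, d⟩ - hne
      by_cases hij : j = i
      · subst hij
        have : ¬ (c = a ∧ d = b) := by rintro ⟨rfl, rfl⟩; exact hne rfl
        simp [hu.apply_self, this]
      · simp [hu.apply_ne _ _ _ _ _ _ hij]
    · simp
  rw [h, pull_sum]
  refine Finset.sum_congr rfl fun p _ => ?_
  conv_rhs => rw [← pull_unit]
  rfl

theorem rhoL_eq_sum (x : C) : rhoL (S.π : C →ₗ[k] C) x =
    ∑ p : M.Idx, M.vec p ⊗ₜ[k] leftHit (S.unit M p.1 p.2.1 p.2.2) x := by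
  refine eq_of_forall_pair fun f g => ?_
  rw [pair_rhoL, S.pull_eq_sum M f, Finset.sum_mul, map_sum, WithConv.ofConv_sum,
    LinearMap.sum_apply]
  refine Finset.sum_congr rfl fun p _ => ?_
  rw [pair_tmul, apply_leftHit, smul_mul_assoc]
  rfl

theorem rhoR_eq_sum (x : C) : rhoR (S.π : C →ₗ[k] C) x =
    ∑ p : M.Idx, rightHit (S.unit M p.1 p.2.1 p.2.2) x ⊗ₜ[k] M.vec p := by
  refine eq_of_forall_pair fun f g => ?_
  rw [pair_rhoR, S.pull_eq_sum M g, Finset.mul_sum, map_sum, WithConv.ofConv_sum,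
    LinearMap.sum_apply]
  refine Finset.sum_congr rfl fun p _ => ?_
  rw [pair_tmul, apply_rightHit, mul_smul_comm, mul_comm]
  rfl

/-- The vectors of a simple subbicomodule. -/
def typeVec {i j : Fin M.r} (a₀ : Fin (M.d i)) (b₀ : Fin (M.d j)) (x : C) (a : Fin (M.d i))
    (b : Fin (M.d j)) : C :=
  leftHit (S.unit M i a₀ a) (rightHit (S.unit M j b b₀) x)

theorem rhoL_typeVec {i j : Fin M.r} (a₀ : Fin (M.d i)) (b₀ : Fin (M.d j)) (x : C)
    (a : Fin (M.d i)) (b : Fin (M.d j)) : rhoL (S.π : C →ₗ[k] C) (S.typeVec M a₀ b₀ x a b) =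
      ∑ l, M.e i a l ⊗ₜ[k] S.typeVec M a₀ b₀ x l b := by
  rw [S.rhoL_eq_sum M, Fintype.sum_sigma, Finset.sum_eq_single i]
  · rw [Fintype.sum_prod_type, Finset.sum_eq_single a]
    · refine Finset.sum_congr rfl fun l _ => ?_
      rw [typeVec, leftHit_leftHit, unit_mul_self, if_pos rfl]
      rfl
    · intro p _ hp
      refine Finset.sum_eq_zero fun l _ => ?_
      rw [typeVec, leftHit_leftHit, unit_mul_self, if_neg hp.symm]
      simp [leftHit]
    · simp
  · intro i' _ hi'
    refine Finset.sum_eq_zero fun p _ => ?_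
    rw [typeVec, leftHit_leftHit, S.unit_mul_ne M hi'.symm]
    simp [leftHit]
  · simp

theorem rhoR_typeVec {i j : Fin M.r} (a₀ : Fin (M.d i)) (b₀ : Fin (M.d j)) (x : C)
    (a : Fin (M.d i)) (b : Fin (M.d j)) : rhoR (S.π : C →ₗ[k] C) (S.typeVec M a₀ b₀ x a b) =
      ∑ l, S.typeVec M a₀ b₀ x a l ⊗ₜ[k] M.e j l b := by
  rw [S.rhoR_eq_sum M, Fintype.sum_sigma, Finset.sum_eq_single j]
  · rw [Fintype.sum_prod_type, Finset.sum_comm, Finset.sum_eq_single b]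
    · refine Finset.sum_congr rfl fun l _ => ?_
      rw [typeVec, ← leftHit_rightHit, rightHit_rightHit, unit_mul_self, if_pos rfl]
      rfl
    · intro p _ hp
      refine Finset.sum_eq_zero fun l _ => ?_
      rw [typeVec, ← leftHit_rightHit, rightHit_rightHit, unit_mul_self, if_neg hp]
      simp [rightHit]
    · simp
  · intro j' _ hj'
    refine Finset.sum_eq_zero fun p _ => ?_
    rw [typeVec, ← leftHit_rightHit, rightHit_rightHit, S.unit_mul_ne M hj']
    simp [rightHit]
  · simp

theorem leftHit_rightHit_typeVec {i j : Fin M.r} (a₀ : Fin (M.d i)) (b₀ : Fin (M.d j)) (x : C)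
    (a a' p : Fin (M.d i)) (b b' q : Fin (M.d j)) :
    leftHit (S.unit M i a' p) (rightHit (S.unit M j q b') (S.typeVec M a₀ b₀ x a b)) =
      if a = a' ∧ b = b' then S.typeVec M a₀ b₀ x p q else 0 := by
  rw [typeVec, ← leftHit_rightHit, rightHit_rightHit, leftHit_leftHit, unit_mul_self,
    unit_mul_self]
  by_cases h1 : a = a' <;> by_cases h2 : b = b'
  · simp [h1, h2, typeVec]
  · simp [h2, Ne.symm h2, rightHit]
  · simp [h1, leftHit]
  · simp [h1, leftHit]

/-- By `leftHit_rightHit_typeVec` the matrix units carry any of these vectors to any other and kill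
the rest, so a single nonzero one forces linear independence. -/
theorem isBicomoduleOfType_span_typeVec {i j : Fin M.r} (a₀ : Fin (M.d i)) (b₀ : Fin (M.d j))
    (x : C) {p : Fin (M.d i)} {q : Fin (M.d j)} (h : S.typeVec M a₀ b₀ x p q ≠ 0) :
    IsBicomoduleOfType (S.π : C →ₗ[k] C) (M.D i) (M.D j) (Submodule.span k
      (Set.range fun c : Fin (M.d i) × Fin (M.d j) => S.typeVec M a₀ b₀ x c.1 c.2)) := by
  refine ⟨M.d i, M.d j, M.e i, M.e j, S.typeVec M a₀ b₀ x, M.isStandardBasis i,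
    M.isStandardBasis j, ?_, rfl, S.rhoL_typeVec M a₀ b₀ x, S.rhoR_typeVec M a₀ b₀ x⟩
  rw [Fintype.linearIndependent_iff]
  intro c hc ab
  have := congrArg (fun y => leftHit (S.unit M i ab.1 p) (rightHit (S.unit M j q ab.2) y)) hc
  simp only [map_sum, map_smul, leftHit_rightHit_typeVec, map_zero] at this
  rw [Finset.sum_eq_single ab] at this
  · simpa [h] using this
  · intro b _ hb
    rw [if_neg (fun h => hb (Prod.ext h.1 h.2)), smul_zero]
  · simp

/-- On V_D ⊗ V_E^* the idempotents of D and E act through the counits, that is, as the identity.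
Conversely, writing both idempotents as sums of diagonal matrix units decomposes x into vectors that
are zero or lie in a subbicomodule of the right type. -/
theorem isotypic_kerFiltration (n : ℕ) (i j : Fin M.r) :
    isotypic (S.π : C →ₗ[k] C) (M.D i) (M.D j) (S.kerFiltration M n) = S.component M n i j := by
  refine le_antisymm (sSup_le ?_) fun x hx => ?_
  · rintro _ ⟨hN, d, d', e, f, w, he, hf, -, rfl, hwL, hwR⟩
    refine Submodule.span_le.2 ?_
    rintro _ ⟨⟨a, b⟩, rfl⟩
    refine (S.mem_component M).2 ⟨hN (Submodule.subset_span ⟨(a, b), rfl⟩), ?_, ?_⟩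
    · rw [← pull_eps, leftHit_pull_eq_of_rhoL (hwL a b)]
      have : ∀ l, S.eps M i (e a l) = if a = l then 1 else 0 := fun l => by
        rw [S.eps_apply_self M (he.span_eq ▸ Submodule.subset_span ⟨(a, l), rfl⟩), he.counit_eq]
      simp [this]
    · rw [← pull_eps, rightHit_pull_eq_of_rhoR (hwR a b)]
      have : ∀ l, S.eps M j (f l b) = if l = b then 1 else 0 := fun l => by
        rw [S.eps_apply_self M (hf.span_eq ▸ Submodule.subset_span ⟨(l, b), rfl⟩), hf.counit_eq]
      simp [this]
  · rw [mem_component] at hx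
    have hx' : x = ∑ a : Fin (M.d i), ∑ b : Fin (M.d j), S.typeVec M a b x a b := by
      conv_lhs => rw [← hx.2.1, ← hx.2.2, eps, leftHit_sum]
      refine Finset.sum_congr rfl fun a _ => ?_
      rw [eps, rightHit_sum, map_sum]
      rfl
    rw [hx']
    refine sum_mem fun a _ => sum_mem fun b _ => ?_
    by_cases h0 : S.typeVec M a b x a b = 0
    · rw [h0]
      exact zero_mem _
    refine (le_sSup ⟨Submodule.span_le.2 ?_, S.isBicomoduleOfType_span_typeVec M a b x h0⟩ :
      _ ≤ isotypic _ _ _ _) (Submodule.subset_span ⟨(a, b), rfl⟩)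
    rintro _ ⟨⟨c, d⟩, rfl⟩
    exact S.leftHit_pull_mem_kerFiltration M _ (S.rightHit_pull_mem_kerFiltration M _ hx.1)

end BlockSystem

end Isotypic

/-! ### Blocks and the layers of the radical -/

section Links

variable {k C : Type*} [Field k] [AddCommGroup C] [Module k C] [Coalgebra k C]

namespace MatrixCoeffs

variable (M : MatrixCoeffs k C)

/-- The upper left matrix coefficient of the `i`-th subcoalgebra. -/
def corner (i : Fin M.r) : C := M.e i ⟨0, M.d_pos i⟩ ⟨0, M.d_pos i⟩

theorem corner_mem_D (i : Fin M.r) : M.corner i ∈ M.D i := M.e_mem_D i _ _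

theorem corner_mem_total (i : Fin M.r) : M.corner i ∈ M.total := M.e_mem_total i _ _

variable {M} {i : Fin M.r} (hi : M.d i = 1)
include hi

theorem e_eq_corner (a b : Fin (M.d i)) : M.e i a b = M.corner i := by
  have : ∀ c : Fin (M.d i), c = ⟨0, M.d_pos i⟩ := fun c => Fin.ext (by have := c.2; omega)
  rw [this a, this b, corner]

theorem isGroupLikeElem_corner : IsGroupLikeElem k (M.corner i) where
  counit_eq_one := by rw [corner, M.counit_eq, if_pos rfl]
  comul_eq_tmul_self := by
    rw [corner, M.comul_eq]
    simp_rw [e_eq_corner hi]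
    simp [hi]

theorem D_eq_span_corner : M.D i = Submodule.span k {M.corner i} := by
  refine le_antisymm (Submodule.span_le.2 ?_)
    (Submodule.span_le.2 (Set.singleton_subset_iff.2 (M.corner_mem_D i)))
  rintro _ ⟨⟨a, b⟩, rfl⟩
  dsimp only
  rw [e_eq_corner hi]
  exact Submodule.mem_span_singleton_self _

end MatrixCoeffs

theorem leftHit_groupLike {g : C} (hg : IsGroupLikeElem k g) (f : ConvDual k C) :
    leftHit f g = f g • g := by
  simp [leftHit, hg.comul_eq_tmul_self]

theorem rightHit_groupLike {g : C} (hg : IsGroupLikeElem k g) (f : ConvDual k C) :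
    rightHit f g = f g • g := by
  simp [rightHit, hg.comul_eq_tmul_self]

theorem isSimpleSubcoalgebra_span_groupLike [FiniteDimensional k C] {g : C}
    (hg : IsGroupLikeElem k g) : IsSimpleSubcoalgebra (Submodule.span k {g}) where
  isSubcoalgebra := by
    refine isSubcoalgebra_iff_hitStable.2 fun f x hx => ?_
    obtain ⟨c, rfl⟩ := Submodule.mem_span_singleton.1 hx
    rw [map_smul, map_smul, leftHit_groupLike hg, rightHit_groupLike hg]
    exact ⟨Submodule.smul_mem _ _ (Submodule.smul_mem _ _ (Submodule.mem_span_singleton_self g)),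
      Submodule.smul_mem _ _ (Submodule.smul_mem _ _ (Submodule.mem_span_singleton_self g))⟩
  ne_bot h := hg.ne_zero (Submodule.span_singleton_eq_bot.1 h)
  eq_bot_or_eq E hE _ := by
    refine or_iff_not_imp_left.2 fun hne => le_antisymm hE ?_
    obtain ⟨x, hx, hx0⟩ := E.exists_mem_ne_zero_of_ne_bot hne
    obtain ⟨c, rfl⟩ := Submodule.mem_span_singleton.1 (hE hx)
    have hc : c ≠ 0 := by rintro rfl; simp at hx0
    exact (Submodule.span_singleton_le_iff_mem _ _).2 ((Submodule.smul_mem_iff _ hc).1 hx)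

theorem MatrixCoeffs.exists_corner_eq [FiniteDimensional k C] (M : MatrixCoeffs k C) {g : C}
    (hg : IsGroupLikeElem k g) : ∃ i, M.d i = 1 ∧ M.corner i = g := by
  obtain ⟨i, hi⟩ := M.exists_eq_D (isSimpleSubcoalgebra_span_groupLike hg)
  have hd : M.d i = 1 := by
    have := M.finrank_D i
    rw [← hi, finrank_span_singleton hg.ne_zero] at this
    exact (Nat.pow_eq_one.1 this.symm).resolve_right (by norm_num)
  refine ⟨i, hd, ?_⟩
  have hmem := M.corner_mem_D i
  rw [← hi] at hmem
  obtain ⟨c, hc⟩ := Submodule.mem_span_singleton.1 hmem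
  have := congrArg (Coalgebra.counit (R := k)) hc
  rw [map_smul, hg.counit_eq_one, (MatrixCoeffs.isGroupLikeElem_corner hd).counit_eq_one,
    smul_eq_mul, mul_one] at this
  rw [← hc, this, one_smul]

namespace BlockSystem

variable (S : BlockSystem k C) (M : MatrixCoeffs k C)

/-- The `n`-th layer of the radical filtration of the dual algebra has a nonzero `(i, j)`-part. -/
def Link (n : ℕ) (i j : Fin M.r) : Prop :=
  ∃ f ∈ annPow M.total n, S.eps M i * f * S.eps M j ∉ annPow M.total (n + 1)

theorem mem_ann_total_iff {f : ConvDual k C} :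
    f ∈ ann M.total ↔ ∀ i a b, f (M.e i a b) = 0 := by
  rw [mem_ann]
  refine ⟨fun h i a b => h _ (M.e_mem_total i a b), fun h x hx => ?_⟩
  refine M.total_induction (p := fun x => f x = 0) (by simp) ?_ ?_ h hx
  · intro x y hx hy
    rw [map_add, hx, hy, add_zero]
  · intro c x hx
    rw [map_smul, hx, smul_zero]

theorem apply_eq_of_mem_component {n : ℕ} {i j : Fin M.r} {x : C}
    (hx : x ∈ S.component M n i j) (f : ConvDual k C) :
    (S.eps M i * f * S.eps M j) x = f x := by
  rw [mem_component] at hx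
  rw [← apply_rightHit, hx.2.2, ← apply_leftHit, hx.2.1]

theorem finrank_D_eq_sq_iff (i : Fin M.r) (d : ℕ) :
    Module.finrank k (M.D i) = d ^ 2 ↔ M.d i = d := by
  rw [M.finrank_D]
  exact ⟨fun h => Nat.pow_left_injective (by norm_num) h, fun h => h ▸ rfl⟩

variable [FiniteDimensional k C]

theorem eps_corner (i : Fin M.r) : S.eps M i (M.corner i) = 1 := by
  rw [S.eps_apply_self M (M.corner_mem_D i), MatrixCoeffs.corner, M.counit_eq, if_pos rfl]

theorem eps_corner_ne {i j : Fin M.r} (h : i ≠ j) : S.eps M i (M.corner j) = 0 :=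
  S.eps_apply_ne M h (M.corner_mem_D j)

/-- Modulo J, the idempotent of a group-like g spans an ideal on which f acts by the scalar f(g).
This is how degree-one simple subcoalgebras are exploited throughout. -/
theorem mul_eps_sub_mem {i : Fin M.r} (hi : M.d i = 1) (f : ConvDual k C) :
    f * S.eps M i - f (M.corner i) • S.eps M i ∈ ann M.total := by
  rw [mem_ann_total_iff]
  intro j a b
  rw [WithConv.ofConv_sub, LinearMap.sub_apply, M.mul_apply_e]
  by_cases hij : i = j
  · subst hij
    simp_rw [MatrixCoeffs.e_eq_corner hi, eps_corner]
    simp [hi, eps_corner]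
  · have : ∀ a b, S.eps M i (M.e j a b) = 0 := fun a b => S.eps_apply_ne M hij (M.e_mem_D _ _ _)
    simp [this]

theorem eps_mul_sub_mem {i : Fin M.r} (hi : M.d i = 1) (f : ConvDual k C) :
    S.eps M i * f - f (M.corner i) • S.eps M i ∈ ann M.total := by
  rw [mem_ann_total_iff]
  intro j a b
  rw [WithConv.ofConv_sub, LinearMap.sub_apply, M.mul_apply_e]
  by_cases hij : i = j
  · subst hij
    simp_rw [MatrixCoeffs.e_eq_corner hi, eps_corner]
    simp [hi, eps_corner]
  · have : ∀ a b, S.eps M i (M.e j a b) = 0 := fun a b => S.eps_apply_ne M hij (M.e_mem_D _ _ _)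
    simp [this]

/-- Insert 1 = ∑ ε_l between the factors of J^n J. If for each l one of the two pieces dropped to
the next power, the whole product would lie in J^{n+2}. -/
theorem Link.exists_left {n : ℕ} {i j : Fin M.r} (h : S.Link M (n + 1) i j) :
    ∃ l, S.Link M n i l ∧ S.Link M 1 l j := by
  by_contra! hcon
  obtain ⟨f, hf, hfn⟩ := h
  refine hfn (Submodule.mul_induction_on hf (fun p hp q hq => ?_) fun p q hp hq => ?_)
  · have : S.eps M i * (p * q) * S.eps M j =
        ∑ l, (S.eps M i * p * S.eps M l) * (S.eps M l * q * S.eps M j) := by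
      have h1 : ∀ l, (S.eps M i * p * S.eps M l) * (S.eps M l * q * S.eps M j) =
          S.eps M i * p * S.eps M l * (q * S.eps M j) := fun l => by
        rw [mul_assoc (S.eps M i * p) (S.eps M l), ← mul_assoc (S.eps M l),
          ← mul_assoc (S.eps M l) (S.eps M l) q, eps_mul_eps_self, mul_assoc (S.eps M l),
          ← mul_assoc (S.eps M i * p)]
      simp_rw [h1]
      rw [← Finset.sum_mul, ← Finset.mul_sum, sum_eps, mul_one]
      simp only [mul_assoc]
    rw [this]
    have hT := M.hitStable_total
    rw [← hT.annPow_one] at hq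
    refine sum_mem fun l _ => ?_
    by_cases hl : S.Link M n i l
    · have h2 : S.eps M l * q * S.eps M j ∈ annPow M.total 2 := by
        by_contra h2
        exact hcon l hl ⟨q, hq, h2⟩
      exact hT.mul_mem_annPow (m := n) (n := 2)
        (hT.mul_mem_annPow_right _ (mul_mem_annPow_left _ hp)) h2
    · have h2 : S.eps M i * p * S.eps M l ∈ annPow M.total (n + 1) := by
        by_contra h2
        exact hl ⟨p, hp, h2⟩
      exact hT.mul_mem_annPow h2 (hT.mul_mem_annPow_right _ (mul_mem_annPow_left _ hq))
  · rw [mul_add, add_mul]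
    exact add_mem hp hq

theorem component_sup_Q {n : ℕ} (hn : 1 ≤ n) (i j : Fin M.r) :
    S.component M (n - 1) i j ⊔ S.Q (M.D i) (M.D j) n = S.component M n i j := by
  have := S.Q_sup _ _ n (M.isSimpleSubcoalgebra_D i) (M.isSimpleSubcoalgebra_D j) hn
  rwa [S.P_eq M, S.P_eq M, isotypic_kerFiltration, isotypic_kerFiltration] at this

theorem component_inf_Q {n : ℕ} (hn : 1 ≤ n) (i j : Fin M.r) :
    S.component M (n - 1) i j ⊓ S.Q (M.D i) (M.D j) n = ⊥ := by
  have := S.Q_disjoint _ _ n (M.isSimpleSubcoalgebra_D i) (M.isSimpleSubcoalgebra_D j) hn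
  rwa [S.P_eq M, isotypic_kerFiltration] at this

theorem Q_le_component {n : ℕ} (hn : 1 ≤ n) (i j : Fin M.r) :
    S.Q (M.D i) (M.D j) n ≤ S.component M n i j :=
  S.component_sup_Q M hn i j ▸ le_sup_right

theorem apply_eq_zero_of_mem_component_left {n : ℕ} {i j l : Fin M.r} (hl : l ≠ i) {x : C}
    (hx : x ∈ S.component M n i j) (f : ConvDual k C) : (S.eps M l * f) x = 0 := by
  rw [← S.apply_eq_of_mem_component M hx, ← mul_assoc, S.eps_mul_eps_ne M hl.symm, zero_mul,
    zero_mul]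
  rfl

theorem apply_eq_zero_of_mem_component_right {n : ℕ} {i j l : Fin M.r} (hl : l ≠ j) {x : C}
    (hx : x ∈ S.component M n i j) (f : ConvDual k C) : (f * S.eps M l) x = 0 := by
  rw [← S.apply_eq_of_mem_component M hx, mul_assoc, mul_assoc f, S.eps_mul_eps_ne M hl,
    mul_zero, mul_zero]
  rfl

/-- Some y killed by J^{n+1} has (ε_i f ε_j)(y) ≠ 0. Subtracting π y and hitting with the
idempotents moves it into the (i, j)-component; f, being in J^n, kills the summand from step n - 1,
so the Q-part carries the value. -/
theorem exists_mem_Q_apply_ne_zero {n : ℕ} (hn : 1 ≤ n) {i j : Fin M.r} {f : ConvDual k C}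
    (hf : f ∈ annPow M.total n) (h : S.eps M i * f * S.eps M j ∉ annPow M.total (n + 1)) :
    ∃ x ∈ S.Q (M.D i) (M.D j) n, f x ≠ 0 := by
  have hT := M.hitStable_total
  obtain ⟨y, hy, hfy⟩ := exists_mem_coann_apply_ne_zero h
  have hz := S.sub_π_mem_kerFiltration M hy
  set z := y - S.π y with hz_def
  have hmem : S.eps M i * f * S.eps M j ∈ ann M.total := by
    rw [← hT.annPow_one]
    exact hT.annPow_antitone hn (hT.mul_mem_annPow_right _ (mul_mem_annPow_left _ hf))
  have hfz : (S.eps M i * f * S.eps M j) z ≠ 0 := by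
    rwa [hz_def, map_sub, mem_ann.1 hmem _ (S.π_mem_total M y), sub_zero]
  set w := leftHit (S.eps M i) (rightHit (S.eps M j) z) with hw_def
  have hw : w ∈ S.component M n i j := by
    refine (S.mem_component M).2 ⟨?_, ?_, ?_⟩
    · rw [hw_def, ← pull_eps, ← S.pull_eps M j]
      exact S.leftHit_pull_mem_kerFiltration M _ (S.rightHit_pull_mem_kerFiltration M _ hz)
    · rw [hw_def, leftHit_leftHit, eps_mul_eps_self]
    · rw [hw_def, ← leftHit_rightHit, rightHit_rightHit, eps_mul_eps_self]
  have hfw : f w ≠ 0 := by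
    rwa [hw_def, apply_leftHit, apply_rightHit]
  rw [← S.component_sup_Q M hn] at hw
  obtain ⟨u, hu, v, hv, huv⟩ := Submodule.mem_sup.1 hw
  refine ⟨v, hv, ?_⟩
  have hfu : f u = 0 := by
    refine ((S.mem_kerFiltration M).1 ((S.mem_component M).1 hu).1).2 f ?_
    rwa [Nat.sub_add_cancel hn]
  rwa [← huv, map_add, hfu, zero_add] at hfw

/-- Otherwise all of J^n would vanish at x, placing x in step n - 1 of the filtration, which meets Q
only in 0. -/
theorem exists_apply_ne_zero_of_mem_Q {n : ℕ} (hn : 1 ≤ n) {i j : Fin M.r} {x : C}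
    (hx : x ∈ S.Q (M.D i) (M.D j) n) (h0 : x ≠ 0) : ∃ f ∈ annPow M.total n,
      f x ≠ 0 ∧ S.eps M i * f * S.eps M j ∉ annPow M.total (n + 1) := by
  have hx' := S.Q_le_component M hn i j hx
  by_contra! hcon
  have hker := (S.mem_component M).1 hx'
  have hall : ∀ f ∈ annPow M.total n, f x = 0 := fun f hf => by
    by_contra hfx
    refine hfx ?_
    rw [← S.apply_eq_of_mem_component M hx']
    exact ((S.mem_kerFiltration M).1 hker.1).2 _ (hcon f hf hfx)
  have hmem : x ∈ S.component M (n - 1) i j :=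
    (S.mem_component M).2 ⟨(S.mem_kerFiltration M).2
      ⟨((S.mem_kerFiltration M).1 hker.1).1, by rwa [Nat.sub_add_cancel hn]⟩, hker.2⟩
  exact h0 ((Submodule.mem_bot k).1 (S.component_inf_Q M hn i j ▸ ⟨hmem, hx⟩))

theorem Q_ne_bot_iff {n : ℕ} (hn : 1 ≤ n) (i j : Fin M.r) :
    S.Q (M.D i) (M.D j) n ≠ ⊥ ↔ S.Link M n i j := by
  constructor
  · intro h
    obtain ⟨x, hx, h0⟩ := Submodule.exists_mem_ne_zero_of_ne_bot h
    obtain ⟨f, hf, -, h⟩ := S.exists_apply_ne_zero_of_mem_Q M hn hx h0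
    exact ⟨f, hf, h⟩
  · rintro ⟨f, hf, h⟩ hbot
    obtain ⟨x, hx, hfx⟩ := S.exists_mem_Q_apply_ne_zero M hn hf h
    rw [hbot, Submodule.mem_bot] at hx
    rw [hx, map_zero] at hfx
    exact hfx rfl

theorem block_eq {n : ℕ} (hn : 1 ≤ n) (d₁ d₂ : ℕ) : S.block d₁ d₂ n =
    ⨆ (i : Fin M.r) (j : Fin M.r) (_ : M.d i = d₁) (_ : M.d j = d₂), S.Q (M.D i) (M.D j) n := by
  rw [block, if_neg (by omega)]
  apply le_antisymm
  · refine iSup_le fun D => iSup_le fun E => iSup_le fun hD => iSup_le fun hE => iSup_le fun h₁ =>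
      iSup_le fun h₂ => ?_
    obtain ⟨i, rfl⟩ := M.exists_eq_D hD
    obtain ⟨j, rfl⟩ := M.exists_eq_D hE
    exact le_iSup_of_le i (le_iSup_of_le j (le_iSup_of_le ((finrank_D_eq_sq_iff M i d₁).1 h₁)
      (le_iSup_of_le ((finrank_D_eq_sq_iff M j d₂).1 h₂) le_rfl)))
  · refine iSup_le fun i => iSup_le fun j => iSup_le fun h₁ => iSup_le fun h₂ => ?_
    exact le_iSup_of_le (M.D i) (le_iSup_of_le (M.D j) (le_iSup_of_le (M.isSimpleSubcoalgebra_D i)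
      (le_iSup_of_le (M.isSimpleSubcoalgebra_D j)
        (le_iSup_of_le ((finrank_D_eq_sq_iff M i d₁).2 h₁)
          (le_iSup_of_le ((finrank_D_eq_sq_iff M j d₂).2 h₂) le_rfl)))))

theorem Q_le_block {n : ℕ} (hn : 1 ≤ n) (i j : Fin M.r) :
    S.Q (M.D i) (M.D j) n ≤ S.block (M.d i) (M.d j) n := by
  rw [S.block_eq M hn]
  exact le_iSup_of_le i (le_iSup_of_le j (le_iSup_of_le rfl (le_iSup_of_le rfl le_rfl)))

theorem block_ne_bot_iff {n : ℕ} (hn : 1 ≤ n) (d₁ d₂ : ℕ) :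
    S.block d₁ d₂ n ≠ ⊥ ↔ ∃ i j, M.d i = d₁ ∧ M.d j = d₂ ∧ S.Link M n i j := by
  constructor
  · intro h
    by_contra! hcon
    refine h ?_
    rw [S.block_eq M hn]
    simp only [iSup_eq_bot]
    intro i j h₁ h₂
    by_contra h
    exact hcon i j h₁ h₂ ((S.Q_ne_bot_iff M hn i j).1 h)
  · rintro ⟨i, j, rfl, rfl, h⟩ hbot
    exact (S.Q_ne_bot_iff M hn i j).2 h (eq_bot_iff.2 (hbot ▸ S.Q_le_block M hn i j))

theorem coradicalPart_eq (d : ℕ) :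
    coradicalPart k C d = ⨆ (i : Fin M.r) (_ : M.d i = d), M.D i := by
  rw [coradicalPart]
  apply le_antisymm
  · refine iSup_le fun D => iSup_le fun hD => iSup_le fun h => ?_
    obtain ⟨i, rfl⟩ := M.exists_eq_D hD
    exact le_iSup_of_le i (le_iSup_of_le ((finrank_D_eq_sq_iff M i d).1 h) le_rfl)
  · refine iSup_le fun i => iSup_le fun h => ?_
    exact le_iSup_of_le (M.D i) (le_iSup_of_le (M.isSimpleSubcoalgebra_D i)
      (le_iSup_of_le ((finrank_D_eq_sq_iff M i d).2 h) le_rfl))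

/-- Nilpotency of J puts x - π x in some step of the filtration, the idempotents split it into
components, and each component is built up from the Q's. -/
theorem eq_top_of_blocks_le {U : Submodule k C} (h0 : ∀ i, M.D i ≤ U)
    (hQ : ∀ n i j, 1 ≤ n → S.Q (M.D i) (M.D j) n ≤ U) : U = ⊤ := by
  have hcomp : ∀ n i j, S.component M n i j ≤ U := by
    intro n i j
    induction n with
    | zero =>
      intro x hx
      have := ((S.mem_component M).1 hx).1
      rw [kerFiltration_zero, Submodule.mem_bot] at this
      exact this ▸ zero_mem U
    | succ n ih =>
      rw [← S.component_sup_Q M (Nat.le_add_left 1 n)]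
      exact sup_le ih (hQ _ _ _ (Nat.le_add_left 1 n))
  have hker : ∀ n, S.kerFiltration M n ≤ U := by
    intro n x hx
    have hx' : x = ∑ i, ∑ j, leftHit (S.eps M i) (rightHit (S.eps M j) x) := by
      simp_rw [← map_sum, ← rightHit_sum, ← leftHit_sum, S.sum_eps, rightHit_one, leftHit_one]
    rw [hx']
    refine sum_mem fun i _ => sum_mem fun j _ => hcomp n i j ((S.mem_component M).2 ⟨?_, ?_, ?_⟩)
    · rw [← pull_eps, ← S.pull_eps M j]
      exact S.leftHit_pull_mem_kerFiltration M _ (S.rightHit_pull_mem_kerFiltration M _ hx)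
    · rw [leftHit_leftHit, eps_mul_eps_self]
    · rw [← leftHit_rightHit, rightHit_rightHit, eps_mul_eps_self]
  refine eq_top_iff.2 fun x _ => ?_
  obtain ⟨N, hN⟩ := M.exists_pow_eq_bot
  rw [← sub_add_cancel x (S.π x)]
  refine add_mem (hker N (S.sub_π_mem_kerFiltration M (mem_coann.2 fun f hf => ?_)))
    ((M.total_eq_iSup ▸ iSup_le h0 : M.total ≤ U) (S.π_mem_total M x))
  have : f ∈ annPow M.total N := M.hitStable_total.annPow_antitone (Nat.le_succ N) hf
  have hbot : annPow M.total N = ⊥ := hN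
  rw [hbot, Submodule.mem_bot] at this
  rw [this]
  rfl

/-- An element x of Q_1 of type (g, h) satisfies ρ_L(x) = g ⊗ x and ρ_R(x) = x ⊗ h, so it is
skew-primitive. Being a multiple of g - h it lies in the coradical, where π is the identity; but π x
= 0. -/
theorem not_link_one (hS : NoNontrivialSkewPrimitives k C) {i j : Fin M.r} (hi : M.d i = 1)
    (hj : M.d j = 1) : ¬ S.Link M 1 i j := by
  intro h
  have hbot := (S.Q_ne_bot_iff M le_rfl i j).2 h
  obtain ⟨x, hx, h0⟩ := Submodule.exists_mem_ne_zero_of_ne_bot hbot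
  have hx' := (S.mem_component M).1 (S.Q_le_component M le_rfl i j hx)
  have hP : x ∈ P (S.π : C →ₗ[k] C) 1 := S.P_eq M 1 ▸ hx'.1
  have hpull : ∀ {l : Fin M.r} {p q : ConvDual k C}, p - q ∈ ann M.total → pull S.π p = pull S.π q :=
    fun {l p q} hpq => S.pull_congr M fun i a b => by
      have := mem_ann.1 hpq _ (M.e_mem_total i a b)
      rwa [WithConv.ofConv_sub, LinearMap.sub_apply, sub_eq_zero] at this
  have hL : rhoL (S.π : C →ₗ[k] C) x = M.corner i ⊗ₜ[k] x := eq_of_forall_pair fun f g => by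
    have h1 : pull S.π (S.eps M i * f) = f (M.corner i) • S.eps M i :=
      (hpull (l := i) (S.eps_mul_sub_mem M hi f)).trans
        ((congrArg (f (M.corner i) • ·) (S.pull_eps M i)))
    rw [pair_rhoL, pair_tmul]
    conv_lhs => rw [← hx'.2.1, apply_leftHit, ← mul_assoc, ← pull_eps, ← pull_mul, h1,
      smul_mul_assoc]
    change f (M.corner i) • (S.eps M i * g) x = _
    rw [← apply_leftHit, hx'.2.1, smul_eq_mul]
  have hR : rhoR (S.π : C →ₗ[k] C) x = x ⊗ₜ[k] M.corner j := eq_of_forall_pair fun f g => by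
    have h1 : pull S.π (g * S.eps M j) = g (M.corner j) • S.eps M j :=
      (hpull (l := j) (S.mul_eps_sub_mem M hj g)).trans
        ((congrArg (g (M.corner j) • ·) (S.pull_eps M j)))
    rw [pair_rhoR, pair_tmul]
    conv_lhs => rw [← hx'.2.2, apply_rightHit, mul_assoc, ← S.pull_eps M j, ← pull_mul, h1,
      mul_smul_comm]
    change g (M.corner j) • (f * S.eps M j) x = _
    rw [← apply_rightHit, hx'.2.2, smul_eq_mul, mul_comm]
  -- For n = 1 the supremum runs over `Fin 0`, so membership in P_1 says Δ(x) = ρ_L(x) + ρ_R(x).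
  rw [P, Submodule.mem_comap, iSup_of_empty, Submodule.mem_bot, LinearMap.sub_apply,
    LinearMap.sub_apply, hL, hR, sub_sub, sub_eq_zero] at hP
  have hspan := hS _ _ x (MatrixCoeffs.isGroupLikeElem_corner hi)
    (MatrixCoeffs.isGroupLikeElem_corner hj) hP
  have htot : x ∈ M.total := (Submodule.span_singleton_le_iff_mem _ _).2
    (sub_mem (M.corner_mem_total i) (M.corner_mem_total j)) hspan
  exact h0 ((S.π_eq_self M htot).symm.trans ((S.mem_kerFiltration M).1 hx'.1).1)

end BlockSystem

end Links

/-! ### The antipode as a convolution inverse -/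

section Antipode

open HopfAlgebra

variable {k H : Type*} [Field k] [Ring H] [HopfAlgebra k H]

variable (k H) in
/-- `h ↦ h ⊗ 1` in the convolution algebra. -/
def inclLeft : WithConv (H →ₗ[k] H ⊗[k] H) :=
  WithConv.toConv (Algebra.TensorProduct.includeLeft : H →ₐ[k] H ⊗[k] H).toLinearMap

variable (k H) in
/-- `h ↦ 1 ⊗ h` in the convolution algebra. -/
def inclRight : WithConv (H →ₗ[k] H ⊗[k] H) :=
  WithConv.toConv (Algebra.TensorProduct.includeRight : H →ₐ[k] H ⊗[k] H).toLinearMap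

/-- Composition with the antipode. -/
def compAntipode {V : Type*} [AddCommGroup V] [Module k V] (φ : WithConv (H →ₗ[k] V)) :
    WithConv (H →ₗ[k] V) :=
  WithConv.toConv (φ.ofConv ∘ₗ antipode k)

theorem compAntipode_algHom_mul {B : Type*} [Ring B] [Algebra k B] (φ : H →ₐ[k] B) :
    compAntipode (WithConv.toConv φ.toLinearMap) * WithConv.toConv φ.toLinearMap = 1 := by
  have := LinearMap.algHom_comp_convMul_distrib φ (WithConv.toConv (antipode k (A := H)))
    (WithConv.toConv LinearMap.id)
  rw [LinearMap.antipode_mul_id] at this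
  apply WithConv.ofConv_injective
  refine Eq.trans ?_ (this.symm.trans ?_)
  · rfl
  · ext x
    simp [LinearMap.convOne_def]

theorem algHom_mul_compAntipode {B : Type*} [Ring B] [Algebra k B] (φ : H →ₐ[k] B) :
    WithConv.toConv φ.toLinearMap * compAntipode (WithConv.toConv φ.toLinearMap) = 1 := by
  have := LinearMap.algHom_comp_convMul_distrib φ (WithConv.toConv LinearMap.id)
    (WithConv.toConv (antipode k (A := H)))
  rw [LinearMap.id_mul_antipode] at this
  apply WithConv.ofConv_injective
  refine Eq.trans ?_ (this.symm.trans ?_)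
  · rfl
  · ext x
    simp [LinearMap.convOne_def]

theorem inclLeft_mul_inclRight :
    inclLeft k H * inclRight k H = WithConv.toConv Coalgebra.comul := by
  have : LinearMap.mul' k (H ⊗[k] H) ∘ₗ
      TensorProduct.map (inclLeft k H).ofConv (inclRight k H).ofConv = LinearMap.id := by
    ext a b
    simp [inclLeft, inclRight]
  exact WithConv.ext (LinearMap.ext fun x => congr($this (Coalgebra.comul x)))

theorem compAntipode_inclRight_mul_inclLeft :
    compAntipode (inclRight k H) * compAntipode (inclLeft k H) =
      WithConv.toConv (TensorProduct.map (antipode k) (antipode k) ∘ₗ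
        (TensorProduct.comm k H H).toLinearMap ∘ₗ Coalgebra.comul) := by
  have : LinearMap.mul' k (H ⊗[k] H) ∘ₗ
      TensorProduct.map (compAntipode (inclRight k H)).ofConv (compAntipode (inclLeft k H)).ofConv =
      TensorProduct.map (antipode k) (antipode k) ∘ₗ (TensorProduct.comm k H H).toLinearMap := by
    ext a b
    simp [inclLeft, inclRight, compAntipode]
  exact WithConv.ext (LinearMap.ext fun x => congr($this (Coalgebra.comul x)))

theorem compAntipode_inclLeft_mul_inclRight :
    compAntipode (inclLeft k H) * compAntipode (inclRight k H) =
      WithConv.toConv (TensorProduct.map (antipode k) (antipode k) ∘ₗ Coalgebra.comul) := by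
  have : LinearMap.mul' k (H ⊗[k] H) ∘ₗ
      TensorProduct.map (compAntipode (inclLeft k H)).ofConv (compAntipode (inclRight k H)).ofConv =
      TensorProduct.map (antipode k) (antipode k) := by
    ext a b
    simp [inclLeft, inclRight, compAntipode]
  exact WithConv.ext (LinearMap.ext fun x => congr($this (Coalgebra.comul x)))

/-- Both sides invert Δ in the convolution algebra Hom(H, H ⊗ H), where Δ = `inclLeft * inclRight`.
-/
theorem compAntipode_comul : compAntipode (WithConv.toConv (Coalgebra.comul (R := k) (A := H))) =
    compAntipode (inclRight k H) * compAntipode (inclLeft k H) := by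
  refine (left_inv_eq_right_inv (a := WithConv.toConv (Coalgebra.comul (R := k) (A := H)))
    ?_ LinearMap.comul_right_inv).symm
  rw [← inclLeft_mul_inclRight, mul_assoc, ← mul_assoc (compAntipode (inclLeft k H)), inclLeft,
    compAntipode_algHom_mul, one_mul, inclRight, compAntipode_algHom_mul]

/-- The antipode reverses the comultiplication. -/
theorem comul_antipode (x : H) : Coalgebra.comul (R := k) (antipode k x) =
    TensorProduct.map (antipode k) (antipode k)
      (TensorProduct.comm k H H (Coalgebra.comul (R := k) x)) := by
  have := compAntipode_comul (k := k) (H := H)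
  rw [compAntipode_inclRight_mul_inclLeft] at this
  exact congrArg (fun φ : WithConv (H →ₗ[k] H ⊗[k] H) => φ x) this

theorem compAntipode_mul (f g : ConvDual k H) :
    compAntipode (f * g) = compAntipode g * compAntipode f := by
  refine WithConv.ext (LinearMap.ext fun x => ?_)
  change pair f g (Coalgebra.comul (antipode k x)) =
    pair (compAntipode g) (compAntipode f) (Coalgebra.comul x)
  rw [comul_antipode]
  have : pair f g ∘ₗ TensorProduct.map (antipode k) (antipode k) ∘ₗ
      (TensorProduct.comm k H H).toLinearMap = pair (compAntipode g) (compAntipode f) := by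
    ext a b
    simp [compAntipode, mul_comm]
  exact congr($this (Coalgebra.comul x))

theorem sum_comul_antipode_mul {ι : Type*} {h : H} (R : Coalgebra.Repr k h ι) :
    ∑ i ∈ R.index, Coalgebra.comul (R := k) (antipode k (R.left i)) * (R.right i ⊗ₜ[k] (1 : H)) =
      1 ⊗ₜ[k] antipode k h := by
  have h1 : compAntipode (WithConv.toConv (Coalgebra.comul (R := k) (A := H))) * inclLeft k H =
      compAntipode (inclRight k H) := by
    rw [compAntipode_comul, mul_assoc, inclLeft, compAntipode_algHom_mul, mul_one]
  have h2 := congrArg (fun φ : WithConv (H →ₗ[k] H ⊗[k] H) => φ h) h1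
  exact (R.convMul_apply _ _).symm.trans h2

theorem inclLeft_mul_map_antipode_comul (y : H) :
    (inclLeft k H * WithConv.toConv (TensorProduct.map (antipode k) (antipode k) ∘ₗ
      Coalgebra.comul) : WithConv (H →ₗ[k] H ⊗[k] H)) y = (1 : H) ⊗ₜ[k] antipode k y := by
  rw [← compAntipode_inclLeft_mul_inclRight, ← mul_assoc, inclLeft, algHom_mul_compAntipode,
    one_mul]
  rfl

end Antipode

/-! ### Integrals, Hopf modules and the Frobenius isomorphism -/

section Integral

open HopfAlgebra

variable {k H : Type*} [Field k] [Ring H] [HopfAlgebra k H]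

/-- The functional `y ↦ f (y h)`. -/
def translate (h : H) (f : ConvDual k H) : ConvDual k H :=
  WithConv.toConv (f.ofConv ∘ₗ LinearMap.mulRight k h)

@[simp] theorem translate_apply (h : H) (f : ConvDual k H) (x : H) :
    translate h f x = f (x * h) := rfl

/-- The functional `x ↦ p (x S(h))`, linearly in `h`. -/
def hopfAct (p : ConvDual k H) : H →ₗ[k] ConvDual k H where
  toFun h := translate (antipode k h) p
  map_add' x y := WithConv.ext (LinearMap.ext fun z => by simp [mul_add])
  map_smul' c x := WithConv.ext (LinearMap.ext fun z => by simp)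

theorem hopfAct_apply (p : ConvDual k H) (h x : H) : hopfAct p h x = p (x * antipode k h) := rfl

theorem hopfAct_hopfAct (p : ConvDual k H) (h h' : H) :
    hopfAct (hopfAct p h) h' = hopfAct p (h * h') :=
  WithConv.ext (LinearMap.ext fun x => by
    change p (x * antipode k h' * antipode k h) = p (x * antipode k (h * h'))
    rw [antipode_mul_antidistrib, mul_assoc])

theorem hopfAct_one (p : ConvDual k H) : hopfAct p 1 = p :=
  WithConv.ext (LinearMap.ext fun x => by
    rw [hopfAct_apply, antipode_one, mul_one])

theorem hopfAct_smul (c : k) (p : ConvDual k H) (h : H) :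
    hopfAct (c • p) h = c • hopfAct p h := rfl

theorem hopfAct_sum {ι : Type*} (s : Finset ι) (p : ι → ConvDual k H) (h : H) :
    hopfAct (∑ i ∈ s, p i) h = ∑ i ∈ s, hopfAct (p i) h :=
  WithConv.ext (LinearMap.ext fun x => by simp [hopfAct_apply])

theorem pair_mul_tmul (f g : ConvDual k H) (z : H ⊗[k] H) (a b : H) :
    pair f g (z * a ⊗ₜ[k] b) = pair (translate a f) (translate b g) z := by
  induction z with
  | zero => simp
  | add x y hx hy => rw [add_mul, map_add, map_add, hx, hy]
  | tmul x y => simp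

theorem translate_one (f : ConvDual k H) : translate 1 f = f :=
  WithConv.ext (LinearMap.ext fun x => by simp)

/-- The Hopf module compatibility of H^*. Replace 1 ⊗ S(h) by ∑ Δ(S(h₁))(h₂ ⊗ 1) and use that Δ is
multiplicative. -/
theorem mul_hopfAct {ι : Type*} (f p : ConvDual k H) {h : H} (R : Coalgebra.Repr k h ι) :
    f * hopfAct p h = ∑ i ∈ R.index, hopfAct (translate (R.right i) f * p) (R.left i) := by
  refine WithConv.ext (LinearMap.ext fun x => ?_)
  have h1 : (f * hopfAct p h) x = pair f p (Coalgebra.comul (R := k) x * 1 ⊗ₜ antipode k h) := by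
    rw [pair_mul_tmul, translate_one]
    rfl
  refine h1.trans ?_
  rw [← sum_comul_antipode_mul R, Finset.mul_sum, map_sum, WithConv.ofConv_sum,
    LinearMap.sum_apply]
  refine Finset.sum_congr rfl fun i _ => ?_
  rw [← mul_assoc, ← Bialgebra.comul_mul, pair_mul_tmul, translate_one, hopfAct_apply]
  rfl

/-- A left integral, as an element of the convolution algebra. -/
def IsInt (lam : ConvDual k H) : Prop := ∀ f : ConvDual k H, f * lam = f 1 • lam

theorem IsInt.isLeftIntegral {lam : ConvDual k H} (h : IsInt lam) : IsLeftIntegral lam.ofConv :=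
  fun f x => congrArg (fun g : ConvDual k H => g x) (h (WithConv.toConv f))

/-- For an integral, f(· h₂) * λ = f(h₂) λ, so the general formula collapses to left A-linearity of
h ↦ λ(· S(h)). -/
theorem IsInt.mul_hopfAct {lam : ConvDual k H} (hlam : IsInt lam) (f : ConvDual k H) (h : H) :
    f * hopfAct lam h = hopfAct lam (rightHit f h) := by
  have R := Coalgebra.Repr.arbitrary k h
  rw [HopfBlock.mul_hopfAct f lam R]
  have hR : rightHit f h = ∑ i ∈ R.index, f (R.right i) • R.left i := by
    rw [rightHit, LinearMap.comp_apply, LinearMap.comp_apply, ← R.eq]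
    simp
  rw [hR, map_sum]
  refine Finset.sum_congr rfl fun i _ => ?_
  rw [hlam, hopfAct_smul, map_smul, translate_apply, one_mul]

theorem mul_hopfAct_antipode {ι : Type*} (f p : ConvDual k H) {h : H} (R : Coalgebra.Repr k h ι) :
    f * hopfAct p (antipode k h) = ∑ i ∈ R.index,
      hopfAct (translate (antipode k (R.left i)) f * p) (antipode k (R.right i)) := by
  let R' : Coalgebra.Repr k (antipode k h) ι :=
    { index := R.index
      left := fun i => antipode k (R.right i)
      right := fun i => antipode k (R.left i)
      eq := by
        rw [comul_antipode, ← R.eq]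
        simp }
  exact mul_hopfAct f p R'

variable [FiniteDimensional k H]

variable (k H) in
/-- The dual basis of a basis of `H`. -/
def dualVec (i : Fin (Module.finrank k H)) : ConvDual k H :=
  WithConv.toConv ((Module.finBasis k H).coord i)

theorem sum_dualVec_smul (x : H) : ∑ i, dualVec k H i x • Module.finBasis k H i = x :=
  (Module.finBasis k H).sum_repr x

theorem sum_smul_dualVec (f : ConvDual k H) : ∑ i, f (Module.finBasis k H i) • dualVec k H i = f := by
  refine WithConv.ext (LinearMap.ext fun x => ?_)
  conv_rhs => rw [← sum_dualVec_smul (k := k) x]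
  rw [map_sum, WithConv.ofConv_sum, LinearMap.sum_apply]
  refine Finset.sum_congr rfl fun i _ => ?_
  rw [map_smul, smul_eq_mul, mul_comm]
  rfl

/-- The projection of the Hopf module `H^*` to its coinvariants. -/
def integralOf (p : ConvDual k H) : ConvDual k H :=
  ∑ i, hopfAct (dualVec k H i * p) (antipode k (Module.finBasis k H i))

/-- In Sweedler notation f(y₁ S(y₂)) S(y₃) = f(1) S(y), spelled out in a dual basis for use in
`isInt_integralOf`. -/
theorem sum_translate_antipode (f : ConvDual k H) {ι : Fin (Module.finrank k H) → Type*}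
    (R : ∀ i, Coalgebra.Repr k (Module.finBasis k H i) (ι i)) (y : H) :
    ∑ i, ∑ j ∈ (R i).index, (translate (antipode k ((R i).left j)) f * dualVec k H i) y •
      antipode k ((R i).right j) = f 1 • antipode k y := by
  let W : H ⊗[k] H →ₗ[k] H :=
    TensorProduct.lid k H ∘ₗ TensorProduct.map f.ofConv LinearMap.id
  have hW := congrArg W (inclLeft_mul_map_antipode_comul (k := k) y)
  have h1 : W (1 ⊗ₜ[k] antipode k y) = f 1 • antipode k y := by simp [W]
  rw [h1] at hW
  rw [← hW]
  let V := W ∘ₗ LinearMap.mul' k (H ⊗[k] H) ∘ₗ TensorProduct.map (inclLeft k H).ofConv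
    (TensorProduct.map (antipode k) (antipode k) ∘ₗ Coalgebra.comul)
  change _ = V (Coalgebra.comul y)
  let V' : H ⊗[k] H →ₗ[k] H := ∑ i, ∑ j ∈ (R i).index,
    (pair (translate (antipode k ((R i).left j)) f) (dualVec k H i)).smulRight
      (antipode k ((R i).right j))
  have hVV : V' = V := by
    refine TensorProduct.ext' fun a b => ?_
    have hb : V (a ⊗ₜ b) = ∑ i, dualVec k H i b • V (a ⊗ₜ Module.finBasis k H i) := by
      conv_lhs => rw [← sum_dualVec_smul (k := k) b, TensorProduct.tmul_sum, map_sum]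
      simp_rw [TensorProduct.tmul_smul, map_smul]
    rw [hb]
    simp only [V', LinearMap.sum_apply, LinearMap.smulRight_apply, pair_tmul]
    refine Finset.sum_congr rfl fun i _ => ?_
    have hi : V (a ⊗ₜ Module.finBasis k H i) = ∑ j ∈ (R i).index,
        f (a * antipode k ((R i).left j)) • antipode k ((R i).right j) := by
      simp [V, W, ← (R i).eq, inclLeft, Finset.mul_sum]
    rw [hi, Finset.smul_sum]
    refine Finset.sum_congr rfl fun j _ => ?_
    rw [translate_apply, smul_smul, mul_comm]
  rw [← hVV]
  simp only [V', LinearMap.sum_apply, LinearMap.smulRight_apply]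
  rfl

theorem isInt_integralOf (p : ConvDual k H) : IsInt (integralOf p) := by
  intro f
  have R : ∀ i, Coalgebra.Repr k (Module.finBasis k H i) _ :=
    fun i => Coalgebra.Repr.arbitrary k (Module.finBasis k H i)
  have hexp : ∀ (g : ConvDual k H) (h : H), hopfAct (g * p) h =
      ∑ l, hopfAct (dualVec k H l * p) (g (Module.finBasis k H l) • h) := fun g h => by
    conv_lhs => rw [← sum_smul_dualVec g, Finset.sum_mul, hopfAct_sum]
    simp_rw [smul_mul_assoc, hopfAct_smul, map_smul]
  rw [integralOf, Finset.mul_sum, Finset.smul_sum]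
  have key : ∀ i, f * hopfAct (dualVec k H i * p) (antipode k (Module.finBasis k H i)) =
      ∑ l, ∑ j ∈ (R i).index, hopfAct (dualVec k H l * p)
        ((translate (antipode k ((R i).left j)) f * dualVec k H i) (Module.finBasis k H l) •
          antipode k ((R i).right j)) := fun i => by
    rw [mul_hopfAct_antipode f _ (R i), Finset.sum_comm]
    refine Finset.sum_congr rfl fun j _ => ?_
    rw [← mul_assoc, hexp]
  rw [Finset.sum_congr rfl fun i _ => key i, Finset.sum_comm]
  refine Finset.sum_congr rfl fun l _ => ?_
  simp_rw [← map_sum]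
  rw [sum_translate_antipode f R, map_smul]

/-- The reconstruction half of the fundamental theorem of Hopf modules: p is recovered from
coinvariants because S(h₁)h₂ = ε(h). Applied to p = 1 it shows that some integral is nonzero. -/
theorem sum_hopfAct_integralOf (p : ConvDual k H) :
    ∑ j, hopfAct (integralOf (dualVec k H j * p)) (Module.finBasis k H j) = p := by
  have hexp : ∀ (g : ConvDual k H) (h : H), hopfAct (g * p) h =
      ∑ l, hopfAct (dualVec k H l * p) (g (Module.finBasis k H l) • h) := fun g h => by
    conv_lhs => rw [← sum_smul_dualVec g, Finset.sum_mul, hopfAct_sum]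
    simp_rw [smul_mul_assoc, hopfAct_smul, map_smul]
  have hSid : ∀ y : H, ∑ j, ∑ i, (dualVec k H i * dualVec k H j : ConvDual k H) y •
      (antipode k (Module.finBasis k H i) * Module.finBasis k H j) =
        Coalgebra.counit (R := k) y • (1 : H) := fun y => by
    let V : H ⊗[k] H →ₗ[k] H := ∑ j, ∑ i, (pair (dualVec k H i) (dualVec k H j)).smulRight
      (antipode k (Module.finBasis k H i) * Module.finBasis k H j)
    have hV : V = LinearMap.mul' k H ∘ₗ TensorProduct.map (antipode k) LinearMap.id := by
      refine TensorProduct.ext' fun a b => ?_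
      simp only [V, LinearMap.sum_apply, LinearMap.smulRight_apply, pair_tmul,
        LinearMap.comp_apply, TensorProduct.map_tmul, LinearMap.mul'_apply, LinearMap.id_apply]
      conv_rhs => rw [← sum_dualVec_smul (k := k) a, ← sum_dualVec_smul (k := k) b, map_sum,
        Finset.mul_sum]
      refine Finset.sum_congr rfl fun j _ => ?_
      rw [Finset.sum_mul]
      refine Finset.sum_congr rfl fun i _ => ?_
      rw [map_smul, smul_mul_smul_comm]
    have h1 : V (Coalgebra.comul y) = Coalgebra.counit (R := k) y • (1 : H) := by
      rw [hV, LinearMap.comp_apply]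
      exact (mul_antipode_rTensor_comul_apply (R := k) y).trans (Algebra.algebraMap_eq_smul_one _)
    rw [← h1]
    simp only [V, LinearMap.sum_apply, LinearMap.smulRight_apply]
    rfl
  have key : ∀ j, hopfAct (integralOf (dualVec k H j * p)) (Module.finBasis k H j) =
      ∑ l, ∑ i, hopfAct (dualVec k H l * p)
        ((dualVec k H i * dualVec k H j : ConvDual k H) (Module.finBasis k H l) •
          (antipode k (Module.finBasis k H i) * Module.finBasis k H j)) := fun j => by
    rw [integralOf, hopfAct_sum, Finset.sum_comm]
    refine Finset.sum_congr rfl fun i _ => ?_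
    rw [hopfAct_hopfAct, ← mul_assoc, hexp]
  rw [Finset.sum_congr rfl fun j _ => key j, Finset.sum_comm]
  simp_rw [← map_sum, hSid, map_smul, hopfAct_one, ← smul_mul_assoc, ← Finset.sum_mul]
  have h1 : ∑ i, Coalgebra.counit (R := k) (Module.finBasis k H i) • dualVec k H i = 1 :=
    sum_smul_dualVec (1 : ConvDual k H)
  rw [h1, one_mul]

theorem exists_isInt : ∃ lam : ConvDual k H, IsInt lam ∧ lam ≠ 0 := by
  by_contra! h
  have h1 := sum_hopfAct_integralOf (1 : ConvDual k H)
  rw [Finset.sum_congr rfl fun j _ => by rw [h _ (isInt_integralOf _)]] at h1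
  have h2 : (0 : ConvDual k H) 1 = (1 : ConvDual k H) 1 := by
    rw [← h1]
    simp [hopfAct_apply]
  rw [one_apply, Bialgebra.counit_one] at h2
  exact zero_ne_one h2

variable {lam : ConvDual k H}

/-- The kernel is stable under `rightHit` by linearity over A. For h in it, h₁S(h₂) = ε(h) then
gives ε(h)λ = 0, so ε vanishes on the kernel; by stability every functional does. -/
theorem IsInt.hopfAct_injective (hlam : IsInt lam) (h0 : lam ≠ 0) :
    Function.Injective (hopfAct lam) := by
  rw [injective_iff_map_eq_zero]
  have hR : ∀ h, hopfAct lam h = 0 → ∀ f : ConvDual k H, hopfAct lam (rightHit f h) = 0 :=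
    fun h hh f => by rw [← hlam.mul_hopfAct, hh, mul_zero]
  have hε : ∀ h, hopfAct lam h = 0 → Coalgebra.counit (R := k) h = 0 := by
    intro h hh
    have h1 : ∑ i, rightHit (dualVec k H i) h * antipode k (Module.finBasis k H i) =
        Coalgebra.counit (R := k) h • (1 : H) := by
      rw [← Algebra.algebraMap_eq_smul_one, ← mul_antipode_lTensor_comul_apply]
      let V : H ⊗[k] H →ₗ[k] H := ∑ i, LinearMap.mulRight k (antipode k (Module.finBasis k H i)) ∘ₗ
        (TensorProduct.rid k H).toLinearMap ∘ₗ TensorProduct.map LinearMap.id (dualVec k H i).ofConv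
      have hV : V = LinearMap.mul' k H ∘ₗ (antipode k).lTensor H := by
        refine TensorProduct.ext' fun a b => ?_
        simp only [LinearMap.comp_apply, LinearMap.lTensor_tmul, LinearMap.mul'_apply]
        conv_rhs => rw [← sum_dualVec_smul (k := k) b, map_sum, Finset.mul_sum]
        simp [V]
      rw [← LinearMap.comp_apply, ← hV]
      simp only [V, LinearMap.sum_apply]
      rfl
    have h2 : hopfAct lam (Coalgebra.counit (R := k) h • (1 : H)) = 0 := by
      rw [← h1, map_sum]
      refine Finset.sum_eq_zero fun i _ => ?_
      rw [← hopfAct_hopfAct, hR h hh]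
      rfl
    rw [map_smul, hopfAct_one] at h2
    exact (smul_eq_zero.1 h2).resolve_right h0
  intro h hh
  refine eq_zero_of_forall_apply (k := k) fun f => ?_
  rw [← one_mul f, ← apply_rightHit, one_apply]
  exact hε _ (hR h hh f)

theorem antipode_injective : Function.Injective (antipode k (A := H)) := by
  obtain ⟨lam, hlam, h0⟩ := exists_isInt (k := k) (H := H)
  intro x y hxy
  refine hlam.hopfAct_injective h0 (WithConv.ext (LinearMap.ext fun z => ?_))
  rw [hopfAct_apply, hopfAct_apply, hxy]

/-- The isomorphism `H ≃ H^*` given by a nonzero integral. -/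
def IsInt.equiv (hlam : IsInt lam) (h0 : lam ≠ 0) : H ≃ₗ[k] ConvDual k H :=
  LinearEquiv.ofInjectiveOfFinrankEq (hopfAct lam) (hlam.hopfAct_injective h0)
    ((Subspace.dual_finrank_eq (K := k) (V := H)).symm.trans
      (WithConv.linearEquiv k (H →ₗ[k] k)).symm.finrank_eq)

theorem IsInt.equiv_apply (hlam : IsInt lam) (h0 : lam ≠ 0) (h : H) :
    hlam.equiv h0 h = hopfAct lam h := rfl

theorem IsInt.mul_equiv (hlam : IsInt lam) (h0 : lam ≠ 0) (f : ConvDual k H) (h : H) :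
    f * hlam.equiv h0 h = hlam.equiv h0 (rightHit f h) :=
  hlam.mul_hopfAct f h

/-- The preimage h of `mu` satisfies Δ(h) = h ⊗ 1, so h = ε(h) 1. -/
theorem IsInt.exists_eq_smul (hlam : IsInt lam) (h0 : lam ≠ 0) {mu : ConvDual k H}
    (hmu : IsInt mu) : ∃ c : k, mu = c • lam := by
  obtain ⟨h, rfl⟩ := (hlam.equiv h0).surjective mu
  refine ⟨Coalgebra.counit (R := k) h, ?_⟩
  have h1 : h = Coalgebra.counit (R := k) h • (1 : H) := by
    refine eq_of_forall_apply_eq (k := k) fun f => ?_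
    have h2 := hmu f
    rw [hlam.mul_equiv, ← map_smul, (hlam.equiv h0).injective.eq_iff] at h2
    conv_lhs => rw [← one_mul f, ← apply_rightHit, h2]
    simp [mul_comm]
  conv_lhs => rw [h1]
  rw [map_smul, hlam.equiv_apply, hopfAct_one]

/-- The distinguished group-like element. -/
theorem IsInt.exists_isGroupLikeElem (hlam : IsInt lam) (h0 : lam ≠ 0) :
    ∃ a : H, IsGroupLikeElem k a ∧ ∀ f, lam * f = f a • lam := by
  -- λ * f is again a left integral, hence a multiple of λ. The scalars form a character of A, and
  -- such a character is evaluation at a group-like element.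
  have h1 : ∀ f, ∃ c : k, lam * f = c • lam := fun f =>
    hlam.exists_eq_smul h0 fun g => by rw [← mul_assoc, hlam, smul_mul_assoc]
  choose χ hχ using h1
  have hinj : ∀ {c d : k}, c • lam = d • lam → c = d := fun h => smul_left_injective k h0 h
  obtain ⟨a, ha⟩ := exists_eval_eq (k := k) (C := H)
    { toFun := χ
      map_add' := fun f g => hinj (by rw [← hχ, mul_add, hχ, hχ, add_smul])
      map_smul' := fun c f => hinj (by
        rw [← hχ, mul_smul_comm, hχ, smul_smul, RingHom.id_apply, smul_eq_mul]) }
  have ha' : ∀ f : ConvDual k H, f a = χ f := ha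
  have hmul : ∀ f g : ConvDual k H, (f * g) a = f a * g a := fun f g => by
    rw [ha', ha', ha']
    refine hinj ?_
    rw [← hχ, ← mul_assoc, hχ, smul_mul_assoc, hχ, smul_smul]
  refine ⟨a, ⟨?_, eq_of_forall_pair fun f g => ?_⟩, fun f => by rw [ha', hχ]⟩
  · rw [← one_apply, ha']
    refine hinj ?_
    rw [← hχ, mul_one, one_smul]
  · rw [pair_tmul, ← hmul]
    rfl

end Integral

/-! ### Invariance of the powers of the radical -/

section Invariance

variable {k C : Type*} [Field k] [AddCommGroup C] [Module k C] [Coalgebra k C]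

/-- This describes J by multiplication alone, so every linear bijection preserving or reversing
products preserves it. On matrix coefficients `u i b a * f` is concentrated in row b with diagonal
entry f(e_ab), so its nilpotency forces that entry to vanish. -/
theorem MatrixCoeffs.mem_ann_total_iff_isNilpotent (M : MatrixCoeffs k C) {f : ConvDual k C} :
    f ∈ ann M.total ↔ ∀ g, IsNilpotent (g * f) := by
  constructor
  · intro hf g
    obtain ⟨N, hN⟩ := M.exists_pow_eq_bot
    have h1 := mem_annPow_of_pow (M.hitStable_total.mul_mem_ann_left g hf) N
    have hbot : annPow M.total N = ⊥ := hN
    rw [hbot, Submodule.mem_bot] at h1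
    exact ⟨N, h1⟩
  · intro h
    obtain ⟨u, hu⟩ := M.exists_isDual
    rw [BlockSystem.mem_ann_total_iff]
    intro i a b
    have hN : ∀ p q, (u i b a * f) (M.e i p q) = if b = p then f (M.e i a q) else 0 := by
      intro p q
      rw [← apply_leftHit, hu.leftHit_self]
      split_ifs
      · rfl
      · exact map_zero _
    have hpow : ∀ n : ℕ, ((u i b a * f) ^ n) (M.e i b b) = f (M.e i a b) ^ n := by
      intro n
      induction n with
      | zero => rw [pow_zero, pow_zero, one_apply, M.counit_eq, if_pos rfl]
      | succ n ih =>
        rw [pow_succ, pow_succ, M.mul_apply_e]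
        simp [hN, ih]
    obtain ⟨n, hn⟩ := h (u i b a)
    have h2 := hpow n
    rw [hn] at h2
    exact IsNilpotent.eq_zero ⟨n, h2.symm⟩

theorem map_isNilpotent_of_mul {T : ConvDual k C ≃ₗ[k] ConvDual k C}
    (hT : (∀ f g, T (f * g) = T f * T g) ∨ ∀ f g, T (f * g) = T g * T f) {f : ConvDual k C}
    (hf : IsNilpotent f) : IsNilpotent (T f) := by
  obtain ⟨n, hn⟩ := hf
  have hpow : ∀ n : ℕ, T (f ^ (n + 1)) = T f ^ (n + 1) := by
    intro n
    induction n with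
    | zero => rw [zero_add, pow_one, pow_one]
    | succ n ih =>
      rcases hT with hT | hT
      · rw [pow_succ, hT, ih, ← pow_succ]
      · rw [pow_succ, hT, ih, ← pow_succ']
  exact ⟨n + 1, by rw [← hpow, pow_succ, hn, zero_mul, map_zero]⟩

theorem isNilpotent_mul_swap {R : Type*} [Ring R] {x y : R} (h : IsNilpotent (x * y)) :
    IsNilpotent (y * x) := by
  obtain ⟨n, hn⟩ := h
  have hpow : ∀ n : ℕ, (y * x) ^ (n + 1) = y * (x * y) ^ n * x := by
    intro n
    induction n with
    | zero => simp
    | succ n ih => rw [pow_succ, ih, pow_succ]; simp only [mul_assoc]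
  exact ⟨n + 1, by rw [hpow, hn, mul_zero, zero_mul]⟩

theorem MatrixCoeffs.map_mem_ann_total (M : MatrixCoeffs k C) {T : ConvDual k C ≃ₗ[k] ConvDual k C}
    (hT : (∀ f g, T (f * g) = T f * T g) ∨ ∀ f g, T (f * g) = T g * T f) {f : ConvDual k C}
    (hf : f ∈ ann M.total) : T f ∈ ann M.total := by
  rw [mem_ann_total_iff_isNilpotent] at hf ⊢
  intro g
  obtain ⟨g, rfl⟩ := T.surjective g
  have h1 := map_isNilpotent_of_mul hT (hf g)
  rcases hT with hT | hT
  · rwa [hT] at h1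
  · rw [hT] at h1
    exact isNilpotent_mul_swap h1

theorem MatrixCoeffs.map_mem_annPow (M : MatrixCoeffs k C) {T : ConvDual k C ≃ₗ[k] ConvDual k C}
    (hT : (∀ f g, T (f * g) = T f * T g) ∨ ∀ f g, T (f * g) = T g * T f) {n : ℕ}
    {f : ConvDual k C} (hf : f ∈ annPow M.total n) : T f ∈ annPow M.total n := by
  induction n generalizing f with
  | zero => trivial
  | succ n ih =>
    refine Submodule.mul_induction_on hf (fun p hp q hq => ?_) fun p q hp hq => ?_
    · rcases hT with hT | hT
      · rw [hT]
        exact Submodule.mul_mem_mul (ih hp) (M.map_mem_ann_total (Or.inl hT) hq)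
      · rw [hT, M.hitStable_total.annPow_succ']
        exact Submodule.mul_mem_mul (M.map_mem_ann_total (Or.inr hT) hq) (ih hp)
    · rw [map_add]
      exact add_mem hp hq

theorem symm_mul_or {T : ConvDual k C ≃ₗ[k] ConvDual k C}
    (hT : (∀ f g, T (f * g) = T f * T g) ∨ ∀ f g, T (f * g) = T g * T f) :
    (∀ f g, T.symm (f * g) = T.symm f * T.symm g) ∨
      ∀ f g, T.symm (f * g) = T.symm g * T.symm f := by
  refine hT.imp (fun hT f g => ?_) fun hT f g => ?_ <;>
  rw [LinearEquiv.symm_apply_eq, hT, T.apply_symm_apply, T.apply_symm_apply]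

theorem MatrixCoeffs.map_mem_annPow_iff (M : MatrixCoeffs k C)
    {T : ConvDual k C ≃ₗ[k] ConvDual k C}
    (hT : (∀ f g, T (f * g) = T f * T g) ∨ ∀ f g, T (f * g) = T g * T f) {n : ℕ}
    {f : ConvDual k C} : T f ∈ annPow M.total n ↔ f ∈ annPow M.total n := by
  refine ⟨fun h => ?_, M.map_mem_annPow hT⟩
  rw [← T.symm_apply_apply f]
  exact M.map_mem_annPow (symm_mul_or hT) h

end Invariance

/-! ### Translations, the antipode and the symmetry of links -/

section Antipode

open HopfAlgebra

variable {k H : Type*} [Field k] [Ring H] [HopfAlgebra k H]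

theorem translate_mul {g : H} (hg : IsGroupLikeElem k g) (f f' : ConvDual k H) :
    translate g (f * f') = translate g f * translate g f' :=
  WithConv.ext (LinearMap.ext fun x => by
    change pair f f' (Coalgebra.comul (R := k) (x * g)) = _
    rw [Bialgebra.comul_mul, hg.comul_eq_tmul_self, pair_mul_tmul]
    rfl)

theorem translate_translate (g h : H) (f : ConvDual k H) :
    translate g (translate h f) = translate (g * h) f :=
  WithConv.ext (LinearMap.ext fun x => by simp [mul_assoc])

/-- Translation by a group-like element. -/
def translateEquiv {g : H} (hg : IsGroupLikeElem k g) : ConvDual k H ≃ₗ[k] ConvDual k H where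
  toFun := translate g
  map_add' _ _ := rfl
  map_smul' _ _ := rfl
  invFun := translate (antipode k g)
  left_inv f := by rw [translate_translate, hg.antipode_mul_cancel, translate_one]
  right_inv f := by rw [translate_translate, hg.mul_antipode_cancel, translate_one]

theorem translate_mem_annPow_iff (M : MatrixCoeffs k H) {g : H} (hg : IsGroupLikeElem k g) {n : ℕ}
    {f : ConvDual k H} : translate g f ∈ annPow M.total n ↔ f ∈ annPow M.total n :=
  M.map_mem_annPow_iff (T := translateEquiv hg) (Or.inl (translate_mul hg))

variable [FiniteDimensional k H]

variable (k H) in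
theorem antipode_surjective : Function.Surjective (antipode k (A := H)) :=
  LinearMap.injective_iff_surjective.1 antipode_injective

variable (k H) in
/-- Composition with the antipode, as an automorphism of the dual space. -/
def compAntipodeEquiv : ConvDual k H ≃ₗ[k] ConvDual k H :=
  LinearEquiv.ofInjectiveEndo
    { toFun := compAntipode
      map_add' := fun _ _ => rfl
      map_smul' := fun _ _ => rfl }
    fun f g h => WithConv.ext (LinearMap.ext fun x => by
      obtain ⟨y, rfl⟩ := antipode_surjective k H x
      exact congrArg (fun φ : ConvDual k H => φ y) h)

theorem compAntipodeEquiv_apply (f : ConvDual k H) (x : H) :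
    compAntipodeEquiv k H f x = f (antipode k x) := rfl

theorem compAntipodeEquiv_mul (f g : ConvDual k H) : compAntipodeEquiv k H (f * g) =
    compAntipodeEquiv k H g * compAntipodeEquiv k H f :=
  compAntipode_mul f g

theorem leftHit_antipode (f : ConvDual k H) (x : H) :
    leftHit f (antipode k x) = antipode k (rightHit (compAntipodeEquiv k H f) x) := by
  refine eq_of_forall_apply_eq (k := k) fun g => ?_
  rw [apply_leftHit, ← compAntipodeEquiv_apply, compAntipodeEquiv_mul, ← compAntipodeEquiv_apply,
    apply_rightHit]

theorem rightHit_antipode (f : ConvDual k H) (x : H) :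
    rightHit f (antipode k x) = antipode k (leftHit (compAntipodeEquiv k H f) x) := by
  refine eq_of_forall_apply_eq (k := k) fun g => ?_
  rw [apply_rightHit, ← compAntipodeEquiv_apply, compAntipodeEquiv_mul, ← compAntipodeEquiv_apply,
    apply_leftHit]

theorem hitStable_map_antipode {D : Submodule k H} (hD : HitStable D) :
    HitStable (D.map (antipode k)) := by
  rintro f _ ⟨x, hx, rfl⟩
  rw [leftHit_antipode, rightHit_antipode]
  exact ⟨Submodule.mem_map_of_mem (hD _ _ hx).2, Submodule.mem_map_of_mem (hD _ _ hx).1⟩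

theorem hitStable_comap_antipode {D : Submodule k H} (hD : HitStable D) :
    HitStable (D.comap (antipode k)) := by
  intro f x hx
  obtain ⟨f, rfl⟩ := (compAntipodeEquiv k H).surjective f
  rw [Submodule.mem_comap, Submodule.mem_comap, ← leftHit_antipode, ← rightHit_antipode]
  exact (hD _ _ hx).symm

theorem isSimpleSubcoalgebra_map_antipode {D : Submodule k H} (hD : IsSimpleSubcoalgebra D) :
    IsSimpleSubcoalgebra (D.map (antipode k)) where
  isSubcoalgebra := isSubcoalgebra_iff_hitStable.2
    (hitStable_map_antipode (isSubcoalgebra_iff_hitStable.1 hD.isSubcoalgebra))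
  ne_bot h := hD.ne_bot (Submodule.map_injective_of_injective
    (antipode_injective (k := k) (H := H)) (h.trans (Submodule.map_bot _).symm))
  eq_bot_or_eq E hE hE' := by
    have h1 := hD.eq_bot_or_eq (E.comap (antipode k))
      (fun x hx => by
        obtain ⟨y, hy, hxy⟩ := hE hx
        exact antipode_injective hxy ▸ hy)
      (isSubcoalgebra_iff_hitStable.2
        (hitStable_comap_antipode (isSubcoalgebra_iff_hitStable.1 hE')))
    rw [← Submodule.map_comap_eq_of_surjective (antipode_surjective k H) E]
    exact h1.imp (fun h => by rw [h, Submodule.map_bot]) fun h => by rw [h]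

namespace BlockSystem

variable (S : BlockSystem k H) (M : MatrixCoeffs k H)

/-- The antipode permutes the simple subcoalgebras and reverses the links between them. -/
theorem exists_antipode_perm : ∃ σ : Fin M.r → Fin M.r, (∀ i, M.d (σ i) = M.d i) ∧
    ∀ n i j, S.Link M n i j → S.Link M n (σ j) (σ i) := by
  have h1 : ∀ i, ∃ j, (M.D i).map (antipode k) = M.D j := fun i =>
    M.exists_eq_D (isSimpleSubcoalgebra_map_antipode (M.isSimpleSubcoalgebra_D i))
  choose σ hσ using h1
  have hinj : Function.Injective σ := fun i j hij => by
    refine M.D_injective (Submodule.map_injective_of_injective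
      (antipode_injective (k := k) (H := H)) ?_)
    rw [hσ, hσ, hij]
  refine ⟨σ, fun i => ?_, fun n i j h => ?_⟩
  · rw [← finrank_D_eq_sq_iff, ← hσ, ← M.finrank_D]
    exact (Submodule.equivMapOfInjective _ antipode_injective _).finrank_eq.symm
  · have hT : (∀ f g, compAntipodeEquiv k H (f * g) =
        compAntipodeEquiv k H f * compAntipodeEquiv k H g) ∨
        ∀ f g, compAntipodeEquiv k H (f * g) =
          compAntipodeEquiv k H g * compAntipodeEquiv k H f := Or.inr compAntipodeEquiv_mul
    have hmem : ∀ l a b, antipode k (M.e l a b) ∈ M.D (σ l) := fun l a b =>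
      hσ l ▸ Submodule.mem_map_of_mem (M.e_mem_D l a b)
    -- The antipode carries D_l onto D_{σ l} and preserves the counit, so ε_{σ l} ∘ S agrees with
    -- ε_l on the coradical.
    have heps : ∀ l, compAntipodeEquiv k H (S.eps M (σ l)) - S.eps M l ∈ ann M.total := by
      intro l
      rw [mem_ann_total_iff]
      intro l' a b
      rw [WithConv.ofConv_sub, LinearMap.sub_apply, compAntipodeEquiv_apply]
      by_cases hl : l = l'
      · subst hl
        rw [S.eps_apply_self M (hmem l a b), S.eps_apply_self M (M.e_mem_D l a b),
          counit_antipode, sub_self]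
      · rw [S.eps_apply_ne M (fun h => hl (hinj h)) (hmem l' a b),
          S.eps_apply_ne M hl (M.e_mem_D l' a b), sub_zero]
    obtain ⟨f, hf, hfn⟩ := h
    refine ⟨(compAntipodeEquiv k H).symm f, M.map_mem_annPow (symm_mul_or hT) hf, fun hcon => hfn ?_⟩
    have h2 := M.map_mem_annPow hT hcon
    rw [compAntipodeEquiv_mul, compAntipodeEquiv_mul, LinearEquiv.apply_symm_apply,
      ← mul_assoc] at h2
    have hU := M.hitStable_total
    set p := compAntipodeEquiv k H (S.eps M (σ i))
    set q := compAntipodeEquiv k H (S.eps M (σ j))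
    -- Exchanging each idempotent for its congruent partner costs a factor in J, so the two
    -- corrections lie in J^{n+1}.
    have h3 : S.eps M i * f * S.eps M j =
        p * f * q - (p - S.eps M i) * (f * q) - S.eps M i * (f * (q - S.eps M j)) := by
      rw [sub_mul, mul_sub, mul_sub]
      simp only [mul_assoc]
      abel
    rw [h3]
    refine sub_mem (sub_mem h2 ?_) (mul_mem_annPow_left _ ?_)
    · rw [hU.annPow_succ']
      exact Submodule.mul_mem_mul (heps i) (hU.mul_mem_annPow_right _ hf)
    · exact Submodule.mul_mem_mul hf (heps j)

end BlockSystem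

end Antipode

/-! ### Socle elements and radical layers -/

section Layers

variable {k C : Type*} [Field k] [AddCommGroup C] [Module k C] [Coalgebra k C]

/-- If n + 1 is the least exponent with J^{n+1} x = 0, any b in J^n with b * x ≠ 0 works. -/
theorem exists_mul_ne_zero_and_ann_mul_eq_zero (M : MatrixCoeffs k C) {x : ConvDual k C}
    (hx : x ≠ 0) : ∃ b, b * x ≠ 0 ∧ ∀ f ∈ ann M.total, f * (b * x) = 0 := by
  classical
  have hN : ∃ n, ∀ f ∈ annPow M.total n, f * x = 0 := by
    obtain ⟨N, hN⟩ := M.exists_pow_eq_bot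
    have hbot : annPow M.total N = ⊥ := hN
    refine ⟨N, fun f hf => ?_⟩
    rw [hbot, Submodule.mem_bot] at hf
    rw [hf, zero_mul]
  have hspec := Nat.find_spec hN
  have hpos : Nat.find hN ≠ 0 := fun h => by
    rw [h] at hspec
    exact hx (by simpa using hspec 1 trivial)
  obtain ⟨n, hn⟩ := Nat.exists_eq_succ_of_ne_zero hpos
  rw [hn] at hspec
  have hlt := Nat.find_min hN (m := n) (by omega)
  push Not at hlt
  obtain ⟨b, hb, hbx⟩ := hlt
  refine ⟨b, hbx, fun f hf => ?_⟩
  rw [← mul_assoc]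
  refine hspec _ ?_
  rw [Nat.succ_eq_add_one, M.hitStable_total.annPow_succ']
  exact Submodule.mul_mem_mul hf hb

theorem eq_zero_of_forall_mem_annPow (M : MatrixCoeffs k C) {x : ConvDual k C}
    (hx : ∀ n, x ∈ annPow M.total n) : x = 0 := by
  obtain ⟨N, hN⟩ := M.exists_pow_eq_bot
  have hbot : annPow M.total N = ⊥ := hN
  have := hx N
  rwa [hbot, Submodule.mem_bot] at this

theorem exists_layer (M : MatrixCoeffs k C) {x : ConvDual k C} (hx : x ≠ 0) :
    ∃ n, x ∈ annPow M.total n ∧ x ∉ annPow M.total (n + 1) := by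
  by_contra! hcon
  refine hx (eq_zero_of_forall_mem_annPow M fun n => ?_)
  induction n with
  | zero => trivial
  | succ n ih => exact hcon n ih

end Layers

/-! ### Translates of the integral inside left ideals -/

section IntegralLayer

open HopfAlgebra

variable {k H : Type*} [Field k] [Ring H] [HopfAlgebra k H] [FiniteDimensional k H]
  {lam : ConvDual k H}

namespace IsInt

/-- Right multiplication by this element corresponds to `leftHit q` under the isomorphism given
by the integral. -/
def rightMul (hlam : IsInt lam) (h0 : lam ≠ 0) (q : ConvDual k H) : ConvDual k H :=
  hlam.equiv h0 (leftHit q ((hlam.equiv h0).symm 1))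

/-- `leftHit q` commutes with the left action, so it becomes an endomorphism of the left regular
module, which is right multiplication by the image of 1. -/
theorem equiv_leftHit (hlam : IsInt lam) (h0 : lam ≠ 0) (q : ConvDual k H) (y : H) :
    hlam.equiv h0 (leftHit q y) = hlam.equiv h0 y * hlam.rightMul h0 q := by
  have hy : y = rightHit (hlam.equiv h0 y) ((hlam.equiv h0).symm 1) := by
    apply (hlam.equiv h0).injective
    rw [← hlam.mul_equiv, LinearEquiv.apply_symm_apply, mul_one]
  conv_lhs => rw [hy, leftHit_rightHit, ← hlam.mul_equiv]
  rfl

theorem mul_equiv_groupLike (hlam : IsInt lam) (h0 : lam ≠ 0) {g : H} (hg : IsGroupLikeElem k g)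
    (f : ConvDual k H) : f * hlam.equiv h0 g = f g • hlam.equiv h0 g := by
  rw [hlam.mul_equiv, rightHit_groupLike hg, map_smul]

theorem equiv_groupLike_mul (hlam : IsInt lam) (h0 : lam ≠ 0) {a g : H}
    (ha : ∀ f, lam * f = f a • lam) (hg : IsGroupLikeElem k g) (f : ConvDual k H) :
    hlam.equiv h0 g * f = f (a * g) • hlam.equiv h0 g := by
  have h1 : f = translate (antipode k g) (translate g f) := by
    rw [translate_translate, hg.antipode_mul_cancel, translate_one]
  have h2 : hlam.equiv h0 g = translate (antipode k g) lam := rfl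
  conv_lhs => rw [h1]
  rw [h2, ← translate_mul hg.antipode, ha]
  rfl

theorem equiv_mem_annPow_iff (hlam : IsInt lam) (h0 : lam ≠ 0) (M : MatrixCoeffs k H) {g : H}
    (hg : IsGroupLikeElem k g) {n : ℕ} :
    hlam.equiv h0 g ∈ annPow M.total n ↔ lam ∈ annPow M.total n :=
  translate_mem_annPow_iff M hg.antipode

variable (S : BlockSystem k H) (M : MatrixCoeffs k H)

/-- Every nonzero left ideal generated by an element `x = x ε_j`, with `ε_j` belonging to a
group-like element, contains a translate of the integral. -/
theorem exists_mul_eq_equiv (hlam : IsInt lam) (h0 : lam ≠ 0) {a : H}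
    (ha : IsGroupLikeElem k a) (hla : ∀ f, lam * f = f a • lam) {j : Fin M.r} (hj : M.d j = 1)
    {x : ConvDual k H} (hx : x ≠ 0) (hxj : x * S.eps M j = x) :
    ∃ b, b * x = hlam.equiv h0 (antipode k a * M.corner j) := by
  have hU := M.hitStable_total
  set g := antipode k a * M.corner j with hg_def
  have hg : IsGroupLikeElem k g := ha.antipode.mul (MatrixCoeffs.isGroupLikeElem_corner hj)
  have hag : a * g = M.corner j := by
    rw [hg_def, ← mul_assoc, ha.mul_antipode_cancel, one_mul]
  obtain ⟨i₀, hi₀, hcorner⟩ := M.exists_corner_eq hg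
  obtain ⟨b, hb0, hb⟩ := exists_mul_ne_zero_and_ann_mul_eq_zero M hx
  set y := (hlam.equiv h0).symm (b * x) with hy_def
  have hey : hlam.equiv h0 y = b * x := LinearEquiv.apply_symm_apply _ _
  -- The isomorphism is left A-linear, so elements killed by J on the left correspond to the
  -- coradical.
  have hy : y ∈ M.total := by
    rw [← coann_ann M.total, mem_coann]
    intro f hf
    have h1 := hb f hf
    rw [← hey, hlam.mul_equiv, LinearEquiv.map_eq_zero_iff] at h1
    rw [← one_mul f, ← apply_rightHit, h1, map_zero]
  have hyD : ∀ i, rightHit (S.eps M i) y ∈ M.D i := fun i => by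
    refine M.total_induction (p := fun y => rightHit (S.eps M i) y ∈ M.D i) ?_ ?_ ?_ ?_ hy
    · rw [map_zero]; exact zero_mem _
    · intro p q hp hq; rw [map_add]; exact add_mem hp hq
    · intro c p hp; rw [map_smul]; exact Submodule.smul_mem _ _ hp
    · intro l p q
      rw [M.rightHit_e]
      by_cases hil : i = l
      · subst hil
        exact sum_mem fun c _ => Submodule.smul_mem _ _ (M.e_mem_D _ _ _)
      · refine sum_mem fun c _ => ?_
        rw [S.eps_apply_ne M hil (M.e_mem_D _ _ _), zero_smul]
        exact zero_mem _
  have hleft : ∀ i, ∀ z ∈ M.D i, leftHit (S.eps M i) z = z := fun i z hz => by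
    refine eq_of_forall_apply_eq (k := k) fun f => ?_
    rw [apply_leftHit]
    have h1 : ∀ l ≠ i, (S.eps M l * f) z = 0 := fun l hl => by
      rw [← apply_rightHit, S.eps_apply_ne M hl ((M.hitStable_D i) f z hz).2]
    conv_rhs => rw [← one_mul f, ← S.sum_eps M, Finset.sum_mul, WithConv.ofConv_sum,
      LinearMap.sum_apply]
    exact (Finset.sum_eq_single i (fun l _ hl => h1 l hl) (by simp)).symm
  -- Right multiplication by ν, the counterpart of `leftHit` by ε_i, fixes X, and so does ε_j.
  -- Comparing with T_g, where that hit gives 0 because g belongs to i₀, shows ν(a g) = 0, hence ε_j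
  -- ν is in J. Thus X = X ε_j ν lies in every power of J.
  have hzero : ∀ i ≠ i₀, S.eps M i * (b * x) = 0 := by
    intro i hi
    set X := S.eps M i * (b * x) with hX
    have hXe : X = hlam.equiv h0 (rightHit (S.eps M i) y) := by
      rw [← hlam.mul_equiv, hey]
    have hXj : X * S.eps M j = X := by rw [hX, mul_assoc, mul_assoc, hxj]
    set ν := hlam.rightMul h0 (S.eps M i)
    have hXν : X * ν = X := by
      conv_lhs => rw [hXe]
      rw [← hlam.equiv_leftHit, hleft i _ (hyD i), ← hXe]
    have hν : ν (M.corner j) = 0 := by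
      have h1 := hlam.equiv_leftHit h0 (S.eps M i) g
      rw [leftHit_groupLike hg, ← hcorner, S.eps_corner_ne M hi, zero_smul, map_zero, hcorner,
        hlam.equiv_groupLike_mul h0 hla hg, hag] at h1
      refine (smul_eq_zero.1 h1.symm).resolve_right ?_
      rw [LinearEquiv.map_eq_zero_iff]
      exact hg.ne_zero
    have hc : S.eps M j * ν ∈ ann M.total := by
      have := S.eps_mul_sub_mem M hj ν
      rwa [hν, zero_smul, sub_zero] at this
    refine eq_zero_of_forall_mem_annPow M fun n => ?_
    induction n with
    | zero => trivial
    | succ n ih =>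
      rw [← hXν, ← hXj, mul_assoc]
      exact Submodule.mul_mem_mul ih hc
  have hbx : b * x = hlam.equiv h0 (rightHit (S.eps M i₀) y) := by
    rw [← hlam.mul_equiv, hey]
    conv_lhs => rw [← one_mul (b * x), ← S.sum_eps M, Finset.sum_mul]
    exact Finset.sum_eq_single i₀ (fun l _ hl => hzero l hl) (by simp)
  have hspan := hyD i₀
  rw [MatrixCoeffs.D_eq_span_corner hi₀, hcorner] at hspan
  obtain ⟨c, hc⟩ := Submodule.mem_span_singleton.1 hspan
  rw [← hc, map_smul] at hbx
  have hc0 : c ≠ 0 := by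
    rintro rfl
    rw [zero_smul] at hbx
    exact hb0 hbx
  exact ⟨c⁻¹ • b, by rw [smul_mul_assoc, hbx, smul_smul, inv_mul_cancel₀ hc0, one_smul]⟩

end IsInt

end IntegralLayer

/-! ### The largest degree with a nonzero block of group-like type -/

section TopLayer

open HopfAlgebra

variable {k H : Type*} [Field k] [Ring H] [HopfAlgebra k H] [FiniteDimensional k H]
  {lam : ConvDual k H} (S : BlockSystem k H) (M : MatrixCoeffs k H)

theorem BlockSystem.Link.exists_ne_zero {S : BlockSystem k H} {M : MatrixCoeffs k H} {n : ℕ}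
    {i j : Fin M.r} (h : S.Link M n i j) : ∃ x ∈ annPow M.total n, x ∉ annPow M.total (n + 1) ∧
      x ≠ 0 ∧ S.eps M i * x = x ∧ x * S.eps M j = x := by
  obtain ⟨f, hf, hfn⟩ := h
  refine ⟨S.eps M i * f * S.eps M j,
    M.hitStable_total.mul_mem_annPow_right _ (mul_mem_annPow_left _ hf), hfn, ?_, ?_, ?_⟩
  · intro h
    exact hfn (h ▸ zero_mem _)
  · rw [← mul_assoc, ← mul_assoc, S.eps_mul_eps_self]
  · rw [mul_assoc, S.eps_mul_eps_self]

namespace IsInt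

/-- A nonzero x in J^n ending in ε_j generates a left ideal inside J^n that contains a translate of
λ, and translates lie in the same powers of J as λ. -/
theorem link_le (hlam : IsInt lam) (h0 : lam ≠ 0) {a : H} (ha : IsGroupLikeElem k a)
    (hla : ∀ f, lam * f = f a • lam) {s n : ℕ} (hs : lam ∉ annPow M.total (s + 1)) {i j : Fin M.r}
    (hj : M.d j = 1) (h : S.Link M n i j) : n ≤ s := by
  obtain ⟨x, hx, -, hx0, -, hxj⟩ := h.exists_ne_zero
  obtain ⟨b, hb⟩ := hlam.exists_mul_eq_equiv S M h0 ha hla hj hx0 hxj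
  have hg := ha.antipode.mul (MatrixCoeffs.isGroupLikeElem_corner hj)
  have h1 : lam ∈ annPow M.total n := by
    rw [← hlam.equiv_mem_annPow_iff h0 M hg, ← hb]
    exact mul_mem_annPow_left _ hx
  by_contra hn
  exact hs (M.hitStable_total.annPow_antitone (by omega) h1)

/-- Put x = ε_i f ε_j and b x = T. Modulo J only the part b(g_i) ε_i of b ε_i remains, so T ≡ b(g_i)
x modulo J^{s+1}; the scalar is nonzero because T is not in J^{s+1}. -/
theorem exists_sub_smul_mem (hlam : IsInt lam) (h0 : lam ≠ 0) {a : H} (ha : IsGroupLikeElem k a)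
    (hla : ∀ f, lam * f = f a • lam) {s : ℕ} (hs : lam ∉ annPow M.total (s + 1)) {i j : Fin M.r}
    (hi : M.d i = 1) (hj : M.d j = 1) {f : ConvDual k H} (hf : f ∈ annPow M.total s) :
    ∃ c : k, S.eps M i * f * S.eps M j - c • hlam.equiv h0 (antipode k a * M.corner j) ∈
      annPow M.total (s + 1) := by
  have hU := M.hitStable_total
  by_cases hx : S.eps M i * f * S.eps M j ∈ annPow M.total (s + 1)
  · exact ⟨0, by rwa [zero_smul, sub_zero]⟩
  · set x := S.eps M i * f * S.eps M j with hx_def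
    have hxs : x ∈ annPow M.total s := hU.mul_mem_annPow_right _ (mul_mem_annPow_left _ hf)
    have hxi : S.eps M i * x = x := by rw [hx_def, ← mul_assoc, ← mul_assoc, S.eps_mul_eps_self]
    have hxj : x * S.eps M j = x := by rw [hx_def, mul_assoc, S.eps_mul_eps_self]
    obtain ⟨b, hb⟩ := hlam.exists_mul_eq_equiv S M h0 ha hla hj
      (fun h : x = 0 => hx (by rw [h]; exact zero_mem _)) hxj
    have hg := ha.antipode.mul (MatrixCoeffs.isGroupLikeElem_corner hj)
    set g := antipode k a * M.corner j
    have h1 : hlam.equiv h0 g - b (M.corner i) • x ∈ annPow M.total (s + 1) := by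
      have h2 : hlam.equiv h0 g - b (M.corner i) • x =
          (b * S.eps M i - b (M.corner i) • S.eps M i) * x := by
        rw [sub_mul, mul_assoc, smul_mul_assoc, hxi, hb]
      rw [h2, hU.annPow_succ']
      exact Submodule.mul_mem_mul (S.mul_eps_sub_mem M hi b) hxs
    have hc : b (M.corner i) ≠ 0 := fun hc => by
      rw [hc, zero_smul, sub_zero, hlam.equiv_mem_annPow_iff h0 M hg] at h1
      exact hs h1
    refine ⟨(b (M.corner i))⁻¹, ?_⟩
    have h2 : x - (b (M.corner i))⁻¹ • hlam.equiv h0 g =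
        -(b (M.corner i))⁻¹ • (hlam.equiv h0 g - b (M.corner i) • x) := by
      rw [neg_smul, smul_sub, smul_smul, inv_mul_cancel₀ hc, one_smul, neg_sub]
    rw [h2]
    exact Submodule.smul_mem _ _ h1

theorem eps_mul_equiv (hlam : IsInt lam) (h0 : lam ≠ 0) {g : H} (hg : IsGroupLikeElem k g)
    {i : Fin M.r} (hi : M.corner i = g) :
    S.eps M i * hlam.equiv h0 g = hlam.equiv h0 g := by
  rw [hlam.mul_equiv_groupLike h0 hg, ← hi, S.eps_corner, one_smul]

theorem equiv_mul_eps (hlam : IsInt lam) (h0 : lam ≠ 0) {a g : H}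
    (hla : ∀ f, lam * f = f a • lam) (hg : IsGroupLikeElem k g) {j : Fin M.r}
    (hj : M.corner j = a * g) : hlam.equiv h0 g * S.eps M j = hlam.equiv h0 g := by
  rw [hlam.equiv_groupLike_mul h0 hla hg, ← hj, S.eps_corner, one_smul]

theorem link_layer (hlam : IsInt lam) (h0 : lam ≠ 0) {a g : H}
    (hla : ∀ f, lam * f = f a • lam) (hg : IsGroupLikeElem k g) {s : ℕ}
    (hs : lam ∈ annPow M.total s) (hs' : lam ∉ annPow M.total (s + 1)) {i j : Fin M.r}
    (hi : M.corner i = g) (hj : M.corner j = a * g) : S.Link M s i j := by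
  refine ⟨hlam.equiv h0 g, (hlam.equiv_mem_annPow_iff h0 M hg).2 hs, ?_⟩
  rwa [hlam.eps_mul_equiv S M h0 hg hi, hlam.equiv_mul_eps S M h0 hla hg hj,
    hlam.equiv_mem_annPow_iff h0 M hg]

theorem isGreatest_layer (hlam : IsInt lam) (h0 : lam ≠ 0) {a : H} (ha : IsGroupLikeElem k a)
    (hla : ∀ f, lam * f = f a • lam) {s : ℕ}
    (hs : lam ∈ annPow M.total s) (hs' : lam ∉ annPow M.total (s + 1)) :
    IsGreatest {n : ℕ | S.block 1 1 n ≠ ⊥} s := by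
  constructor
  · rcases Nat.eq_zero_or_pos s with rfl | hpos
    · obtain ⟨i, hi, -⟩ := M.exists_corner_eq (IsGroupLikeElem.one (R := k) (A := H))
      rw [Set.mem_ofPred_eq, BlockSystem.block, if_pos rfl, if_pos rfl,
        BlockSystem.coradicalPart_eq M]
      intro h
      have hle : M.D i ≤ ⊥ := h ▸ le_iSup_of_le i (le_iSup_of_le hi le_rfl)
      exact (M.isSimpleSubcoalgebra_D i).ne_bot (eq_bot_iff.2 hle)
    · obtain ⟨i, hi, hi'⟩ := M.exists_corner_eq (IsGroupLikeElem.one (R := k) (A := H))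
      obtain ⟨j, hj, hj'⟩ := M.exists_corner_eq (ha.mul (IsGroupLikeElem.one (R := k) (A := H)))
      exact (S.block_ne_bot_iff M hpos 1 1).2
        ⟨i, j, hi, hj, hlam.link_layer S M h0 hla IsGroupLikeElem.one hs hs' hi' hj'⟩
  · intro n hn
    rcases Nat.eq_zero_or_pos n with rfl | hpos
    · exact Nat.zero_le s
    · obtain ⟨i, j, -, hj, h⟩ := (S.block_ne_bot_iff M hpos 1 1).1 hn
      exact hlam.link_le S M h0 ha hla hs' hj h

end IsInt

end TopLayer

/-! ### A basis with a prescribed coordinate functional -/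

section LinearAlgebra

variable {k V : Type*} [Field k] [AddCommGroup V] [Module k V] [FiniteDimensional k V]

/-- Extend u to a basis by vectors of T in ker φ; φ then has the values of the coordinate at u. -/
theorem exists_basis_coord_eq {T : Set V} {φ : V →ₗ[k] k} {u : V} (hu : φ u = 1) (huT : u ∈ T)
    (hspan : Submodule.span k (insert u {x ∈ T | φ x = 0}) = ⊤) :
    ∃ (b : Module.Basis (Fin (Module.finrank k V)) k V) (i : Fin (Module.finrank k V)),
      (∀ j, b j ∈ T) ∧ b i = u ∧ b.coord i = φ := by
  have hu0 : u ≠ 0 := by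
    rintro rfl
    rw [map_zero] at hu
    exact zero_ne_one hu
  have hlin : LinearIndepOn k id ({u} : Set V) := linearIndepOn_singleton_iff k |>.2 hu0
  obtain ⟨B, hBT, huB, hspanB, hB⟩ := exists_linearIndepOn_id_extension hlin
    (Set.singleton_subset_iff.2 (Set.mem_insert u {x ∈ T | φ x = 0}))
  have htop : ⊤ ≤ Submodule.span k (Set.range ((↑) : B → V)) := by
    rw [Subtype.range_coe, ← hspan]
    exact Submodule.span_le.2 hspanB
  let b := Module.Basis.mk hB htop
  have hb : ∀ x : B, b x = x := fun x => Module.Basis.mk_apply hB htop x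
  have : Fintype B := FiniteDimensional.fintypeBasisIndex b
  let e : B ≃ Fin (Module.finrank k V) :=
    Fintype.equivFinOfCardEq (Module.finrank_eq_card_basis b).symm
  have huB' : u ∈ B := huB rfl
  refine ⟨b.reindex e, e ⟨u, huB'⟩, fun j => ?_, ?_, ?_⟩
  · rw [Module.Basis.reindex_apply, hb]
    rcases hBT (e.symm j).2 with h | h
    · rw [h]; exact huT
    · exact h.1
  · rw [Module.Basis.reindex_apply, e.symm_apply_apply, hb]
  · refine (b.reindex e).ext fun j => ?_
    rw [Module.Basis.coord_apply, Module.Basis.repr_self, Module.Basis.reindex_apply, hb]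
    by_cases hj : j = e ⟨u, huB'⟩
    · rw [hj, Finsupp.single_eq_same, e.symm_apply_apply, hu]
    · rw [Finsupp.single_eq_of_ne (Ne.symm hj)]
      rcases hBT (e.symm j).2 with h | h
      · exact absurd ((Equiv.symm_apply_eq e).1 (Subtype.ext h)) hj
      · exact h.2.symm

end LinearAlgebra

/-! ### Dimension of the top block and the integral as a dual basis functional -/

section TopBlock

open HopfAlgebra

variable {k H : Type*} [Field k] [Ring H] [HopfAlgebra k H] [FiniteDimensional k H]
  {lam : ConvDual k H} (S : BlockSystem k H) (M : MatrixCoeffs k H)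

namespace BlockSystem

theorem leftHit_rightHit_eps_of_mem_Q {n : ℕ} (hn : 1 ≤ n) (i j i' j' : Fin M.r) {x : H}
    (hx : x ∈ S.Q (M.D i') (M.D j') n) :
    leftHit (S.eps M i) (rightHit (S.eps M j) x) = if i = i' ∧ j = j' then x else 0 := by
  obtain ⟨-, h1, h2⟩ := (S.mem_component M).1 (S.Q_le_component M hn _ _ hx)
  split_ifs with h
  · obtain ⟨rfl, rfl⟩ := h
    rw [h2, h1]
  · by_cases hi : i = i'
    · have hj : j ≠ j' := fun hj => h ⟨hi, hj⟩
      refine eq_zero_of_forall_apply (k := k) fun f => ?_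
      rw [← h2, rightHit_rightHit, S.eps_mul_eps_ne M hj, apply_leftHit, apply_rightHit, mul_zero]
      rfl
    · refine eq_zero_of_forall_apply (k := k) fun f => ?_
      rw [← h1, ← leftHit_rightHit, leftHit_leftHit, S.eps_mul_eps_ne M (Ne.symm hi),
        apply_leftHit, zero_mul]
      rfl

theorem leftHit_rightHit_eps_of_mem_block {n : ℕ} (hn : 1 ≤ n) {d₁ d₂ : ℕ} (i j : Fin M.r) {x : H}
    (hx : x ∈ S.block d₁ d₂ n) :
    leftHit (S.eps M i) (rightHit (S.eps M j) x) ∈ S.Q (M.D i) (M.D j) n ∧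
      (leftHit (S.eps M i) (rightHit (S.eps M j) x) ≠ 0 → M.d i = d₁ ∧ M.d j = d₂) := by
  rw [S.block_eq M hn] at hx
  have key : ∀ (U : Submodule k H) (_ : S.Q (M.D i) (M.D j) n ≤ U ∨ ¬(M.d i = d₁ ∧ M.d j = d₂)),
      leftHit (S.eps M i) (rightHit (S.eps M j) x) ∈ U := by
    intro U hU
    refine (iSup_le fun i' => iSup_le fun j' => iSup_le fun h₁ => iSup_le fun h₂ => ?_ :
      _ ≤ U.comap (leftHit (S.eps M i) ∘ₗ rightHit (S.eps M j))) hx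
    intro y hy
    rw [Submodule.mem_comap, LinearMap.comp_apply, S.leftHit_rightHit_eps_of_mem_Q M hn i j i' j' hy]
    split_ifs with h
    · obtain ⟨rfl, rfl⟩ := h
      exact hU.elim (fun h => h hy) fun h => absurd ⟨h₁, h₂⟩ h
    · exact zero_mem U
  refine ⟨key _ (Or.inl le_rfl), fun h => ?_⟩
  by_contra hcon
  exact h ((Submodule.mem_bot k).1 (key ⊥ (Or.inr hcon)))

theorem eq_sum_leftHit_rightHit_eps (x : H) :
    x = ∑ i, ∑ j, leftHit (S.eps M i) (rightHit (S.eps M j) x) := by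
  simp_rw [← map_sum, ← rightHit_sum, ← leftHit_sum, S.sum_eps, rightHit_one, leftHit_one]

end BlockSystem

namespace IsInt

/-- A nonzero (i, j)-part of x is detected by some f in J^s. Modulo J^{s+1}, which kills x, ε_i f
ε_j is a multiple of a translate of λ, and those vanish at x. -/
theorem eq_zero_of_mem_block (hlam : IsInt lam) (h0 : lam ≠ 0) {a : H} (ha : IsGroupLikeElem k a)
    (hla : ∀ f, lam * f = f a • lam) {s : ℕ} (hpos : 1 ≤ s)
    (hs' : lam ∉ annPow M.total (s + 1)) {x : H} (hx : x ∈ S.block 1 1 s)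
    (h : ∀ g, IsGroupLikeElem k g → hlam.equiv h0 g x = 0) : x = 0 := by
  rw [S.eq_sum_leftHit_rightHit_eps M x]
  refine Finset.sum_eq_zero fun i _ => Finset.sum_eq_zero fun j _ => ?_
  by_contra hne
  obtain ⟨hQ, hd⟩ := S.leftHit_rightHit_eps_of_mem_block M hpos i j hx
  obtain ⟨hi, hj⟩ := hd hne
  obtain ⟨f, hf, hfx, -⟩ := S.exists_apply_ne_zero_of_mem_Q M hpos hQ hne
  obtain ⟨c, hc⟩ := hlam.exists_sub_smul_mem S M h0 ha hla hs' hi hj hf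
  have hker : S.block 1 1 s ≤ S.kerFiltration M s := by
    rw [S.block_eq M hpos]
    refine iSup_le fun i => iSup_le fun j => iSup_le fun _ => iSup_le fun _ y hy => ?_
    exact ((S.mem_component M).1 (S.Q_le_component M hpos _ _ hy)).1
  have h1 := ((S.mem_kerFiltration M).1 (hker hx)).2 _ hc
  rw [WithConv.ofConv_sub, LinearMap.sub_apply, WithConv.ofConv_smul, LinearMap.smul_apply,
    h _ (ha.antipode.mul (MatrixCoeffs.isGroupLikeElem_corner hj)), smul_zero, sub_zero,
    ← apply_rightHit, ← apply_leftHit] at h1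
  exact hfx h1

theorem exists_mem_Q (hlam : IsInt lam) (h0 : lam ≠ 0) {a g : H}
    (hla : ∀ f, lam * f = f a • lam) (hg : IsGroupLikeElem k g) {s : ℕ} (hpos : 1 ≤ s)
    (hs : lam ∈ annPow M.total s) (hs' : lam ∉ annPow M.total (s + 1)) {i j : Fin M.r}
    (hi : M.corner i = g) (hj : M.corner j = a * g) :
    ∃ x ∈ S.Q (M.D i) (M.D j) s, hlam.equiv h0 g x = 1 := by
  obtain ⟨x, hx, hne⟩ := S.exists_mem_Q_apply_ne_zero M hpos (i := i) (j := j)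
    ((hlam.equiv_mem_annPow_iff h0 M hg).2 hs) (by
      rwa [hlam.eps_mul_equiv S M h0 hg hi, hlam.equiv_mul_eps S M h0 hla hg hj,
        hlam.equiv_mem_annPow_iff h0 M hg])
  exact ⟨(hlam.equiv h0 g x)⁻¹ • x, Submodule.smul_mem _ _ hx, by
    rw [map_smul, smul_eq_mul, inv_mul_cancel₀ hne]⟩

theorem equiv_apply_eq_zero (hlam : IsInt lam) (h0 : lam ≠ 0) {g : H} (hg : IsGroupLikeElem k g)
    {n : ℕ} {i j : Fin M.r} (hn : 1 ≤ n) (hi : M.corner i ≠ g) {x : H}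
    (hx : x ∈ S.Q (M.D i) (M.D j) n) : hlam.equiv h0 g x = 0 := by
  obtain ⟨l, -, hl⟩ := M.exists_corner_eq hg
  rw [← hlam.eps_mul_equiv S M h0 hg hl]
  refine S.apply_eq_zero_of_mem_component_left M ?_ (S.Q_le_component M hn _ _ hx) _
  rintro rfl
  exact hi hl

/-- For s ≥ 1 the translates T_g are coordinates on the block: they separate its points, and the
component of type (g, ag) contains a vector on which T_g is 1 and the other translates vanish. For s
= 0 the block is the span of the group-likes, which are independent. -/
theorem finrank_block (hlam : IsInt lam) (h0 : lam ≠ 0) {a : H} (ha : IsGroupLikeElem k a)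
    (hla : ∀ f, lam * f = f a • lam) {s : ℕ}
    (hs : lam ∈ annPow M.total s) (hs' : lam ∉ annPow M.total (s + 1)) :
    Module.finrank k (S.block 1 1 s) = Nat.card (GroupLike k H) := by
  classical
  have hfin : Finite (GroupLike k H) := (linearIndep_groupLikeVal (R := k) (A := H)).finite
  have := Fintype.ofFinite (GroupLike k H)
  rw [Nat.card_eq_fintype_card]
  rcases Nat.eq_zero_or_pos s with rfl | hpos
  · have h1 : S.block 1 1 0 = Submodule.span k (Set.range (GroupLike.val (R := k) (A := H))) := by
      rw [BlockSystem.block, if_pos rfl, if_pos rfl, BlockSystem.coradicalPart_eq M]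
      apply le_antisymm
      · refine iSup_le fun i => iSup_le fun hi => ?_
        rw [MatrixCoeffs.D_eq_span_corner hi]
        exact Submodule.span_mono (Set.singleton_subset_iff.2
          ⟨⟨_, MatrixCoeffs.isGroupLikeElem_corner hi⟩, rfl⟩)
      · rw [Submodule.span_le]
        rintro _ ⟨g, rfl⟩
        obtain ⟨i, hi, hg⟩ := M.exists_corner_eq g.2
        have hle : M.D i ≤ ⨆ (i : Fin M.r) (_ : M.d i = 1), M.D i :=
          le_iSup_of_le i (le_iSup_of_le hi le_rfl)
        exact hle (hg ▸ M.corner_mem_D i)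
    rw [h1, finrank_span_eq_card linearIndep_groupLikeVal]
  · let φ : S.block 1 1 s →ₗ[k] (GroupLike k H → k) :=
      LinearMap.pi fun g => (hlam.equiv h0 g.val).ofConv ∘ₗ (S.block 1 1 s).subtype
    have hφ : ∀ x g, φ x g = hlam.equiv h0 g.val (x : H) := fun _ _ => rfl
    have hinj : Function.Injective φ := by
      rw [injective_iff_map_eq_zero]
      intro x hx
      refine Subtype.ext (hlam.eq_zero_of_mem_block S M h0 ha hla hpos hs' x.2 fun g hg => ?_)
      exact congrFun hx ⟨g, hg⟩
    have hex : ∀ g : GroupLike k H, ∃ x : S.block 1 1 s, φ x = Pi.single g 1 := by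
      intro g
      obtain ⟨i, hi, hgi⟩ := M.exists_corner_eq g.2
      obtain ⟨j, hj, hgj⟩ := M.exists_corner_eq (ha.mul g.2)
      obtain ⟨x, hx, hx1⟩ := hlam.exists_mem_Q S M h0 hla g.2 hpos hs hs' hgi hgj
      refine ⟨⟨x, ?_⟩, funext fun g' => ?_⟩
      · have := S.Q_le_block M hpos i j hx
        rwa [hi, hj] at this
      · rw [hφ]
        by_cases h : g' = g
        · subst h
          rw [Pi.single_eq_same]
          exact hx1
        · rw [Pi.single_eq_of_ne h]
          refine hlam.equiv_apply_eq_zero S M h0 g'.2 hpos (fun h' => h ?_) hx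
          exact GroupLike.ext (h'.symm.trans hgi)
    have hsurj : Function.Surjective φ := by
      intro v
      choose x hx using hex
      refine ⟨∑ g, v g • x g, ?_⟩
      simp_rw [map_sum, map_smul, hx]
      refine funext fun g => ?_
      simp [Finset.sum_apply, Pi.single_apply]
    rw [(LinearEquiv.ofBijective φ ⟨hinj, hsurj⟩).finrank_eq, Module.finrank_fintype_fun_eq_card]

/-- As λ = ε_1 λ ε_a, it can be nonzero only on pieces of type (1, a). It vanishes on those below
degree s because it is in J^s, and there are none above by `link_le`. So a vector of the top block
with λ-value 1 extends by block vectors in ker λ. -/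
theorem exists_basis (hlam : IsInt lam) (h0 : lam ≠ 0) {a : H} (ha : IsGroupLikeElem k a)
    (hla : ∀ f, lam * f = f a • lam) {s : ℕ}
    (hs : lam ∈ annPow M.total s) (hs' : lam ∉ annPow M.total (s + 1)) :
    ∃ (b : Module.Basis (Fin (Module.finrank k H)) k H) (i : Fin (Module.finrank k H)),
      (∀ j, ∃ d₁ d₂ n : ℕ, b j ∈ S.block d₁ d₂ n) ∧ b i ∈ S.block 1 1 s ∧
        IsLeftIntegral (b.coord i) := by
  have hU := M.hitStable_total
  have hone := IsGroupLikeElem.one (R := k) (A := H)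
  have heq1 : hlam.equiv h0 1 = lam := by rw [hlam.equiv_apply, hopfAct_one]
  obtain ⟨i, hi, hi1⟩ := M.exists_corner_eq hone
  obtain ⟨j, hj, hja⟩ := M.exists_corner_eq (ha.mul hone)
  have hil : S.eps M i * lam = lam := by
    have := hlam.eps_mul_equiv S M h0 hone hi1
    rwa [heq1] at this
  have hlj : lam * S.eps M j = lam := by
    have := hlam.equiv_mul_eps S M h0 hla hone hja
    rwa [heq1] at this
  have hD : ∀ l, M.D l ≤ S.block 1 1 s ∨ ∀ x ∈ M.D l, lam x = 0 := by
    intro l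
    rcases Nat.eq_zero_or_pos s with rfl | hpos
    · by_cases hl : l = i
      · left
        rw [BlockSystem.block, if_pos rfl, if_pos rfl, BlockSystem.coradicalPart_eq M, hl]
        exact le_iSup_of_le i (le_iSup_of_le hi le_rfl)
      · right
        intro x hx
        rw [← hil, ← apply_rightHit, S.eps_apply_ne M (Ne.symm hl) ((M.hitStable_D l) lam x hx).2]
    · right
      intro x hx
      have h1 := hU.annPow_antitone hpos hs
      rw [hU.annPow_one] at h1
      exact mem_ann.1 h1 x (M.D_le_total l hx)
  have hQ : ∀ n i' j', 1 ≤ n → S.Q (M.D i') (M.D j') n ≤ S.block 1 1 s ∨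
      ∀ x ∈ S.Q (M.D i') (M.D j') n, lam x = 0 := by
    intro n i' j' hn
    by_cases hj' : j = j'
    swap
    · right
      intro x hx
      rw [← hlj]
      exact S.apply_eq_zero_of_mem_component_right M hj' (S.Q_le_component M hn _ _ hx) _
    subst hj'
    by_cases hi' : i = i'
    swap
    · right
      intro x hx
      rw [← hil]
      exact S.apply_eq_zero_of_mem_component_left M hi' (S.Q_le_component M hn _ _ hx) _
    subst hi'
    rcases lt_trichotomy n s with hns | rfl | hns
    · right
      intro x hx
      exact ((S.mem_kerFiltration M).1 ((S.mem_component M).1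
        (S.Q_le_component M hn _ _ hx)).1).2 _ (hU.annPow_antitone (by omega) hs)
    · left
      have := S.Q_le_block M hn i j
      rwa [hi, hj] at this
    · right
      intro x hx
      have hbot : S.Q (M.D i) (M.D j) n = ⊥ := by
        by_contra hne
        have := hlam.link_le S M h0 ha hla hs' hj ((S.Q_ne_bot_iff M hn i j).1 hne)
        omega
      rw [hbot, Submodule.mem_bot] at hx
      rw [hx, map_zero]
  have hu : ∃ u ∈ S.block 1 1 s, lam u ≠ 0 := by
    by_contra! hcon
    refine h0 (WithConv.ext (LinearMap.ker_eq_top.1 ?_))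
    refine S.eq_top_of_blocks_le M (fun l x hx => ?_) fun n i' j' hn x hx => ?_
    · exact (hD l).elim (fun h => hcon x (h hx)) fun h => h x hx
    · exact (hQ n i' j' hn).elim (fun h => hcon x (h hx)) fun h => h x hx
  obtain ⟨u, hu, hlu⟩ := hu
  set v := (lam u)⁻¹ • u with hv_def
  have hv : v ∈ S.block 1 1 s := Submodule.smul_mem _ _ hu
  have hlv : lam v = 1 := by rw [hv_def, map_smul, smul_eq_mul, inv_mul_cancel₀ hlu]
  obtain ⟨b, l, hbT, hbl, hcoord⟩ := exists_basis_coord_eq (φ := lam.ofConv)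
    (T := {x | ∃ d₁ d₂ n : ℕ, x ∈ S.block d₁ d₂ n}) hlv ⟨1, 1, s, hv⟩ (by
      have key : ∀ (U : Submodule k H) (d₁ d₂ n : ℕ), U ≤ S.block d₁ d₂ n →
          (U ≤ S.block 1 1 s ∨ ∀ x ∈ U, lam x = 0) → U ≤ Submodule.span k
            (insert v {x ∈ {x | ∃ d₁ d₂ n : ℕ, x ∈ S.block d₁ d₂ n} | lam x = 0}) := by
        intro U d₁ d₂ n hU h x hx
        rcases h with h | h
        · rw [← sub_add_cancel x (lam x • v)]
          refine add_mem (Submodule.subset_span (Or.inr ⟨⟨1, 1, s, sub_mem (h hx)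
            (Submodule.smul_mem _ _ hv)⟩, ?_⟩)) (Submodule.smul_mem _ _
              (Submodule.subset_span (Or.inl rfl)))
          rw [map_sub, map_smul, hlv, smul_eq_mul, mul_one, sub_self]
        · exact Submodule.subset_span (Or.inr ⟨⟨d₁, d₂, n, hU hx⟩, h x hx⟩)
      refine S.eq_top_of_blocks_le M (fun l => key _ (M.d l) (M.d l) 0 ?_ (hD l))
        fun n i' j' hn => key _ _ _ n (S.Q_le_block M hn i' j') (hQ n i' j' hn)
      rw [BlockSystem.block, if_pos rfl, if_pos rfl, BlockSystem.coradicalPart_eq M]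
      exact le_iSup_of_le l (le_iSup_of_le rfl le_rfl))
  exact ⟨b, l, hbT, hbl ▸ hv, hcoord ▸ hlam.isLeftIntegral⟩

end IsInt

end TopBlock

/-! ### Consequences of the absence of skew-primitives -/

section SkewPrimitives

open HopfAlgebra

variable {k H : Type*} [Field k] [Ring H] [HopfAlgebra k H] [FiniteDimensional k H]
  {lam : ConvDual k H} (S : BlockSystem k H) (M : MatrixCoeffs k H)

/-- Otherwise only the pieces ε_l J ε_i with d_l = 1 act on x, and these lie in J² by
`not_link_one`. Then Jx ⊆ J²x ⊆ J³x ⊆ ..., which is zero by nilpotency. -/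
theorem BlockSystem.exists_eps_mul_mul_ne_zero (hS : NoNontrivialSkewPrimitives k H) {i : Fin M.r}
    (hi : M.d i = 1) {x : ConvDual k H} (hxi : S.eps M i * x = x)
    (hx : ∃ v ∈ ann M.total, v * x ≠ 0) :
    ∃ i', M.d i' ≠ 1 ∧ ∃ v ∈ ann M.total, S.eps M i' * v * x ≠ 0 := by
  by_contra! hcon
  have hU := M.hitStable_total
  have hone : ∀ q ∈ ann M.total, ∃ q' ∈ annPow M.total 2, q * x = q' * x := by
    intro q hq
    refine ⟨∑ l, if M.d l = 1 then S.eps M l * q * S.eps M i else 0, sum_mem fun l _ => ?_, ?_⟩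
    · split_ifs with hl
      · by_contra h
        exact S.not_link_one M hS hl hi ⟨q, hU.annPow_one ▸ hq, h⟩
      · exact zero_mem _
    · conv_lhs => rw [← one_mul (q * x), ← S.sum_eps M, Finset.sum_mul]
      rw [Finset.sum_mul]
      refine Finset.sum_congr rfl fun l _ => ?_
      split_ifs with hl
      · rw [mul_assoc _ (S.eps M i), hxi, mul_assoc]
      · rw [zero_mul, ← mul_assoc]
        exact hcon l hl q hq
  have hstep : ∀ n, ∀ w ∈ annPow M.total (n + 1), ∃ w' ∈ annPow M.total (n + 2),
      w * x = w' * x := by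
    intro n w hw
    refine Submodule.mul_induction_on hw (fun p hp q hq => ?_) ?_
    · obtain ⟨q', hq', h⟩ := hone q hq
      exact ⟨p * q', hU.mul_mem_annPow hp hq', by rw [mul_assoc, h, mul_assoc]⟩
    · rintro p q ⟨p', hp, hp'⟩ ⟨q', hq, hq'⟩
      exact ⟨p' + q', add_mem hp hq, by rw [add_mul, hp', hq', add_mul]⟩
  obtain ⟨v, hv, hvx⟩ := hx
  have hall : ∀ n, ∃ w ∈ annPow M.total (n + 1), v * x = w * x := by
    intro n
    induction n with
    | zero => exact ⟨v, by rwa [zero_add, hU.annPow_one], rfl⟩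
    | succ n ih =>
      obtain ⟨w, hw, h⟩ := ih
      obtain ⟨w', hw', h'⟩ := hstep n w hw
      exact ⟨w', hw', h.trans h'⟩
  refine hvx (eq_zero_of_forall_mem_annPow M fun n => ?_)
  obtain ⟨w, hw, h⟩ := hall n
  rw [h]
  exact hU.mul_mem_annPow_right _ (hU.annPow_succ_le n hw)

namespace IsInt

/-- Write T = b x with T in J^s ⊆ J^{l+1}. Modulo J^{l+1} this reads b(g_i) x ≡ 0, so b(g_i) = 0 and
T lies in Jx. Hence Jx ≠ 0, and a nonzero ε_{i'} v x with v in J and d_{i'} ≠ 1 lies in a layer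
beyond l. -/
theorem exists_link_lt (hlam : IsInt lam) (h0 : lam ≠ 0) {a : H} (ha : IsGroupLikeElem k a)
    (hla : ∀ f, lam * f = f a • lam) {s : ℕ} (hs : lam ∈ annPow M.total s)
    (hS : NoNontrivialSkewPrimitives k H) {l : ℕ} (hl : l < s) {i j : Fin M.r} (hi : M.d i = 1)
    (hj : M.d j = 1) (h : S.Link M l i j) : ∃ n i', l < n ∧ M.d i' ≠ 1 ∧ S.Link M n i' j := by
  have hU := M.hitStable_total
  obtain ⟨x, hx, hx', hx0, hxi, hxj⟩ := h.exists_ne_zero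
  obtain ⟨b, hb⟩ := hlam.exists_mul_eq_equiv S M h0 ha hla hj hx0 hxj
  have hg := ha.antipode.mul (MatrixCoeffs.isGroupLikeElem_corner hj)
  set g := antipode k a * M.corner j
  have hr := S.mul_eps_sub_mem M hi b
  have hsub : (b * S.eps M i - b (M.corner i) • S.eps M i) * x =
      hlam.equiv h0 g - b (M.corner i) • x := by
    rw [sub_mul, mul_assoc, smul_mul_assoc, hxi, hb]
  have hmem : b (M.corner i) • x ∈ annPow M.total (l + 1) := by
    have h1 : b (M.corner i) • x =
        hlam.equiv h0 g - (b * S.eps M i - b (M.corner i) • S.eps M i) * x := by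
      rw [hsub, sub_sub_cancel]
    rw [h1]
    refine sub_mem (hU.annPow_antitone hl ((hlam.equiv_mem_annPow_iff h0 M hg).2 hs)) ?_
    rw [hU.annPow_succ']
    exact Submodule.mul_mem_mul hr hx
  have hb0 : b (M.corner i) = 0 := by
    by_contra hne
    exact hx' ((Submodule.smul_mem_iff _ hne).1 hmem)
  have hne : (b * S.eps M i - b (M.corner i) • S.eps M i) * x ≠ 0 := by
    rw [hsub, hb0, zero_smul, sub_zero, Ne, LinearEquiv.map_eq_zero_iff]
    exact hg.ne_zero
  obtain ⟨i', hi', v, hv, hz⟩ := S.exists_eps_mul_mul_ne_zero M hS hi hxi ⟨_, hr, hne⟩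
  obtain ⟨n, hn, hn'⟩ := exists_layer M hz
  refine ⟨n, i', ?_, hi', S.eps M i' * v * x, hn, ?_⟩
  · by_contra hcon
    refine hn' (hU.annPow_antitone (by omega : n + 1 ≤ l + 1) ?_)
    rw [hU.annPow_succ']
    exact Submodule.mul_mem_mul (hU.mul_mem_ann_left _ hv) hx
  · rwa [← mul_assoc, ← mul_assoc, S.eps_mul_eps_self, mul_assoc _ x, hxj]

theorem exists_blocks (hlam : IsInt lam) (h0 : lam ≠ 0) {a : H} (ha : IsGroupLikeElem k a)
    (hla : ∀ f, lam * f = f a • lam) {s : ℕ} (hs : lam ∈ annPow M.total s)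
    (hS : NoNontrivialSkewPrimitives k H) {l : ℕ} (hl1 : 1 ≤ l) (hl : l < s)
    (hblock : S.block 1 1 l ≠ ⊥) :
    1 < l ∧ ∃ d₁ d₂ d₃ d₄ l' : ℕ, 1 < d₁ ∧ 1 < d₂ ∧ 1 < d₃ ∧ 1 < d₄ ∧ l < l' ∧
      S.block d₁ 1 l' ≠ ⊥ ∧ S.block 1 d₂ l' ≠ ⊥ ∧
      S.block d₁ d₃ (l' - 1) ≠ ⊥ ∧ S.block d₄ d₂ (l' - 1) ≠ ⊥ := by
  obtain ⟨i, j, hi, hj, hlink⟩ := (S.block_ne_bot_iff M hl1 1 1).1 hblock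
  have hone : l ≠ 1 := by
    rintro rfl
    exact S.not_link_one M hS hi hj hlink
  obtain ⟨n, i', hn, hi', hlink'⟩ := hlam.exists_link_lt S M h0 ha hla hs hS hl hi hj hlink
  obtain ⟨n, rfl⟩ : ∃ n', n = n' + 1 := ⟨n - 1, by omega⟩
  obtain ⟨j', hj₁, hj₂⟩ := hlink'.exists_left
  have hj' : M.d j' ≠ 1 := fun h => S.not_link_one M hS h hj hj₂
  obtain ⟨σ, hσ, hσlink⟩ := S.exists_antipode_perm M
  have h1 := M.d_pos i'
  have h2 := M.d_pos j'
  -- The antipode preserves degrees, so the mirrored blocks allow d₂ = d₁ and d₄ = d₃.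
  refine ⟨by omega, M.d i', M.d i', M.d j', M.d j', n + 1, by omega, by omega, by omega, by omega,
    hn, ?_, ?_, ?_, ?_⟩
  · exact (S.block_ne_bot_iff M (by omega) _ _).2 ⟨i', j, rfl, hj, hlink'⟩
  · exact (S.block_ne_bot_iff M (by omega) _ _).2
      ⟨σ j, σ i', by rw [hσ, hj], hσ i', hσlink _ _ _ hlink'⟩
  · exact (S.block_ne_bot_iff M (by omega) _ _).2 ⟨i', j', rfl, rfl, hj₁⟩
  · exact (S.block_ne_bot_iff M (by omega) _ _).2 ⟨σ j', σ i', hσ j', hσ i', hσlink _ _ _ hj₁⟩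

end IsInt

end SkewPrimitives

end HopfBlock

end

theorem proposition3 {k H : Type*} [Field k] [IsAlgClosed k] [CharZero k]
    [Ring H] [HopfAlgebra k H] [FiniteDimensional k H] (S : HopfBlock.BlockSystem k H) :
    ∃ m : ℕ, IsGreatest {n : ℕ | S.block 1 1 n ≠ ⊥} m ∧
      Module.finrank k (S.block 1 1 m) = Nat.card (GroupLike k H) ∧
      (∃ (b : Module.Basis (Fin (Module.finrank k H)) k H) (i : Fin (Module.finrank k H)),
        (∀ j, ∃ d₁ d₂ n : ℕ, b j ∈ S.block d₁ d₂ n) ∧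
        b i ∈ S.block 1 1 m ∧ HopfBlock.IsLeftIntegral (b.coord i)) ∧
      (∀ l : ℕ, IsLeast {n : ℕ | 1 ≤ n ∧ S.block 1 1 n ≠ ⊥} l → l < m →
        ¬ HopfBlock.IsCosemisimple k H → HopfBlock.NoNontrivialSkewPrimitives k H →
        1 < l ∧ ∃ d₁ d₂ d₃ d₄ l' : ℕ,
          1 < d₁ ∧ 1 < d₂ ∧ 1 < d₃ ∧ 1 < d₄ ∧ l < l' ∧
          S.block d₁ 1 l' ≠ ⊥ ∧ S.block 1 d₂ l' ≠ ⊥ ∧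
          S.block d₁ d₃ (l' - 1) ≠ ⊥ ∧ S.block d₄ d₂ (l' - 1) ≠ ⊥) := by
  obtain ⟨M⟩ := HopfBlock.exists_matrixCoeffs (k := k) (C := H)
  obtain ⟨lam, hlam, h0⟩ := HopfBlock.exists_isInt (k := k) (H := H)
  obtain ⟨a, ha, hla⟩ := hlam.exists_isGroupLikeElem h0
  obtain ⟨s, hs, hs'⟩ := HopfBlock.exists_layer M h0
  exact ⟨s, hlam.isGreatest_layer S M h0 ha hla hs hs', hlam.finrank_block S M h0 ha hla hs hs',
    hlam.exists_basis S M h0 ha hla hs hs', fun l hl hlt _ hS =>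
      hlam.exists_blocks S M h0 ha hla hs hS hl.1.1 hlt hl.1.2⟩
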